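/- **Setting.** A *one-ended space-time* is a smooth spherically symmetric globally hyperbolic Lorentzian manifold with metric $g=-\Omega^2\,du\,dv+r^2(d\theta^2+\sin^2\theta\,d\varphi^2)$, $\Omega^2>0$, $(u,v)\in\mathcal Q\subset\mathbb R^2$, developed to the future from a spacelike curve $\Sigma\subset\mathcal Q$ which starts at a regular centre $\Gamma=\{r=0\}$, has one end along which $v\to+\infty$ and $r\to\infty$, and contains no anti-trapped sphere ($\partial_u r|_\Sigma<0$). (No maximality is needed; the maximal development is included.) The trapped region is $\mathcal T=\{\partial_v r<0\}\subset\mathcal Q$. Say that $u$ *reaches* $v=\infty$ if $(u,v)\in\mathcal Q$ for all large $v$. Let $i^+=(u_{i^+},\infty)$, where $u_{i^+}$ is the supremum (assumed to exist) of the set of $u$ that reach $v=\infty$ and have $\lim_{v\to\infty}r(u,v)=\infty$. The Cauchy horizon $\mathcal{CH}_{i^+}$ is the set of points $(u,\infty)$, $u>u_{i^+}$, such that every $x\in(u_{i^+},u)$ reaches $v=\infty$ and has $\lim_{v\to\infty}r(x,v)\in(0,\infty)$; it is assumed to be non-empty with future end-point $(u_{\mathcal{CH}},\infty)$, $u_{\mathcal{CH}}<\infty$.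 $\mathcal S_{i^+}$ is the set of points $(u,\infty)$, $u>u_{\mathcal{CH}}$, such that every $x\in(u_{\mathcal{CH}},u]$ reaches $v=\infty$ and $r$ extends continuously by $0$ to $(x,\infty)$, i.e. $r(u',v')\to0$ as $\mathcal Q\ni(u',v')\to(x,\infty)$. **(1) Static Cauchy horizons.** Let $q_0\neq0$, $m^2\ge0$, $0<|e|<M$, $s>\tfrac34$, and let $(\mathcal Q,r,\Omega^2,\phi,A,Q)$ be a smooth solution on a one-ended space-time of the spherically symmetric Einstein–Maxwell–Klein–Gordon equations, i.e. $F=dA=\frac{Q\Omega^2}{2r^2}du\wedge dv$, $A=A_u\,du+A_v\,dv$, $Q|_\Gamma=0$, $D=\nabla+iq_0A$ and $$\mathrm{Ric}_{\mu\nu}-\tfrac12Rg_{\mu\nu}=2\bigl(g^{\alpha\beta}F_{\alpha\nu}F_{\beta\mu}-\tfrac14F^{\alpha\beta}F_{\alpha\beta}g_{\mu\nu}\bigr)+2\bigl(\Re(D_\mu\phi\overline{D_\nu\phi})-\tfrac12(g^{\alpha\beta}D_\alpha\phi\overline{D_\beta\phi}+m^2|\phi|^2)g_{\mu\nu}\bigr),$$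 $$\nabla^\mu F_{\mu\nu}=\tfrac{iq_0}2(\phi\overline{D_\nu\phi}-\overline\phi D_\nu\phi),\qquad g^{\mu\nu}D_\mu D_\nu\phi=m^2\phi,$$ imposed in their double null form: $\partial_u\frac{\partial_ur}{\Omega^2}=-\frac r{\Omega^2}|D_u\phi|^2$, $\partial_v\frac{\partial_vr}{\Omega^2}=-\frac r{\Omega^2}|D_v\phi|^2$, $\partial_u\partial_vr=-\frac{\Omega^2}{4r}-\frac{\partial_ur\partial_vr}r+\frac{\Omega^2Q^2}{4r^3}+\frac{m^2r}4\Omega^2|\phi|^2$, $\partial_u\partial_v\log\Omega^2=-2\Re(D_u\phi\overline{D_v\phi})+\frac{\Omega^2}{2r^2}+\frac{2\partial_ur\partial_vr}{r^2}-\frac{\Omega^2Q^2}{r^4}$, $\partial_uQ=-q_0r^2\Im(\phi\overline{D_u\phi})$, $\partial_vQ=q_0r^2\Im(\phi\overline{D_v\phi})$, $D_uD_v\phi=-\frac{\partial_vr}rD_u\phi-\frac{\partial_ur}rD_v\phi+\frac{iq_0Q\Omega^2}{4r^2}\phi-\frac{m^2\Omega^2}4\phi$, $\partial_uA_v-\partial_vA_u=\frac{Q\Omega^2}{2r^2}$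 where $r>0$. Write $\kappa=-\Omega^2/(4\partial_ur)$, $\varpi=\frac r2\bigl(1+\frac{4\partial_ur\,\partial_vr}{\Omega^2}\bigr)+\frac{Q^2}{2r}$, $r_-=M-\sqrt{M^2-e^2}$, $K_-=\frac1{r_-^2}\bigl(M-\frac{e^2}{r_-}\bigr)$. Suppose that $\mathcal{CH}_{i^+}$ is of static type, that is: * $r-r_-$, $|\phi|$, $|D_u\phi|$, $\varpi-M$, $Q-e$ and $\partial_v\log(\Omega^2)-2K_-$ extend continuously by $0$ to every point $(u,\infty)$ with $u_{i^+}<u<u_{\mathcal{CH}}$ (nothing is prescribed at the end-point); * there are $u_1\in(u_{i^+},u_{\mathcal{CH}})$, $C>0$, $v_1>0$ with $(u_1,v_1)\in\mathcal T$, $\{u_1\}\times[v_1,\infty)\subset\mathcal Q$ and, on $\{u_1\}\times[v_1,\infty)$, $$C^{-1}e^{2.01K_-v}\le\Omega^2\le Ce^{1.99K_-v},\quad |\phi|+|D_v\phi|\le Cv^{-s},\quad |\varpi-M|+|Q-e|+|r-r_-|\le Cv^{1-2s},$$ $$|\partial_v\log(\Omega^2)-2K_-|\le Cv^{1-2s},\quad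 |\kappa^{-1}-1|\le Cv^{1-2s},\quad |\partial_vr|\le Cv^{-2s}.$$ Then $\mathcal S_{i^+}=\emptyset$. **(2) Continuity of $r$.** Let a one-ended space-time satisfy the Einstein equations $\mathrm{Ric}-\frac12Rg=\mathbb T$ with any matter such that $\mathbb T_{uu},\mathbb T_{uv},\mathbb T_{vv}\ge0$ away from the centre. Assume $\mathcal S_{i^+}\ne\emptyset$ and that the end-point $(u_{\mathcal{CH}},\infty)$ of $\mathcal{CH}_{i^+}$ has a trapped neighborhood: an open set $\mathcal V\subset\mathbb R\times[-\infty,\infty]$ containing it with $\mathcal V\cap\mathcal Q\subset\mathcal T$. Then $r$ extends to a continuous function on $\mathcal V\cap(\mathcal Q\cup\mathcal{CH}_{i^+}\cup\mathcal S_{i^+})$, with value $0$ at the end-point $(u_{\mathcal{CH}},\infty)$. -/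

import Mathlib

open Set Filter Topology

open scoped ContDiff

noncomputable section

namespace Collapse

/-! Points of the Penrose diagram are pairs `p = (u, v)` of double null coordinates:
`u` is constant on outgoing null rays and `v` is constant on ingoing null rays. -/

/-- Partial derivative in the ingoing null direction. -/
def du {E : Type*} [NormedAddCommGroup E] [NormedSpace ℝ E] (f : ℝ × ℝ → E) (p : ℝ × ℝ) : E :=
  deriv (fun x : ℝ => f (x, p.2)) p.1

/-- Partial derivative in the outgoing null direction. -/
def dv {E : Type*} [NormedAddCommGroup E] [NormedSpace ℝ E] (f : ℝ × ℝ → E) (p : ℝ × ℝ) : E :=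
  deriv (fun y : ℝ => f (p.1, y)) p.2

/-- A smooth, spherically symmetric, one-ended, globally hyperbolic space-time
`g = - Ω² du dv + r² (dθ² + sin² θ dφ²)` to the future of an initial hypersurface that has a
regular centre and contains no anti-trapped sphere. The functions are total; only their values
on `Q` and near `Q` matter (near a boundary point of `Q`: a smooth extension).
The coordinate `v` is normalized to be `+∞` at the asymptotically flat end. No maximality is
demanded, so that the maximal development is one of the objects described. -/
structure OneEnded where
  /-- the Penrose diagram, including its boundary curves (initial curve and centre) -/
  Q : Set (ℝ × ℝ)
  /-- the area-radius -/
  r : ℝ × ℝ → ℝ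
  /-- the null lapse `Ω²` -/
  lapse : ℝ × ℝ → ℝ
  /-- the initial curve is `u = σ v`, `v ≥ vc` -/
  σ : ℝ → ℝ
  vc : ℝ
  smooth_r : ∀ p ∈ Q, ContDiffAt ℝ ∞ r p
  smooth_lapse : ∀ p ∈ Q, ContDiffAt ℝ ∞ lapse p
  lapse_pos : ∀ p ∈ Q, 0 < lapse p
  r_nonneg : ∀ p ∈ Q, 0 ≤ r p
  /-- the initial curve is a smooth space-like curve in `Q` -/
  smooth_σ : ∀ v, vc ≤ v → ContDiffAt ℝ ∞ σ v
  spacelike_σ : ∀ v, vc ≤ v → deriv σ v < 0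
  initial_mem : ∀ v, vc ≤ v → (σ v, v) ∈ Q
  /-- the initial curve starts at the centre ... -/
  initial_center : r (σ vc, vc) = 0
  /-- ... and has one asymptotic end -/
  initial_end : Tendsto (fun v => r (σ v, v)) atTop atTop
  /-- no anti-trapped sphere on the initial curve -/
  no_antitrapped : ∀ v, vc ≤ v → du r (σ v, v) < 0
  /-- past-directed ingoing null rays in `Q` end on the initial curve -/
  past_ingoing : ∀ u v, (u, v) ∈ Q →
    vc ≤ v ∧ σ v ≤ u ∧ ∀ x ∈ Icc (σ v) u, (x, v) ∈ Q
  /-- past-directed outgoing null rays in `Q` end on the centre or on the initial curve -/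
  past_outgoing : ∀ u v, (u, v) ∈ Q →
    ∃ w ≤ v, (r (u, w) = 0 ∨ (vc ≤ w ∧ u = σ w)) ∧ ∀ y ∈ Icc w v, (u, y) ∈ Q
  /-- the centre is a boundary of `Q` ... -/
  center_left : ∀ u v w, (u, v) ∈ Q → (u, w) ∈ Q → r (u, w) = 0 → w ≤ v
  /-- ... and the metric is regular (elementarily flat) there: `g (∇ r, ∇ r) = 1` -/
  center_regular : ∀ p ∈ Q, r p = 0 → -4 * du r p * dv r p / lapse p = 1
  /-- `Q` has no boundary points of its own besides the centre and the initial curve -/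
  interior_mem : ∀ p ∈ Q, r p ≠ 0 → p.1 ≠ σ p.2 → Q ∈ 𝓝 p

namespace OneEnded

variable (S : OneEnded)

/-- The centre of symmetry. -/
def center : Set (ℝ × ℝ) := {p | p ∈ S.Q ∧ S.r p = 0}

/-- The trapped region. -/
def trapped : Set (ℝ × ℝ) := {p | p ∈ S.Q ∧ dv S.r p < 0}

/-- The outgoing null ray with coordinate `u` lies in the space-time for all large `v`, so that
`(u, ∞)` is an ideal boundary point. -/
def Reaches (u : ℝ) : Prop := ∀ᶠ v in atTop, (u, v) ∈ S.Q

/-- Approach to the ideal boundary point `(u, ∞)` from within the space-time. -/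
def approach (u : ℝ) : Filter (ℝ × ℝ) := (𝓝 u ×ˢ atTop) ⊓ 𝓟 S.Q

/-- The `u`-coordinates of the points of null infinity: `r → ∞` along the outgoing ray. -/
def scri : Set ℝ := {u | S.Reaches u ∧ Tendsto (fun v => S.r (u, v)) atTop atTop}

/-- `i⁺ = (ui, ∞)` is the future end-point of null infinity. -/
def IsTimelikeInfinity (ui : ℝ) : Prop := IsLUB S.scri ui

/-- The `u`-coordinates of the points of the Cauchy horizon emanating from `i⁺ = (ui, ∞)`: the
half-open null segment emanating from (and not including) `i⁺` on which `r` has a strictly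
positive limit along outgoing rays, except maybe at its future end-point. -/
def cauchyHorizon (ui : ℝ) : Set ℝ :=
  {u | ui < u ∧ ∀ x ∈ Ioo ui u,
    S.Reaches x ∧ ∃ l : ℝ, 0 < l ∧ Tendsto (fun v => S.r (x, v)) atTop (𝓝 l)}

/-- `(uc, ∞)` is the future end-point of the (then non-empty) Cauchy horizon. -/
def IsCauchyHorizonEnd (ui uc : ℝ) : Prop := IsLUB (S.cauchyHorizon ui) uc

/-- The `u`-coordinates of the points of `𝓢_{i⁺}`: the null segment emanating from (and not
including) the end-point `(uc, ∞)`, to which `r` extends continuously by zero. -/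
def singularSegment (uc : ℝ) : Set ℝ :=
  {u | uc < u ∧ ∀ x ∈ Ioc uc u, S.Reaches x ∧ Tendsto S.r (S.approach x) (𝓝 0)}

/-- `f` extends continuously by `0` to the ideal boundary point `(u, ∞)`. -/
def ExtendsByZero (f : ℝ × ℝ → ℝ) (u : ℝ) : Prop := Tendsto f (S.approach u) (𝓝 0)

/-- The Hawking mass `r / 2 * (1 - g (∇ r, ∇ r))`. -/
def hawkingMass (p : ℝ × ℝ) : ℝ :=
  S.r p / 2 * (1 - (-4 * du S.r p * dv S.r p / S.lapse p))

/-- `κ = - Ω² / (4 ∂ᵤ r)`. -/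
def kappa (p : ℝ × ℝ) : ℝ := -S.lapse p / (4 * du S.r p)

/-- The component `G_uu` of the Einstein tensor (away from the centre). -/
def einsteinUU (p : ℝ × ℝ) : ℝ :=
  -(2 / S.r p) * S.lapse p * du (fun q => du S.r q / S.lapse q) p

/-- The component `G_vv` of the Einstein tensor (away from the centre). -/
def einsteinVV (p : ℝ × ℝ) : ℝ :=
  -(2 / S.r p) * S.lapse p * dv (fun q => dv S.r q / S.lapse q) p

/-- The component `G_uv` of the Einstein tensor (away from the centre). -/
def einsteinUV (p : ℝ × ℝ) : ℝ :=
  2 / S.r p * (du (dv S.r) p + du S.r p * dv S.r p / S.r p + S.lapse p / (4 * S.r p))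

/-- The energy condition `T_uu, T_uv, T_vv ≥ 0` on the matter, whose energy-momentum tensor is
`T = G` by the Einstein equations. -/
def NullEnergyCondition : Prop :=
  ∀ p ∈ S.Q, S.r p ≠ 0 → 0 ≤ S.einsteinUU p ∧ 0 ≤ S.einsteinUV p ∧ 0 ≤ S.einsteinVV p

end OneEnded

/-- A charged scalar field `φ`, an electromagnetic potential `Au du + Av dv` and a charge
function `e`, where `F = e Ω² / (2 r²) du ∧ dv`. -/
structure Matter where
  φ : ℝ × ℝ → ℂ
  Au : ℝ × ℝ → ℝ
  Av : ℝ × ℝ → ℝ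
  charge : ℝ × ℝ → ℝ

namespace Matter

variable (F : Matter)

/-- The gauge derivative `D_u = ∂_u + i q₀ A_u`. -/
def covU (q₀ : ℝ) (ψ : ℝ × ℝ → ℂ) (p : ℝ × ℝ) : ℂ :=
  du ψ p + Complex.I * (q₀ : ℂ) * (F.Au p : ℂ) * ψ p

/-- The gauge derivative `D_v = ∂_v + i q₀ A_v`. -/
def covV (q₀ : ℝ) (ψ : ℝ × ℝ → ℂ) (p : ℝ × ℝ) : ℂ :=
  dv ψ p + Complex.I * (q₀ : ℂ) * (F.Av p : ℂ) * ψ p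

/-- The modified mass: Hawking mass plus `Q² / (2 r)`. -/
def modifiedMass (S : OneEnded) (p : ℝ × ℝ) : ℝ :=
  S.hawkingMass p + F.charge p ^ 2 / (2 * S.r p)

end Matter

/-- The Einstein-Maxwell-Klein-Gordon equations in double null coordinates, with coupling
constant `q₀` and squared Klein-Gordon mass `m2`, for a smooth solution on `S.Q`. The equations
are imposed away from the centre, where the charge vanishes. -/
structure IsEMKG (S : OneEnded) (F : Matter) (q₀ m2 : ℝ) : Prop where
  smooth_φ : ∀ p ∈ S.Q, ContDiffAt ℝ ∞ F.φ p
  smooth_Au : ∀ p ∈ S.Q, ContDiffAt ℝ ∞ F.Au p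
  smooth_Av : ∀ p ∈ S.Q, ContDiffAt ℝ ∞ F.Av p
  smooth_charge : ∀ p ∈ S.Q, ContDiffAt ℝ ∞ F.charge p
  charge_center : ∀ p ∈ S.Q, S.r p = 0 → F.charge p = 0
  wave_lapse : ∀ p ∈ S.Q, S.r p ≠ 0 →
    du (dv (fun q => Real.log (S.lapse q))) p =
      -2 * (F.covU q₀ F.φ p * starRingEnd ℂ (F.covV q₀ F.φ p)).re
        + S.lapse p / (2 * S.r p ^ 2) + 2 * du S.r p * dv S.r p / S.r p ^ 2
        - S.lapse p / S.r p ^ 4 * F.charge p ^ 2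
  wave_r : ∀ p ∈ S.Q, S.r p ≠ 0 →
    du (dv S.r) p =
      -S.lapse p / (4 * S.r p) - du S.r p * dv S.r p / S.r p
        + S.lapse p / (4 * S.r p ^ 3) * F.charge p ^ 2
        + m2 * S.r p / 4 * S.lapse p * ‖F.φ p‖ ^ 2
  wave_φ : ∀ p ∈ S.Q, S.r p ≠ 0 →
    F.covU q₀ (F.covV q₀ F.φ) p =
      -((dv S.r p / S.r p : ℝ) : ℂ) * F.covU q₀ F.φ p
        - ((du S.r p / S.r p : ℝ) : ℂ) * F.covV q₀ F.φ p
        + Complex.I * ((q₀ * F.charge p * S.lapse p / (4 * S.r p ^ 2) : ℝ) : ℂ) * F.φ p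
        - ((m2 * S.lapse p / 4 : ℝ) : ℂ) * F.φ p
  maxwell_u : ∀ p ∈ S.Q, S.r p ≠ 0 →
    du F.charge p = -q₀ * S.r p ^ 2 * (F.φ p * starRingEnd ℂ (F.covU q₀ F.φ p)).im
  maxwell_v : ∀ p ∈ S.Q, S.r p ≠ 0 →
    dv F.charge p = q₀ * S.r p ^ 2 * (F.φ p * starRingEnd ℂ (F.covV q₀ F.φ p)).im
  raychaudhuri_u : ∀ p ∈ S.Q, S.r p ≠ 0 →
    du (fun q => du S.r q / S.lapse q) p = -S.r p / S.lapse p * ‖F.covU q₀ F.φ p‖ ^ 2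
  raychaudhuri_v : ∀ p ∈ S.Q, S.r p ≠ 0 →
    dv (fun q => dv S.r q / S.lapse q) p = -S.r p / S.lapse p * ‖F.covV q₀ F.φ p‖ ^ 2
  potential : ∀ p ∈ S.Q, S.r p ≠ 0 →
    du F.Av p - dv F.Au p = F.charge p * S.lapse p / (2 * S.r p ^ 2)

/-- The radius `r₋` of the Reissner-Nordström Cauchy horizon of mass `M` and charge `e`. -/
def rMinus (M e : ℝ) : ℝ := M - √(M ^ 2 - e ^ 2)

/-- `K₋`, where `2 K₋ = (2 / r₋²) (M - e² / r₋)` is the surface gravity of the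
Reissner-Nordström Cauchy horizon. -/
def kMinus (M e : ℝ) : ℝ := 1 / rMinus M e ^ 2 * (M - e ^ 2 / rMinus M e)

/-- The Cauchy horizon `{(u, ∞) | ui < u < uc}` is of static type, with Reissner-Nordström
parameters `M`, `e` and decay rate `s`: the geometry and the field extend continuously to it by
the values on the Reissner-Nordström Cauchy horizon, and approach these values at the stated
rates on one trapped outgoing cone. The value at the end-point `(uc, ∞)` is not prescribed. -/
structure IsStaticType (S : OneEnded) (F : Matter) (q₀ M e s ui uc : ℝ) : Prop where
  extend_r : ∀ u ∈ Ioo ui uc, S.ExtendsByZero (fun p => S.r p - rMinus M e) u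
  extend_φ : ∀ u ∈ Ioo ui uc, S.ExtendsByZero (fun p => ‖F.φ p‖) u
  extend_Du_φ : ∀ u ∈ Ioo ui uc, S.ExtendsByZero (fun p => ‖F.covU q₀ F.φ p‖) u
  extend_mass : ∀ u ∈ Ioo ui uc, S.ExtendsByZero (fun p => F.modifiedMass S p - M) u
  extend_charge : ∀ u ∈ Ioo ui uc, S.ExtendsByZero (fun p => F.charge p - e) u
  extend_lapse : ∀ u ∈ Ioo ui uc,
    S.ExtendsByZero (fun p => dv (fun q => Real.log (S.lapse q)) p - 2 * kMinus M e) u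
  cone : ∃ u₁ ∈ Ioo ui uc, ∃ C > 0, ∃ v₁ > 0, (u₁, v₁) ∈ S.trapped ∧ ∀ v ≥ v₁,
    (u₁, v) ∈ S.Q ∧
    C⁻¹ * Real.exp (2.01 * kMinus M e * v) ≤ S.lapse (u₁, v) ∧
    S.lapse (u₁, v) ≤ C * Real.exp (1.99 * kMinus M e * v) ∧
    ‖F.φ (u₁, v)‖ + ‖F.covV q₀ F.φ (u₁, v)‖ ≤ C * v ^ (-s) ∧
    |F.modifiedMass S (u₁, v) - M| + |F.charge (u₁, v) - e| + |S.r (u₁, v) - rMinus M e|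
      ≤ C * v ^ (1 - 2 * s) ∧
    |dv (fun q => Real.log (S.lapse q)) (u₁, v) - 2 * kMinus M e| ≤ C * v ^ (1 - 2 * s) ∧
    |(S.kappa (u₁, v))⁻¹ - 1| ≤ C * v ^ (1 - 2 * s) ∧
    |dv S.r (u₁, v)| ≤ C * v ^ (-(2 * s))

/-- The inclusion of the coordinate plane into the plane with `v = ∞` added. -/
def embed (p : ℝ × ℝ) : ℝ × EReal := (p.1, (p.2 : EReal))

end Collapse

end

noncomputable section

namespace Collapse

/-! ### Partial derivatives of smooth functions of two variables -/

section Calculus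

/-! Continuity of `r` rests on a Lipschitz bound for `r²`. On a trapped rectangle `[a, b] × [V, ∞)`,
Raychaudhuri makes `∂ᵥ r / Ω²` nonincreasing in `v`, so `-∂ᵥ r ≥ c Ω²` with `c > 0` read off on `v =
V`. The condition `T_uv ≥ 0` says `∂ᵥ (r ∂ᵤ r) ≥ -Ω² / 4`, which is at least `∂ᵥ r / (4 c)`;
integration bounds `r ∂ᵤ r` from below, and `∂ᵤ r < 0` because no sphere is anti-trapped
(`du_r_neg`). Hence `r²` is Lipschitz in `u` uniformly in `v` (`exists_lipschitz_r_sq`), its limits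
at `v = ∞` vary continuously, and the value `0` on the singular segment forces `0` at the end-point
of the Cauchy horizon.

Emptiness of the singular segment is proved by contradiction: a point of it provides outgoing rays
up to `v = ∞` beyond `uc`, and two bootstraps in `u` then keep `r` away from zero on one of them.

The first bootstrap (`exists_static_bounds`) controls the solution along the static horizon with
constants that do not degenerate at `uc`. There `Ω²` decays exponentially in `v`. Since `r` is
constant on `v = ∞`, `-∂ᵤ r` is at most a multiple of `Ω²`; an excess would persist up to `v = ∞`
and make `r` drop there. Since `Dᵤ φ` vanishes on `v = ∞`, integrating its equation backwards from
there gives `|Dᵤ φ| ≲ Ω² · sup (|φ|, |r Dᵥ φ|)`. The integrals in `u` are therefore integrals of `Ω²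
≤ -8 ∂ᵤ r`, bounded by the variation of `r` whatever the length in `u`. A Grönwall argument with
weight `exp (-L r)` bounds the field by its size on the first cone (`exists_field_le`). Charge and
`∂ᵥ log Ω²` follow (`exists_improved`): since `r₋ < |e|`, the charge term in the equation for `∂ᵥ
log Ω²` has the favourable sign.

The bounds pass to the cone `u = uc` by continuity. The second bootstrap (`exists_r_ge_of_cone`)
runs beyond it, where nothing is known at `v = ∞`, so `r Dᵤ φ` is allowed to grow like `√v`. The
bounds `φ = O(√v)`, `r Dᵥ φ = O(1 / √v)`, `Q = O(v)` are consistent with this: the product `Dᵤ φ ·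
Dᵥ φ` stays bounded, and every other dangerous term carries the exponentially small `Ω²`. On a
`u`-interval of length independent of `v` all quantities change little, so `r` has a positive lower
bound on a cone where it was assumed to tend to `0`. -/

lemma mapsTo_fst_hasDerivAt (p : ℝ × ℝ) :
    HasDerivAt (fun x : ℝ => ((x, p.2) : ℝ × ℝ)) (1, 0) p.1 :=
  (hasDerivAt_id p.1).prodMk (hasDerivAt_const p.1 p.2)

lemma mapsTo_snd_hasDerivAt (p : ℝ × ℝ) :
    HasDerivAt (fun y : ℝ => ((p.1, y) : ℝ × ℝ)) (0, 1) p.2 :=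
  (hasDerivAt_const p.2 p.1).prodMk (hasDerivAt_id p.2)

variable {E : Type*} [NormedAddCommGroup E] [NormedSpace ℝ E] {f g : ℝ × ℝ → E} {p : ℝ × ℝ}

lemma hasDerivAt_du_of_differentiableAt (h : DifferentiableAt ℝ f p) :
    HasDerivAt (fun x => f (x, p.2)) (fderiv ℝ f p (1, 0)) p.1 :=
  HasFDerivAt.comp_hasDerivAt (f := fun x : ℝ => ((x, p.2) : ℝ × ℝ)) p.1
    (by simpa using h.hasFDerivAt) (mapsTo_fst_hasDerivAt p)

lemma hasDerivAt_dv_of_differentiableAt (h : DifferentiableAt ℝ f p) :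
    HasDerivAt (fun y => f (p.1, y)) (fderiv ℝ f p (0, 1)) p.2 :=
  HasFDerivAt.comp_hasDerivAt (f := fun y : ℝ => ((p.1, y) : ℝ × ℝ)) p.2
    (by simpa using h.hasFDerivAt) (mapsTo_snd_hasDerivAt p)

lemma hasDerivAt_du (h : ContDiffAt ℝ ∞ f p) :
    HasDerivAt (fun x => f (x, p.2)) (du f p) p.1 := by
  have := hasDerivAt_du_of_differentiableAt (h.differentiableAt (by simp))
  unfold du
  rwa [this.deriv]

lemma hasDerivAt_dv (h : ContDiffAt ℝ ∞ f p) :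
    HasDerivAt (fun y => f (p.1, y)) (dv f p) p.2 := by
  have := hasDerivAt_dv_of_differentiableAt (h.differentiableAt (by simp))
  unfold dv
  rwa [this.deriv]

lemma eventually_differentiableAt (h : ContDiffAt ℝ ∞ f p) :
    ∀ᶠ q in 𝓝 p, DifferentiableAt ℝ f q := by
  have h1 : ContDiffAt ℝ 1 f p := h.of_le (by exact_mod_cast le_top)
  filter_upwards [h1.eventually (by simp)] with q hq
  exact hq.differentiableAt (by simp)

lemma du_eventuallyEq (h : ContDiffAt ℝ ∞ f p) :
    du f =ᶠ[𝓝 p] fun q => fderiv ℝ f q (1, 0) := by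
  filter_upwards [eventually_differentiableAt h] with q hq
  exact (hasDerivAt_du_of_differentiableAt hq).deriv

lemma dv_eventuallyEq (h : ContDiffAt ℝ ∞ f p) :
    dv f =ᶠ[𝓝 p] fun q => fderiv ℝ f q (0, 1) := by
  filter_upwards [eventually_differentiableAt h] with q hq
  exact (hasDerivAt_dv_of_differentiableAt hq).deriv

lemma contDiffAt_fderiv_apply (h : ContDiffAt ℝ ∞ f p) (w : ℝ × ℝ) :
    ContDiffAt ℝ ∞ (fun q => fderiv ℝ f q w) p :=
  (h.fderiv_right (m := ∞) (by exact_mod_cast le_top)).clm_apply contDiffAt_const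

lemma contDiffAt_du (h : ContDiffAt ℝ ∞ f p) : ContDiffAt ℝ ∞ (du f) p :=
  (contDiffAt_fderiv_apply h _).congr_of_eventuallyEq (du_eventuallyEq h)

lemma contDiffAt_dv (h : ContDiffAt ℝ ∞ f p) : ContDiffAt ℝ ∞ (dv f) p :=
  (contDiffAt_fderiv_apply h _).congr_of_eventuallyEq (dv_eventuallyEq h)

lemma eventuallyEq_comp_fst {α : Type*} {f g : ℝ × ℝ → α} (h : f =ᶠ[𝓝 p] g) :
    (fun x => f (x, p.2)) =ᶠ[𝓝 p.1] fun x => g (x, p.2) := by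
  have : Tendsto (fun x : ℝ => ((x, p.2) : ℝ × ℝ)) (𝓝 p.1) (𝓝 p) :=
    (Continuous.prodMk_left p.2).tendsto p.1
  exact this.eventually h

lemma eventuallyEq_comp_snd {α : Type*} {f g : ℝ × ℝ → α} (h : f =ᶠ[𝓝 p] g) :
    (fun y => f (p.1, y)) =ᶠ[𝓝 p.2] fun y => g (p.1, y) := by
  have : Tendsto (fun y : ℝ => ((p.1, y) : ℝ × ℝ)) (𝓝 p.2) (𝓝 p) :=
    (Continuous.prodMk_right p.1).tendsto p.2
  exact this.eventually h

/-- Partial derivatives commute. -/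
lemma du_dv_comm (h : ContDiffAt ℝ ∞ f p) : dv (du f) p = du (dv f) p := by
  have hd : DifferentiableAt ℝ (fderiv ℝ f) p :=
    (h.fderiv_right (m := ∞) (by exact_mod_cast le_top)).differentiableAt (by simp)
  have hs : ∀ w₁ w₂ : ℝ × ℝ,
      fderiv ℝ (fun q => fderiv ℝ f q w₁) p w₂ = fderiv ℝ (fderiv ℝ f) p w₂ w₁ := by
    intro w₁ w₂
    have := (hd.hasFDerivAt.clm_apply (hasFDerivAt_const w₁ p)).fderiv
    rw [this]; simp
  have h1 : dv (du f) p = fderiv ℝ (fderiv ℝ f) p (0, 1) (1, 0) := by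
    unfold dv
    rw [(eventuallyEq_comp_snd (du_eventuallyEq h)).deriv_eq, ← hs]
    exact (hasDerivAt_dv_of_differentiableAt
      ((contDiffAt_fderiv_apply h _).differentiableAt (by simp))).deriv
  have h2 : du (dv f) p = fderiv ℝ (fderiv ℝ f) p (1, 0) (0, 1) := by
    unfold du
    rw [(eventuallyEq_comp_fst (dv_eventuallyEq h)).deriv_eq, ← hs]
    exact (hasDerivAt_du_of_differentiableAt
      ((contDiffAt_fderiv_apply h _).differentiableAt (by simp))).deriv
  rw [h1, h2]
  exact (h.isSymmSndFDerivAt (by simpa using (WithTop.coe_le_coe.2 le_top : ((2 : ℕ∞) : WithTop ℕ∞) ≤ ∞))).eq _ _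

end Calculus

/-! ### Comparison along a segment and real induction -/

section Comparison

variable {a b : ℝ}

lemma sub_le_sub_of_hasDerivAt_le {f g f' g' : ℝ → ℝ} (hab : a ≤ b)
    (hf : ∀ t ∈ Icc a b, HasDerivAt f (f' t) t) (hg : ∀ t ∈ Icc a b, HasDerivAt g (g' t) t)
    (h : ∀ t ∈ Icc a b, f' t ≤ g' t) : f b - f a ≤ g b - g a := by
  have hm : MonotoneOn (fun t => g t - f t) (Icc a b) := by
    apply monotoneOn_of_hasDerivWithinAt_nonneg (convex_Icc a b)
      (f' := fun t => g' t - f' t)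
    · intro t ht
      exact ((hg t ht).sub (hf t ht)).continuousAt.continuousWithinAt
    · intro t ht
      exact ((hg t (interior_subset ht)).sub (hf t (interior_subset ht))).hasDerivWithinAt
    · intro t ht
      exact sub_nonneg.2 (h t (interior_subset ht))
  have := hm (left_mem_Icc.2 hab) (right_mem_Icc.2 hab) hab
  simp only at this
  linarith

lemma abs_sub_le_of_abs_hasDerivAt_le {f g f' g' : ℝ → ℝ} (hab : a ≤ b)
    (hf : ∀ t ∈ Icc a b, HasDerivAt f (f' t) t) (hg : ∀ t ∈ Icc a b, HasDerivAt g (g' t) t)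
    (h : ∀ t ∈ Icc a b, |f' t| ≤ g' t) : |f b - f a| ≤ g b - g a := by
  rw [abs_le]
  have h1 := sub_le_sub_of_hasDerivAt_le hab hf hg fun t ht => (abs_le.1 (h t ht)).2
  have h2 := sub_le_sub_of_hasDerivAt_le hab (fun t ht => (hf t ht).neg) hg
    fun t ht => by have := (abs_le.1 (h t ht)).1; linarith
  simp only [Pi.neg_apply] at h2
  constructor <;> linarith

/-- Transport along a curve by a metric connection changes norms only through the source. -/
lemma abs_norm_sub_norm_le_of_transport {ψ F : ℝ → ℂ} {A g g' : ℝ → ℝ} (hab : a ≤ b)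
    (hψ : ∀ t ∈ Icc a b, HasDerivAt ψ (F t - Complex.I * (A t : ℂ) * ψ t) t)
    (hg : ∀ t ∈ Icc a b, HasDerivAt g (g' t) t) (h : ∀ t ∈ Icc a b, ‖F t‖ ≤ g' t) :
    |‖ψ b‖ - ‖ψ a‖| ≤ g b - g a := by
  -- The norm may fail to be differentiable where `ψ` vanishes; `√(‖ψ‖² + ε)` is differentiable
  -- everywhere, and `ε → 0` at the end.
  have key : ∀ ε > 0, |√(‖ψ b‖ ^ 2 + ε) - √(‖ψ a‖ ^ 2 + ε)| ≤ g b - g a := by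
    intro ε hε
    refine abs_sub_le_of_abs_hasDerivAt_le (f := fun t => √(‖ψ t‖ ^ 2 + ε))
      (f' := fun t => (2 * inner ℝ (ψ t) (F t - Complex.I * (A t : ℂ) * ψ t)) /
        (2 * √(‖ψ t‖ ^ 2 + ε))) hab ?_ hg ?_
    · intro t ht
      have h1 := ((hψ t ht).norm_sq.add_const ε).sqrt (by positivity)
      exact h1
    · intro t ht
      refine le_trans ?_ (h t ht)
      -- The connection term `i A ψ` with real `A` is orthogonal to `ψ`, so the gauge potential
      -- drops out.
      have h1 : inner ℝ (ψ t) (F t - Complex.I * (A t : ℂ) * ψ t) = inner ℝ (ψ t) (F t) := by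
        simp only [Complex.inner, Complex.mul_re, Complex.sub_re, Complex.sub_im, Complex.mul_im,
          Complex.conj_re, Complex.conj_im, Complex.I_re, Complex.I_im, Complex.ofReal_re,
          Complex.ofReal_im]
        ring
      rw [h1, mul_div_mul_left _ _ two_ne_zero, abs_div, abs_of_pos (a := √_) (by positivity)]
      rw [div_le_iff₀ (by positivity)]
      calc |inner ℝ (ψ t) (F t)| ≤ ‖ψ t‖ * ‖F t‖ := abs_real_inner_le_norm _ _
        _ ≤ √(‖ψ t‖ ^ 2 + ε) * ‖F t‖ := by
          gcongr; exact Real.le_sqrt_of_sq_le (by linarith)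
        _ = _ := mul_comm _ _
  have hc : ∀ z : ℂ, Tendsto (fun ε : ℝ => √(‖z‖ ^ 2 + ε)) (𝓝[>] 0) (𝓝 ‖z‖) := by
    intro z
    have : Continuous (fun ε : ℝ => √(‖z‖ ^ 2 + ε)) := by fun_prop
    have h2 := (this.tendsto 0).mono_left (nhdsWithin_le_nhds (s := Ioi 0))
    simpa using h2
  exact le_of_tendsto ((hc _).sub (hc _)).abs (eventually_mem_nhdsWithin.mono key)

/-- Real induction on a compact interval. -/
lemma continuity_induction {P : ℝ → Prop} (ha : P a)
    (hclosed : ∀ u ∈ Ioc a b, (∀ w ∈ Ico a u, P w) → P u)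
    (hopen : ∀ u ∈ Ico a b, (∀ w ∈ Icc a u, P w) → ∀ᶠ w in 𝓝[>] u, P w) :
    ∀ u ∈ Icc a b, P u := by
  intro u hu
  by_contra hPu
  set s : Set ℝ := {w | w ∈ Icc a b ∧ ¬ P w}
  have hne : s.Nonempty := ⟨u, hu, hPu⟩
  have hbdd : BddBelow s := ⟨a, fun w hw => hw.1.1⟩
  set c := sInf s
  have hac : a ≤ c := le_csInf hne fun w hw => hw.1.1
  have hcu : c ≤ u := csInf_le hbdd ⟨hu, hPu⟩
  have hcb : c ≤ b := hcu.trans hu.2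
  have hlt : ∀ w ∈ Ico a c, P w := by
    intro w hw
    by_contra hPw
    exact absurd (csInf_le hbdd ⟨⟨hw.1, hw.2.le.trans hcb⟩, hPw⟩) (not_le.2 hw.2)
  have hPc : P c := by
    rcases hac.eq_or_lt with h | h
    · rwa [← h]
    · exact hclosed c ⟨h, hcb⟩ hlt
  have hcb' : c < b := by
    rcases hcb.eq_or_lt with h | h
    · have : u = c := le_antisymm (h ▸ hu.2) hcu
      exact absurd (this ▸ hPc) hPu
    · exact h
  have hle : ∀ w ∈ Icc a c, P w := by
    intro w hw
    rcases hw.2.eq_or_lt with h | h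
    · rwa [h]
    · exact hlt w ⟨hw.1, h⟩
  obtain ⟨d, hd, hdP⟩ := (mem_nhdsGT_iff_exists_Ioo_subset).1 (hopen c ⟨hac, hcb'⟩ hle)
  have : d ≤ c := le_csInf hne fun w hw => by
    by_contra hwd
    have hcw : c ≤ w := csInf_le hbdd hw
    rcases hcw.eq_or_lt with h | h
    · exact hw.2 (h ▸ hPc)
    · exact hw.2 (hdP ⟨h, not_le.1 hwd⟩)
  exact absurd hd (not_lt.2 this)

end Comparison

/-! ### Bulk points, Raychaudhuri monotonicity and absence of anti-trapped spheres -/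

namespace OneEnded

variable (S : OneEnded)

/-- The interior points of the space-time away from the centre. -/
def bulk : Set (ℝ × ℝ) := {p | S.Q ∈ 𝓝 p ∧ 0 < S.r p}

variable {S} {p : ℝ × ℝ}

lemma mem_of_bulk (hp : p ∈ S.bulk) : p ∈ S.Q := mem_of_mem_nhds hp.1

lemma r_pos_of_bulk (hp : p ∈ S.bulk) : 0 < S.r p := hp.2

lemma r_contDiffAt (hp : p ∈ S.bulk) : ContDiffAt ℝ ∞ S.r p := S.smooth_r p (mem_of_bulk hp)

lemma lapse_contDiffAt (hp : p ∈ S.bulk) : ContDiffAt ℝ ∞ S.lapse p :=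
  S.smooth_lapse p (mem_of_bulk hp)

lemma lapse_pos_of_bulk (hp : p ∈ S.bulk) : 0 < S.lapse p := S.lapse_pos p (mem_of_bulk hp)

lemma log_lapse_contDiffAt {p : ℝ × ℝ} (hp : p ∈ S.Q) :
    ContDiffAt ℝ ∞ (fun q => Real.log (S.lapse q)) p :=
  (S.smooth_lapse p hp).log (S.lapse_pos p hp).ne'

/-- The logarithmic outgoing derivative of the lapse. -/
def lam (S : OneEnded) (p : ℝ × ℝ) : ℝ := dv (fun q => Real.log (S.lapse q)) p

lemma lam_contDiffAt (hp : p ∈ S.bulk) : ContDiffAt ℝ ∞ S.lam p :=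
  contDiffAt_dv (log_lapse_contDiffAt (mem_of_bulk hp))

lemma hasDerivAt_lapse_dv (hp : p ∈ S.bulk) :
    HasDerivAt (fun y => S.lapse (p.1, y)) (S.lapse p * S.lam p) p.2 := by
  have h1 := hasDerivAt_dv (lapse_contDiffAt hp)
  have h2 := hasDerivAt_dv (log_lapse_contDiffAt (mem_of_bulk hp))
  have h3 := h1.log (lapse_pos_of_bulk hp).ne'
  have h4 : S.lam p = dv S.lapse p / S.lapse p := h2.unique h3
  rw [h4, mul_div_cancel₀ _ (lapse_pos_of_bulk hp).ne']
  exact h1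

lemma hasDerivAt_r_du (hp : p ∈ S.bulk) :
    HasDerivAt (fun x => S.r (x, p.2)) (du S.r p) p.1 := hasDerivAt_du (r_contDiffAt hp)

lemma hasDerivAt_r_dv (hp : p ∈ S.bulk) :
    HasDerivAt (fun y => S.r (p.1, y)) (dv S.r p) p.2 := hasDerivAt_dv (r_contDiffAt hp)

/-- Raychaudhuri's monotone quantity in the ingoing direction is differentiable. -/
lemma hasDerivAt_du_quotient {p : ℝ × ℝ} (hp : p ∈ S.Q) :
    HasDerivAt (fun x => du S.r (x, p.2) / S.lapse (x, p.2))
      (du (fun q => du S.r q / S.lapse q) p) p.1 :=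
  hasDerivAt_du ((contDiffAt_du (S.smooth_r p hp)).div (S.smooth_lapse p hp) (S.lapse_pos p hp).ne')

lemma hasDerivAt_dv_quotient {p : ℝ × ℝ} (hp : p ∈ S.Q) :
    HasDerivAt (fun y => dv S.r (p.1, y) / S.lapse (p.1, y))
      (dv (fun q => dv S.r q / S.lapse q) p) p.2 :=
  hasDerivAt_dv ((contDiffAt_dv (S.smooth_r p hp)).div (S.smooth_lapse p hp) (S.lapse_pos p hp).ne')

/-- `∂ᵤ (r ∂ᵥ r)`. -/
lemma hasDerivAt_r_mul_dv_r (hp : p ∈ S.bulk) :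
    HasDerivAt (fun x => S.r (x, p.2) * dv S.r (x, p.2))
      (du S.r p * dv S.r p + S.r p * du (dv S.r) p) p.1 :=
  (hasDerivAt_r_du hp).mul (hasDerivAt_du (contDiffAt_dv (r_contDiffAt hp)))

/-- `∂ᵥ (r ∂ᵤ r)`. -/
lemma hasDerivAt_r_mul_du_r (hp : p ∈ S.bulk) :
    HasDerivAt (fun y => S.r (p.1, y) * du S.r (p.1, y))
      (du S.r p * dv S.r p + S.r p * du (dv S.r) p) p.2 := by
  have := (hasDerivAt_r_dv hp).mul (hasDerivAt_dv (contDiffAt_du (r_contDiffAt hp)))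
  rw [du_dv_comm (r_contDiffAt hp), mul_comm (dv S.r (p.1, p.2))] at this
  exact this

lemma continuousAt_du_r (hp : p ∈ S.bulk) : ContinuousAt (du S.r) p :=
  (contDiffAt_du (r_contDiffAt hp)).continuousAt

lemma continuousAt_dv_r (hp : p ∈ S.bulk) : ContinuousAt (dv S.r) p :=
  (contDiffAt_dv (r_contDiffAt hp)).continuousAt

/-- An outgoing ray which stays in the space-time for large `v` meets the interior away from the
centre, uniformly in the ingoing direction. -/
lemma exists_rectangle_subset_bulk {a b : ℝ} (ha : S.Reaches a) (hb : S.Reaches b) :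
    ∃ V₀, ∀ V ≥ V₀, ∀ u ∈ Icc a b, (u, V) ∈ S.bulk := by
  obtain ⟨V₁, h₁⟩ := eventually_atTop.1 (ha.and hb)
  have hQ : ∀ V ≥ V₁, ∀ u ∈ Icc a b, (u, V) ∈ S.Q := fun V hV u hu =>
    (S.past_ingoing b V (h₁ V hV).2).2.2 u
      ⟨(S.past_ingoing a V (h₁ V hV).1).2.1.trans hu.1, hu.2⟩
  -- Being strictly later than `V₁` excludes the centre, which precedes every other point of its
  -- outgoing ray, and the initial curve, since `σ` is strictly decreasing.
  refine ⟨V₁ + 1, fun V hV u hu => ?_⟩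
  have hq := hQ V (by linarith) u hu
  have hr : S.r (u, V) ≠ 0 := fun h0 => by
    have := S.center_left u V₁ V (hQ V₁ le_rfl u hu) hq h0
    linarith
  refine ⟨S.interior_mem _ hq hr ?_, lt_of_le_of_ne (S.r_nonneg _ hq) hr.symm⟩
  have hvc : S.vc ≤ V₁ := (S.past_ingoing a V₁ (h₁ V₁ le_rfl).1).1
  have hσ : S.σ V < S.σ V₁ := by
    have hanti : StrictAntiOn S.σ (Icc V₁ V) := by
      apply strictAntiOn_of_deriv_neg (convex_Icc _ _)
      · intro t ht
        exact (S.smooth_σ t (hvc.trans ht.1)).continuousAt.continuousWithinAt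
      · intro t ht
        rw [interior_Icc] at ht
        exact S.spacelike_σ t (hvc.trans ht.1.le)
    exact hanti (left_mem_Icc.2 (by linarith)) (right_mem_Icc.2 (by linarith)) (by linarith)
  have := (S.past_ingoing a V₁ (h₁ V₁ le_rfl).1).2.1
  exact (hσ.trans_le (this.trans hu.1)).ne'

lemma eventually_approach_iff {P : ℝ × ℝ → Prop} {u : ℝ} :
    (∀ᶠ p in S.approach u, P p) ↔
      ∃ ε > 0, ∃ V, ∀ p ∈ S.Q, |p.1 - u| < ε → V ≤ p.2 → P p := by
  unfold approach
  rw [eventually_inf_principal, ((Metric.nhds_basis_ball (x := u)).prod atTop_basis).eventually_iff]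
  constructor
  · rintro ⟨⟨ε, V⟩, ⟨hε, -⟩, h⟩
    exact ⟨ε, hε, V, fun p hp h1 h2 => h ⟨by simpa [Real.dist_eq] using h1, h2⟩ hp⟩
  · rintro ⟨ε, hε, V, h⟩
    exact ⟨⟨ε, V⟩, ⟨hε, trivial⟩, fun p hp hq =>
      h p hq (by simpa [Real.dist_eq] using hp.1) hp.2⟩

lemma tendsto_ray_approach {u : ℝ} (hu : S.Reaches u) :
    Tendsto (fun v => ((u, v) : ℝ × ℝ)) atTop (S.approach u) := by
  unfold approach
  rw [tendsto_inf]
  exact ⟨tendsto_const_nhds.prodMk tendsto_id, tendsto_principal.2 hu⟩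

/-- There are no anti-trapped spheres. -/
lemma du_r_neg (hE : ∀ p ∈ S.Q, S.r p ≠ 0 → du (fun q => du S.r q / S.lapse q) p ≤ 0)
    {u v : ℝ} (hp : (u, v) ∈ S.Q) : du S.r (u, v) < 0 := by
  obtain ⟨hv, hσ, hseg⟩ := S.past_ingoing u v hp
  have hcont : ∀ w ∈ Icc (S.σ v) u, ContinuousAt (fun x => du S.r (x, v) / S.lapse (x, v)) w :=
    fun w hw => (hasDerivAt_du_quotient (hseg w hw)).continuousAt
  have hiff : ∀ w ∈ Icc (S.σ v) u, du S.r (w, v) / S.lapse (w, v) < 0 ↔ du S.r (w, v) < 0 :=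
    fun w hw => by rw [div_lt_iff₀ (S.lapse_pos _ (hseg w hw)), zero_mul]
  refine continuity_induction (P := fun w => du S.r (w, v) < 0) (a := S.σ v) (b := u)
    (S.no_antitrapped v hv) ?_ ?_ u (right_mem_Icc.2 hσ)
  · intro w hw hlt
    -- Raychaudhuri holds away from the centre only. A zero of `r` before `w` is impossible: with
    -- `∂ᵤ r < 0` there, `r` would be negative just after it.
    have hr : ∀ x ∈ Ico (S.σ v) w, S.r (x, v) ≠ 0 := by
      intro x hx h0
      have hxQ := hseg x ⟨hx.1, hx.2.le.trans hw.2⟩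
      have hd := hasDerivAt_du (S.smooth_r _ hxQ)
      have hneg := eventually_nhdsWithin_sign_eq_of_deriv_neg
        (by rw [hd.deriv]; exact hlt x hx) h0
      obtain ⟨y, hy, hyw⟩ := ((hneg.filter_mono (nhdsWithin_le_nhds (s := Ioi x))).and
        (Ioo_mem_nhdsGT hx.2)).exists
      have h1 := S.r_nonneg _ (hseg y ⟨hx.1.trans hyw.1.le, hyw.2.le.trans hw.2⟩)
      rw [sign_neg (sub_neg.2 hyw.1), sign_eq_neg_one_iff] at hy
      exact absurd h1 (not_le.2 hy)
    have hanti : AntitoneOn (fun x => du S.r (x, v) / S.lapse (x, v)) (Icc (S.σ v) w) := by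
      apply antitoneOn_of_deriv_nonpos (convex_Icc _ _)
      · exact fun x hx => (hcont x ⟨hx.1, hx.2.trans hw.2⟩).continuousWithinAt
      · intro x hx
        rw [interior_Icc] at hx
        exact (hasDerivAt_du_quotient
          (hseg x ⟨hx.1.le, hx.2.le.trans hw.2⟩)).differentiableAt.differentiableWithinAt
      · intro x hx
        rw [interior_Icc] at hx
        have hxQ := hseg x ⟨hx.1.le, hx.2.le.trans hw.2⟩
        rw [(hasDerivAt_du_quotient hxQ).deriv]
        exact hE _ hxQ (hr x ⟨hx.1.le, hx.2⟩)
    rw [← hiff w ⟨hw.1.le, hw.2⟩]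
    refine (hanti (left_mem_Icc.2 hw.1.le) (right_mem_Icc.2 hw.1.le) hw.1.le).trans_lt ?_
    simp only
    rw [hiff _ (left_mem_Icc.2 hσ)]
    exact S.no_antitrapped v hv
  · intro w hw hlt
    have h1 := (hiff w ⟨hw.1, hw.2.le⟩).2 (hlt w ⟨hw.1, le_rfl⟩)
    have h2 := ((hcont w ⟨hw.1, hw.2.le⟩).eventually_lt_const h1)
    filter_upwards [h2.filter_mono nhdsWithin_le_nhds, Ioo_mem_nhdsGT hw.2] with x hx hxw
    exact (hiff x ⟨hw.1.trans hxw.1.le, hxw.2.le⟩).1 hx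

/-- In the absence of violations of the energy condition, trapped spheres stay trapped in the
outgoing direction, quantitatively. -/
lemma dv_quotient_antitone (hE : ∀ p ∈ S.Q, S.r p ≠ 0 → dv (fun q => dv S.r q / S.lapse q) p ≤ 0)
    {u v w : ℝ} (hvw : v ≤ w) (hp : ∀ y ∈ Icc v w, (u, y) ∈ S.bulk) :
    dv S.r (u, w) / S.lapse (u, w) ≤ dv S.r (u, v) / S.lapse (u, v) := by
  have := sub_le_sub_of_hasDerivAt_le hvw
    (f := fun y => dv S.r (u, y) / S.lapse (u, y)) (fun t ht => hasDerivAt_dv_quotient (mem_of_bulk (hp t ht)))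
    (fun t _ => hasDerivAt_const t (0 : ℝ))
    (fun t ht => hE _ (mem_of_bulk (hp t ht)) (r_pos_of_bulk (hp t ht)).ne')
  linarith

end OneEnded

/-! ### Continuity of `r` at the boundary under the energy condition -/

namespace OneEnded

variable {S : OneEnded} {p : ℝ × ℝ}

lemma NullEnergyCondition.du_quotient_nonpos (h : S.NullEnergyCondition) (hp : p ∈ S.Q)
    (hr : S.r p ≠ 0) : du (fun q => du S.r q / S.lapse q) p ≤ 0 := by
  have h1 := (h p hp hr).1
  have hr' : 0 < S.r p := lt_of_le_of_ne (S.r_nonneg p hp) hr.symm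
  have hΩ := S.lapse_pos p hp
  unfold einsteinUU at h1
  by_contra hc
  have : 0 < 2 / S.r p * S.lapse p * du (fun q => du S.r q / S.lapse q) p := by
    have := not_le.1 hc
    positivity
  linarith

lemma NullEnergyCondition.dv_quotient_nonpos (h : S.NullEnergyCondition) (hp : p ∈ S.Q)
    (hr : S.r p ≠ 0) : dv (fun q => dv S.r q / S.lapse q) p ≤ 0 := by
  have h1 := (h p hp hr).2.2
  have hr' : 0 < S.r p := lt_of_le_of_ne (S.r_nonneg p hp) hr.symm
  have hΩ := S.lapse_pos p hp
  unfold einsteinVV at h1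
  by_contra hc
  have : 0 < 2 / S.r p * S.lapse p * dv (fun q => dv S.r q / S.lapse q) p := by
    have := not_le.1 hc
    positivity
  linarith

/-- Multiplied by `r² / 2`, the component `G_uv` becomes `∂ᵥ (r ∂ᵤ r) + Ω² / 4`. -/
lemma NullEnergyCondition.neg_lapse_le (h : S.NullEnergyCondition) (hp : p ∈ S.bulk) :
    -(S.lapse p / 4) ≤ du S.r p * dv S.r p + S.r p * du (dv S.r) p := by
  have hr := r_pos_of_bulk hp
  have h1 := (h p (mem_of_bulk hp) hr.ne').2.1
  unfold einsteinUV at h1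
  have h2 : 2 / S.r p * (du (dv S.r) p + du S.r p * dv S.r p / S.r p + S.lapse p / (4 * S.r p)) =
    2 / S.r p ^ 2 * (du S.r p * dv S.r p + S.r p * du (dv S.r) p + S.lapse p / 4) := by
    field_simp
    ring
  rw [h2] at h1
  have := nonneg_of_mul_nonneg_right h1 (by positivity : 0 < 2 / S.r p ^ 2)
  linarith

/-- In a trapped rectangle reaching `v = ∞`, the function `r²` is Lipschitz in the ingoing
direction, uniformly in `v`: the energy condition bounds the area of the rectangle. -/
lemma exists_lipschitz_r_sq (h : S.NullEnergyCondition) {a b V : ℝ} (hab : a ≤ b)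
    (hb : ∀ u ∈ Icc a b, ∀ v ≥ V, (u, v) ∈ S.bulk)
    (ht : ∀ u ∈ Icc a b, ∀ v ≥ V, dv S.r (u, v) < 0) :
    ∃ N ≥ 0, ∀ v ≥ V, ∀ x ∈ Icc a b, ∀ y ∈ Icc a b,
      |S.r (x, v) ^ 2 - S.r (y, v) ^ 2| ≤ N * |x - y| := by
  have hcont : ∀ {f : ℝ × ℝ → ℝ}, (∀ p ∈ S.bulk, ContinuousAt f p) →
      ContinuousOn (fun u => f (u, V)) (Icc a b) := fun hf u hu =>
    ((hf _ (hb u hu V le_rfl)).comp (f := fun u : ℝ => ((u, V) : ℝ × ℝ))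
      (Continuous.prodMk_left V).continuousAt).continuousWithinAt
  obtain ⟨u₀, hu₀, hmax⟩ := isCompact_Icc.exists_isMaxOn (nonempty_Icc.2 hab)
    (hcont (f := fun p => dv S.r p / S.lapse p) fun p hp =>
      (continuousAt_dv_r hp).div (lapse_contDiffAt hp).continuousAt (lapse_pos_of_bulk hp).ne')
  -- The least value of `-∂ᵥ r / Ω²` on the ingoing segment `v = V`; it is positive because that
  -- segment is compact and trapped.
  set c := -(dv S.r (u₀, V) / S.lapse (u₀, V)) with hc
  have hc0 : 0 < c := by
    rw [hc, neg_pos]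
    exact div_neg_of_neg_of_pos (ht u₀ hu₀ V le_rfl) (lapse_pos_of_bulk (hb u₀ hu₀ V le_rfl))
  have hlapse : ∀ u ∈ Icc a b, ∀ v ≥ V, c * S.lapse (u, v) ≤ -dv S.r (u, v) := by
    intro u hu v hv
    have h1 := dv_quotient_antitone (S := S) (fun p hp hr => h.dv_quotient_nonpos hp hr) hv
      (fun y hy => hb u hu y hy.1)
    have h2 : dv S.r (u, V) / S.lapse (u, V) ≤ -c := by rw [hc, neg_neg]; exact hmax hu
    have h3 := h1.trans h2
    rw [div_le_iff₀ (lapse_pos_of_bulk (hb u hu v hv))] at h3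
    linarith
  obtain ⟨u₁, hu₁, hmin⟩ := isCompact_Icc.exists_isMinOn (nonempty_Icc.2 hab)
    (hcont (f := fun p => S.r p * du S.r p - S.r p / (4 * c)) fun p hp =>
      ((r_contDiffAt hp).continuousAt.mul (continuousAt_du_r hp)).sub
        ((r_contDiffAt hp).continuousAt.div_const _))
  set N := |S.r (u₁, V) * du S.r (u₁, V) - S.r (u₁, V) / (4 * c)|
  have hlow : ∀ u ∈ Icc a b, ∀ v ≥ V, -N ≤ S.r (u, v) * du S.r (u, v) := by
    intro u hu v hv
    -- The combination `r ∂ᵤ r - r / (4 c)` is nondecreasing in `v`: the lapse in `T_uv ≥ 0` is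
    -- absorbed by `-∂ᵥ r ≥ c Ω²`.
    have h1 := sub_le_sub_of_hasDerivAt_le hv
      (f := fun y => S.r (u, y) / (4 * c)) (g := fun y => S.r (u, y) * du S.r (u, y))
      (fun t ht => (hasDerivAt_r_dv (hb u hu t ht.1)).div_const _)
      (fun t ht => hasDerivAt_r_mul_du_r (hb u hu t ht.1)) (fun t ht => by
        refine le_trans ?_ (h.neg_lapse_le (hb u hu t ht.1))
        rw [div_le_iff₀ (by positivity)]
        have := hlapse u hu t ht.1
        linarith)
    have h2 : _ ≤ S.r (u, V) * du S.r (u, V) - S.r (u, V) / (4 * c) := hmin hu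
    have h3 : 0 ≤ S.r (u, v) / (4 * c) :=
      div_nonneg (r_pos_of_bulk (hb u hu v hv)).le (by positivity)
    have h4 : -N ≤ _ := neg_abs_le (S.r (u₁, V) * du S.r (u₁, V) - S.r (u₁, V) / (4 * c))
    simp only at h1 h2
    linarith
  have hle : ∀ v ≥ V, ∀ x ∈ Icc a b, ∀ y ∈ Icc a b, x ≤ y →
      |S.r (y, v) ^ 2 - S.r (x, v) ^ 2| ≤ 2 * N * (y - x) := by
    intro v hv x hx y hy hxy
    have h1 := abs_sub_le_of_abs_hasDerivAt_le hxy (f := fun t => S.r (t, v) ^ 2)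
      (g := fun t => 2 * N * t)
      (fun t ht => (hasDerivAt_r_du (hb t ⟨hx.1.trans ht.1, ht.2.trans hy.2⟩ v hv)).pow 2)
      (fun t ht => (hasDerivAt_id t).const_mul (2 * N)) (fun t ht => by
        have hm : t ∈ Icc a b := ⟨hx.1.trans ht.1, ht.2.trans hy.2⟩
        have hr := r_pos_of_bulk (hb t hm v hv)
        have hd := du_r_neg (S := S) (fun p hp hr => h.du_quotient_nonpos hp hr)
          (mem_of_bulk (hb t hm v hv))
        have hl := hlow t hm v hv
        have := mul_pos_of_neg_of_neg hd (neg_neg_of_pos hr)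
        rw [abs_le]
        constructor <;> simp <;> nlinarith)
    linarith
  refine ⟨2 * N, by positivity, fun v hv x hx y hy => ?_⟩
  rcases le_total x y with hxy | hxy
  · rw [abs_sub_comm, abs_sub_comm x y, abs_of_nonneg (sub_nonneg.2 hxy)]
    exact hle v hv x hx y hy hxy
  · rw [abs_of_nonneg (sub_nonneg.2 hxy)]
    exact hle v hv y hy x hx hxy

lemma cauchyHorizon_of_lt {ui uc u : ℝ} (hc : S.IsCauchyHorizonEnd ui uc) (hu : u ∈ Ioo ui uc) :
    S.Reaches u ∧ ∃ l : ℝ, 0 < l ∧ Tendsto (fun v => S.r (u, v)) atTop (𝓝 l) := by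
  obtain ⟨c, hc', hlt⟩ := (lt_isLUB_iff hc).1 hu.2
  exact hc'.2 u ⟨hu.1, hlt⟩

lemma lt_of_isCauchyHorizonEnd {ui uc : ℝ} (hc : S.IsCauchyHorizonEnd ui uc)
    (hne : (S.cauchyHorizon ui).Nonempty) : ui < uc := by
  obtain ⟨c, hc'⟩ := hne
  exact hc'.1.trans_le (hc.1 hc')

lemma IsCauchyHorizonEnd.nonempty {ui uc : ℝ} (hc : S.IsCauchyHorizonEnd ui uc) :
    (S.cauchyHorizon ui).Nonempty := by
  by_contra h
  rw [not_nonempty_iff_eq_empty] at h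
  have h1 := hc.2 (show uc - 1 ∈ upperBounds (S.cauchyHorizon ui) by rw [h]; simp)
  linarith

/-- The limit of `r` along outgoing rays reaching the Cauchy horizon, continued by zero. -/
def boundaryRadius (S : OneEnded) (uc u : ℝ) : ℝ :=
  if u < uc then limUnder atTop (fun v => S.r (u, v)) else 0

lemma tendsto_boundaryRadius {ui uc u : ℝ} (hc : S.IsCauchyHorizonEnd ui uc)
    (hu : u ∈ Ioo ui uc) :
    Tendsto (fun v => S.r (u, v)) atTop (𝓝 (S.boundaryRadius uc u)) := by
  obtain ⟨-, l, -, hl⟩ := cauchyHorizon_of_lt hc hu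
  rw [boundaryRadius, if_pos hu.2]
  exact tendsto_nhds_limUnder ⟨l, hl⟩

lemma tendsto_r_of_singularSegment {uc u x : ℝ} (hu : u ∈ S.singularSegment uc)
    (hx : x ∈ Ioc uc u) : Tendsto (fun v => S.r (x, v)) atTop (𝓝 0) :=
  (hu.2 x hx).2.comp (tendsto_ray_approach (hu.2 x hx).1)

/-- The extension of `r` to the boundary at `v = ∞`. -/
def extendedRadius (S : OneEnded) (uc : ℝ) (p : ℝ × EReal) : ℝ :=
  if p.2 = ⊤ then S.boundaryRadius uc p.1 else S.r (p.1, p.2.toReal)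

lemma extendedRadius_embed {uc : ℝ} (q : ℝ × ℝ) : S.extendedRadius uc (embed q) = S.r q := by
  simp [extendedRadius, embed]

lemma extendedRadius_top {uc u : ℝ} :
    S.extendedRadius uc (u, ⊤) = S.boundaryRadius uc u := by
  simp [extendedRadius]

lemma continuousAt_extendedRadius_embed {uc : ℝ} {q : ℝ × ℝ} (hq : q ∈ S.Q) :
    ContinuousAt (S.extendedRadius uc) (embed q) := by
  have h1 : ContinuousAt (fun p : ℝ × EReal => ((p.1, p.2.toReal) : ℝ × ℝ)) (embed q) := by
    refine continuousAt_fst.prodMk ?_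
    exact ContinuousAt.comp (f := Prod.snd) (x := embed q)
      (EReal.continuousOn_toReal.continuousAt
        ((Set.toFinite _).isClosed.isOpen_compl.mem_nhds (by simp [embed]))) continuousAt_snd
  have h2 : ContinuousAt (fun p : ℝ × EReal => S.r (p.1, p.2.toReal)) (embed q) := by
    refine ContinuousAt.comp (g := S.r) ?_ h1
    simpa [embed] using (S.smooth_r q hq).continuousAt
  refine h2.congr ?_
  have h3 : ∀ᶠ p : ℝ × EReal in 𝓝 (embed q), p.2 ≠ ⊤ :=
    continuousAt_snd.eventually_ne (by simp [embed])
  filter_upwards [h3] with p hp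
  simp [extendedRadius, hp]

lemma hasBasis_nhds_top (u : ℝ) {s : Set (ℝ × EReal)} :
    s ∈ 𝓝 (u, (⊤ : EReal)) ↔ ∃ ε > 0, ∃ V : ℝ, ∀ p : ℝ × EReal, |p.1 - u| < ε → (V : EReal) < p.2 →
      p ∈ s := by
  rw [nhds_prod_eq, ((Metric.nhds_basis_ball (x := u)).prod EReal.nhds_top_basis).mem_iff]
  constructor
  · rintro ⟨⟨ε, V⟩, ⟨hε, -⟩, h⟩
    exact ⟨ε, hε, V, fun p h1 h2 => h ⟨by simpa [Real.dist_eq] using h1, h2⟩⟩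
  · rintro ⟨ε, hε, V, h⟩
    exact ⟨⟨ε, V⟩, ⟨hε, trivial⟩, fun p hp => h p (by simpa [Real.dist_eq] using hp.1) hp.2⟩

/-- Continuity of the extension at an ideal point around which `r²` is uniformly Lipschitz. -/
lemma continuousWithinAt_extendedRadius_top {uc a b u V N : ℝ} {s : Set (ℝ × EReal)}
    (hs : ∀ p ∈ s, p.2 ≠ ⊥) (hN : 0 ≤ N)
    (hu : u ∈ Ioo a b) (hb : ∀ u ∈ Icc a b, ∀ v ≥ V, (u, v) ∈ S.bulk)
    (hlim : ∀ x ∈ Icc a b, Tendsto (fun v => S.r (x, v)) atTop (𝓝 (S.boundaryRadius uc x)))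
    (hL : ∀ v ≥ V, ∀ x ∈ Icc a b, ∀ y ∈ Icc a b,
      |S.r (x, v) ^ 2 - S.r (y, v) ^ 2| ≤ N * |x - y|) :
    ContinuousWithinAt (S.extendedRadius uc) s (u, ⊤) := by
  have hu' : u ∈ Icc a b := Ioo_subset_Icc_self hu
  have hlimsq : ∀ x ∈ Icc a b, |S.boundaryRadius uc x ^ 2 - S.boundaryRadius uc u ^ 2|
      ≤ N * |x - u| := fun x hx =>
    le_of_tendsto (((hlim x hx).pow 2).sub ((hlim u hu').pow 2)).abs
      ((eventually_ge_atTop V).mono fun v hv => hL v hv x hx u hu')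
  have hnn : ∀ x ∈ Icc a b, 0 ≤ S.boundaryRadius uc x := fun x hx =>
    ge_of_tendsto (hlim x hx)
      ((eventually_ge_atTop V).mono fun v hv => (r_pos_of_bulk (hb x hx v hv)).le)
  -- The Lipschitz bound concerns `r²` and gives nothing for `r` near zero; continuity is proved for
  -- the square and the root is taken at the end.
  have hsq : ContinuousWithinAt (fun p => S.extendedRadius uc p ^ 2) s (u, ⊤) := by
    rw [ContinuousWithinAt, Metric.tendsto_nhds]
    intro ε hε
    obtain ⟨W, hW⟩ := eventually_atTop.1 ((Metric.tendsto_nhds.1 ((hlim u hu').pow 2)) (ε / 2)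
      (by positivity))
    refine mem_nhdsWithin_iff_exists_mem_nhds_inter.2
      ⟨_, (hasBasis_nhds_top u).2 ⟨min (ε / (2 * (N + 1))) (min (u - a) (b - u)),
        lt_min (by positivity) (lt_min (by linarith [hu.1]) (by linarith [hu.2])), max V W,
        fun p h1 h2 => (show p ∈ {p : ℝ × EReal | |p.1 - u| <
          min (ε / (2 * (N + 1))) (min (u - a) (b - u)) ∧ ((max V W : ℝ) : EReal) < p.2}
          from ⟨h1, h2⟩)⟩, ?_⟩
    rintro ⟨x, y⟩ ⟨⟨h1, h2⟩, hxs⟩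
    simp only [lt_min_iff] at h1
    obtain ⟨h1, h3, h4⟩ := h1
    have hx : x ∈ Icc a b := by
      rw [abs_lt] at h3 h4
      exact ⟨by linarith, by linarith⟩
    have hNx : N * |x - u| < ε / 2 := by
      have : (N + 1) * |x - u| < ε / 2 := by
        rw [lt_div_iff₀ (by positivity)] at h1 ⊢
        linarith
      nlinarith [abs_nonneg (x - u)]
    rw [mem_ofPred_eq, Real.dist_eq, extendedRadius_top]
    induction y with
    | bot => exact absurd rfl (hs _ hxs)
    | top =>
      rw [extendedRadius_top]
      have := hlimsq x hx
      linarith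
    | coe v =>
      have hv : max V W < v := by simpa using h2
      have h5 := hL v ((le_max_left _ _).trans hv.le) x hx u hu'
      have h6 := hW v ((le_max_right _ _).trans hv.le)
      rw [Real.dist_eq] at h6
      have h7 : S.extendedRadius uc (x, (v : EReal)) = S.r (x, v) := extendedRadius_embed (x, v)
      rw [h7]
      have := abs_sub_le (S.r (x, v) ^ 2) (S.r (u, v) ^ 2) (S.boundaryRadius uc u ^ 2)
      linarith
  have hsqrt := hsq.sqrt
  refine hsqrt.congr_of_eventuallyEq ?_ ?_
  · refine mem_nhdsWithin_iff_exists_mem_nhds_inter.2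
      ⟨_, (hasBasis_nhds_top u).2 ⟨min (u - a) (b - u),
        (lt_min (by linarith [hu.1]) (by linarith [hu.2])), V,
        fun p h1 h2 => (show p ∈ {p : ℝ × EReal | |p.1 - u| < min (u - a) (b - u) ∧
          (V : EReal) < p.2} from ⟨h1, h2⟩)⟩, ?_⟩
    rintro ⟨x, y⟩ ⟨⟨h1, h2⟩, hxs⟩
    rw [lt_min_iff, abs_lt, abs_lt] at h1
    have hx : x ∈ Icc a b := ⟨by linarith [h1.1.1], by linarith [h1.2.2]⟩
    refine (Real.sqrt_sq ?_).symm
    induction y with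
    | bot => exact absurd rfl (hs _ hxs)
    | top => rw [extendedRadius_top]; exact hnn x hx
    | coe v =>
      have h7 : S.extendedRadius uc (x, (v : EReal)) = S.r (x, v) := extendedRadius_embed (x, v)
      rw [h7]
      exact (r_pos_of_bulk (hb x hx v (by simpa using h2.le))).le
  · rw [extendedRadius_top, Real.sqrt_sq (hnn u hu')]

/-- If the end-point of the Cauchy horizon has a trapped neighbourhood and is followed by
a null segment with `r = 0`, then `r` extends continuously. -/
theorem exists_continuous_extension {ui uc : ℝ} {V : Set (ℝ × EReal)}
    (h : S.NullEnergyCondition) (hc : S.IsCauchyHorizonEnd ui uc)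
    (hne : (S.singularSegment uc).Nonempty) (hV : IsOpen V) (hVt : (uc, ⊤) ∈ V)
    (ht : ∀ p ∈ S.Q, embed p ∈ V → p ∈ S.trapped) :
    ContinuousOn (S.extendedRadius uc)
      (V ∩ (embed '' S.Q ∪ (S.cauchyHorizon ui ∪ S.singularSegment uc) ×ˢ {⊤})) := by
  obtain ⟨z, hz⟩ := hne
  have hiu : ui < uc := lt_of_isCauchyHorizonEnd hc hc.nonempty
  have hbot : ∀ p ∈ V ∩ (embed '' S.Q ∪ (S.cauchyHorizon ui ∪ S.singularSegment uc) ×ˢ {⊤}),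
      p.2 ≠ (⊥ : EReal) := by
    rintro ⟨x, y⟩ ⟨-, ⟨q, -, hq⟩ | ⟨-, hy⟩⟩ h0
    · have := congrArg Prod.snd hq
      simp [embed] at this h0
      exact EReal.coe_ne_bot _ (this.trans h0)
    · simp at hy h0
      exact top_ne_bot (hy.symm.trans h0)
  have hrect : ∀ a b, S.Reaches a → S.Reaches b → a ≤ b → ∀ W : ℝ,
      (∀ u ∈ Icc a b, ∀ v > W, ((u, (v : EReal)) : ℝ × EReal) ∈ V) →
      ∃ V₀, (∀ u ∈ Icc a b, ∀ v ≥ V₀, (u, v) ∈ S.bulk) ∧ ∃ N ≥ 0, ∀ v ≥ V₀, ∀ x ∈ Icc a b,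
        ∀ y ∈ Icc a b, |S.r (x, v) ^ 2 - S.r (y, v) ^ 2| ≤ N * |x - y| := by
    intro a b ha hb hab W hW
    obtain ⟨V₀, hV₀⟩ := exists_rectangle_subset_bulk ha hb
    have hbk : ∀ u ∈ Icc a b, ∀ v ≥ max V₀ (W + 1), (u, v) ∈ S.bulk := fun u hu v hv =>
      hV₀ v ((le_max_left _ _).trans hv) u hu
    refine ⟨max V₀ (W + 1), hbk, exists_lipschitz_r_sq h hab hbk fun u hu v hv => ?_⟩
    refine (ht _ (mem_of_bulk (hbk u hu v hv)) (hW u hu v ?_)).2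
    linarith [(le_max_right V₀ (W + 1)).trans hv]
  have hbox : ∀ u, ((u, ⊤) : ℝ × EReal) ∈ V → ∃ ε > 0, ∃ W : ℝ, ∀ x, |x - u| < ε → ∀ v > W,
      ((x, (v : EReal)) : ℝ × EReal) ∈ V := by
    intro u hu
    obtain ⟨ε, hε, W, hW⟩ := (hasBasis_nhds_top u).1 (hV.mem_nhds hu)
    exact ⟨ε, hε, W, fun x hx v hv => hW (x, (v : EReal)) hx (by simpa using hv)⟩
  rintro ⟨u, y⟩ ⟨huV, ⟨q, hq, hqe⟩ | ⟨hu, hy⟩⟩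
  · rw [← hqe]
    exact (continuousAt_extendedRadius_embed hq).continuousWithinAt
  obtain rfl : y = ⊤ := by simpa using hy
  simp only at hu
  rcases hu with hu | hu
  · rcases (hc.1 hu).lt_or_eq with hlt | rfl
    · obtain ⟨ε, hε, W, hW⟩ := hbox u huV
      obtain ⟨a, ha, hau⟩ := exists_between (max_lt hu.1 (sub_lt_self u hε))
      obtain ⟨b, hub, hb⟩ := exists_between (lt_min hlt (lt_add_of_pos_right u hε))
      rw [max_lt_iff] at ha
      rw [lt_min_iff] at hb
      have hsub : ∀ x ∈ Icc a b, x ∈ Ioo ui uc := fun x hx =>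
        ⟨ha.1.trans_le hx.1, hx.2.trans_lt hb.1⟩
      have hab := hau.le.trans hub.le
      obtain ⟨V₀, hbk, N, hN, hL⟩ := hrect a b
        (cauchyHorizon_of_lt hc (hsub a (left_mem_Icc.2 hab))).1
        (cauchyHorizon_of_lt hc (hsub b (right_mem_Icc.2 hab))).1 hab W
        (fun x hx v hv => hW x (by rw [abs_lt]; constructor <;> linarith [hx.1, hx.2]) v hv)
      exact continuousWithinAt_extendedRadius_top hbot hN ⟨hau, hub⟩ hbk
        (fun x hx => tendsto_boundaryRadius hc (hsub x hx)) hL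
    · obtain ⟨ε, hε, W, hW⟩ := hbox u huV
      obtain ⟨a, ha, hau⟩ := exists_between (max_lt hu.1 (sub_lt_self u hε))
      obtain ⟨b, hub, hb⟩ := exists_between (lt_min hz.1 (lt_add_of_pos_right u hε))
      rw [max_lt_iff] at ha
      rw [lt_min_iff] at hb
      have hab := hau.le.trans hub.le
      obtain ⟨V₀, hbk, N, hN, hL⟩ := hrect a b
        (cauchyHorizon_of_lt hc ⟨ha.1, hau⟩).1 (hz.2 b ⟨hub, hb.1.le⟩).1 hab W
        (fun x hx v hv => hW x (by rw [abs_lt]; constructor <;> linarith [hx.1, hx.2]) v hv)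
      -- At the end-point itself no limit is given. The Lipschitz bound compares `r (u, v)²` with `r
      -- (c, v)²` for `c` slightly beyond, on the singular segment, where `r` tends to zero.
      have hend : Tendsto (fun v => S.r (u, v)) atTop (𝓝 0) := by
        have hsq : Tendsto (fun v => S.r (u, v) ^ 2) atTop (𝓝 0) := by
          rw [Metric.tendsto_nhds]
          intro δ hδ
          obtain ⟨c, huc, hc'⟩ := exists_between
            (lt_min hub (lt_add_of_pos_right u (by positivity : 0 < δ / (2 * (N + 1)))))
          rw [lt_min_iff] at hc'
          have h0 := (tendsto_r_of_singularSegment hz ⟨huc, hc'.1.le.trans hb.1.le⟩).pow 2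
          filter_upwards [(Metric.tendsto_nhds.1 h0) (δ / 2) (by positivity),
            eventually_ge_atTop V₀] with v h1 h2
          have h3 := hL v h2 u ⟨hau.le, hub.le⟩ c ⟨hau.le.trans huc.le, hc'.1.le⟩
          rw [abs_sub_comm u c, abs_of_pos (sub_pos.2 huc)] at h3
          have h4 : (N + 1) * (c - u) < δ / 2 := by
            have := hc'.2
            rw [← sub_lt_iff_lt_add', lt_div_iff₀ (by positivity)] at this
            linarith
          rw [Real.dist_eq] at h1 ⊢
          have := abs_sub_le (S.r (u, v) ^ 2) (S.r (c, v) ^ 2) 0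
          norm_num at this h1 ⊢
          nlinarith [sub_pos.2 huc]
        have := hsq.sqrt
        rw [Real.sqrt_zero] at this
        refine this.congr' ?_
        filter_upwards [eventually_ge_atTop V₀] with v hv
        exact Real.sqrt_sq (r_pos_of_bulk (hbk u ⟨hau.le, hub.le⟩ v hv)).le
      refine continuousWithinAt_extendedRadius_top hbot hN ⟨hau, hub⟩ hbk (fun x hx => ?_) hL
      rcases lt_trichotomy x u with hxu | rfl | hxu
      · exact tendsto_boundaryRadius hc ⟨ha.1.trans_le hx.1, hxu⟩
      · simpa [boundaryRadius] using hend
      · rw [boundaryRadius, if_neg (not_lt.2 hxu.le)]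
        exact tendsto_r_of_singularSegment hz ⟨hxu, hx.2.trans hb.1.le⟩
  -- On the singular segment continuity is part of its definition; a radius at most `u - uc` keeps
  -- nearby boundary points beyond `uc`, where the extension is zero.
  · have h0 : S.extendedRadius uc (u, ⊤) = 0 := by
      rw [extendedRadius_top, boundaryRadius, if_neg (not_lt.2 hu.1.le)]
    rw [ContinuousWithinAt, h0, Metric.tendsto_nhds]
    intro ε hε
    obtain ⟨δ, hδ, W, hW⟩ := eventually_approach_iff.1
      ((Metric.tendsto_nhds.1 (hu.2 u ⟨hu.1, le_rfl⟩).2) ε hε)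
    refine mem_nhdsWithin_iff_exists_mem_nhds_inter.2
      ⟨_, (hasBasis_nhds_top u).2 ⟨min δ (u - uc), lt_min hδ (sub_pos.2 hu.1), W,
        fun p h1 h2 => (show p ∈ {p : ℝ × EReal | |p.1 - u| < min δ (u - uc) ∧
          (W : EReal) < p.2} from ⟨h1, h2⟩)⟩, ?_⟩
    rintro ⟨x, y⟩ ⟨⟨h1, h2⟩, -, ⟨q, hq, hqe⟩ | ⟨-, hy⟩⟩
    · rw [← hqe] at h1 h2 ⊢
      rw [mem_ofPred_eq, extendedRadius_embed]
      exact hW q hq (h1.trans_le (min_le_left _ _)) (by simpa [embed] using h2.le)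
    · obtain rfl : y = ⊤ := by simpa using hy
      have h3 := (abs_lt.1 (h1.trans_le (min_le_right _ _))).1
      simp only at h3
      rw [mem_ofPred_eq, extendedRadius_top, boundaryRadius, if_neg (by linarith)]
      simpa using hε

end OneEnded

/-! ### The field equations in first-order form -/

section ChargedScalarField

variable {S : OneEnded} {F : Matter} {q₀ m2 : ℝ} {p : ℝ × ℝ}

/-- The common factor in `∂ᵤ (r ∂ᵥ r) = ∂ᵥ (r ∂ᵤ r) = Ω² H`. -/
def areaSource (S : OneEnded) (F : Matter) (m2 : ℝ) (p : ℝ × ℝ) : ℝ :=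
  (-1 + F.charge p ^ 2 / S.r p ^ 2 + m2 * S.r p ^ 2 * ‖F.φ p‖ ^ 2) / 4

/-- The rescaled outgoing derivative `r Dᵥ φ`. -/
def chi (S : OneEnded) (F : Matter) (q₀ : ℝ) (p : ℝ × ℝ) : ℂ := (S.r p : ℂ) * F.covV q₀ F.φ p

/-- The rescaled ingoing derivative `r Dᵤ φ`. -/
def psi (S : OneEnded) (F : Matter) (q₀ : ℝ) (p : ℝ × ℝ) : ℂ := (S.r p : ℂ) * F.covU q₀ F.φ p

/-- The gauge-covariant `u`-derivative of `r Dᵥ φ`. -/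
def chiSource (S : OneEnded) (F : Matter) (q₀ m2 : ℝ) (p : ℝ × ℝ) : ℂ :=
  -((dv S.r p : ℝ) : ℂ) * F.covU q₀ F.φ p + (S.lapse p : ℂ) *
    (Complex.I * ((q₀ * F.charge p / (4 * S.r p) : ℝ) : ℂ) - ((m2 * S.r p / 4 : ℝ) : ℂ)) * F.φ p

/-- The gauge-covariant `v`-derivative of `r Dᵤ φ`. -/
def psiSource (S : OneEnded) (F : Matter) (q₀ m2 : ℝ) (p : ℝ × ℝ) : ℂ :=
  -((du S.r p : ℝ) : ℂ) * F.covV q₀ F.φ p - (S.lapse p : ℂ) *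
    (Complex.I * ((q₀ * F.charge p / (4 * S.r p) : ℝ) : ℂ) + ((m2 * S.r p / 4 : ℝ) : ℂ)) * F.φ p

namespace IsEMKG

/-- The term `-∂ᵤ r ∂ᵥ r / r` of the wave equation cancels after multiplication by `r`; what remains
is proportional to `Ω²`, hence small wherever the lapse is. -/
lemma area_eq (sol : IsEMKG S F q₀ m2) (hp : p ∈ S.bulk) :
    du S.r p * dv S.r p + S.r p * du (dv S.r) p = S.lapse p * areaSource S F m2 p := by
  have hr := OneEnded.r_pos_of_bulk hp
  rw [sol.wave_r p (OneEnded.mem_of_bulk hp) hr.ne', areaSource]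
  field_simp
  ring

lemma hasDerivAt_phi_du (sol : IsEMKG S F q₀ m2) (hp : p ∈ S.bulk) :
    HasDerivAt (fun x => F.φ (x, p.2))
      (F.covU q₀ F.φ p - Complex.I * ((q₀ * F.Au p : ℝ) : ℂ) * F.φ p) p.1 := by
  have := hasDerivAt_du (sol.smooth_φ p (OneEnded.mem_of_bulk hp))
  refine this.congr_deriv ?_
  unfold Matter.covU
  push_cast
  ring

lemma contDiffAt_covU (sol : IsEMKG S F q₀ m2) (hp : p ∈ S.bulk) : ContDiffAt ℝ ∞ (F.covU q₀ F.φ) p := by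
  have h1 := sol.smooth_φ p (OneEnded.mem_of_bulk hp)
  have h2 := sol.smooth_Au p (OneEnded.mem_of_bulk hp)
  exact (contDiffAt_du h1).add ((contDiffAt_const.mul (Complex.ofRealCLM.contDiff.contDiffAt.comp p h2)).mul h1)

lemma contDiffAt_covV (sol : IsEMKG S F q₀ m2) (hp : p ∈ S.bulk) : ContDiffAt ℝ ∞ (F.covV q₀ F.φ) p := by
  have h1 := sol.smooth_φ p (OneEnded.mem_of_bulk hp)
  have h2 := sol.smooth_Av p (OneEnded.mem_of_bulk hp)
  exact (contDiffAt_dv h1).add ((contDiffAt_const.mul (Complex.ofRealCLM.contDiff.contDiffAt.comp p h2)).mul h1)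

/-- The factor `r` removes the term `-(∂ᵤ r / r) Dᵥ φ` of the wave equation. The derivative is
written as source minus connection term, the form required by `abs_norm_sub_norm_le_of_transport`.
-/
lemma hasDerivAt_chi (sol : IsEMKG S F q₀ m2) (hp : p ∈ S.bulk) :
    HasDerivAt (fun x => chi S F q₀ (x, p.2))
      (chiSource S F q₀ m2 p - Complex.I * ((q₀ * F.Au p : ℝ) : ℂ) * chi S F q₀ p) p.1 := by
  have hr := OneEnded.r_pos_of_bulk hp
  have h1 := (OneEnded.hasDerivAt_r_du hp).ofReal_comp.mul
    (hasDerivAt_du (sol.contDiffAt_covV hp))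
  refine h1.congr_deriv ?_
  simp only [Prod.mk.eta]
  have h2 := sol.wave_φ p (OneEnded.mem_of_bulk hp) hr.ne'
  rw [Matter.covU] at h2
  rw [eq_sub_of_add_eq h2, chi, chiSource]
  have : (S.r p : ℂ) ≠ 0 := by exact_mod_cast hr.ne'
  push_cast
  field_simp
  ring

/-- The commutator of the gauge derivatives is the curvature of the connection, that is, the
electric field. It flips the sign of the charge term between `chiSource` and `psiSource`. -/
lemma dv_covU_eq (sol : IsEMKG S F q₀ m2) (hp : p ∈ S.bulk) :
    dv (F.covU q₀ F.φ) p + Complex.I * (q₀ : ℂ) * (F.Av p : ℂ) * F.covU q₀ F.φ p =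
      F.covU q₀ (F.covV q₀ F.φ) p -
        Complex.I * ((q₀ * (F.charge p * S.lapse p / (2 * S.r p ^ 2)) : ℝ) : ℂ) * F.φ p := by
  have hφ := sol.smooth_φ p (OneEnded.mem_of_bulk hp)
  have hu := sol.smooth_Au p (OneEnded.mem_of_bulk hp)
  have hv := sol.smooth_Av p (OneEnded.mem_of_bulk hp)
  have h1 : dv (F.covU q₀ F.φ) p = dv (du F.φ) p + (Complex.I * (q₀ : ℂ) * ((dv F.Au p : ℝ) : ℂ) * F.φ p
      + Complex.I * (q₀ : ℂ) * (F.Au p : ℂ) * dv F.φ p) :=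
    ((hasDerivAt_dv (contDiffAt_du hφ)).add
      (((hasDerivAt_dv hu).ofReal_comp.const_mul (Complex.I * (q₀ : ℂ))).mul
        (hasDerivAt_dv hφ))).deriv
  have h2 : du (F.covV q₀ F.φ) p = du (dv F.φ) p + (Complex.I * (q₀ : ℂ) * ((du F.Av p : ℝ) : ℂ) * F.φ p
      + Complex.I * (q₀ : ℂ) * (F.Av p : ℂ) * du F.φ p) :=
    ((hasDerivAt_du (contDiffAt_dv hφ)).add
      (((hasDerivAt_du hv).ofReal_comp.const_mul (Complex.I * (q₀ : ℂ))).mul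
        (hasDerivAt_du hφ))).deriv
  have h3 := sol.potential p (OneEnded.mem_of_bulk hp) (OneEnded.r_pos_of_bulk hp).ne'
  rw [← h3, Matter.covU, h1, Matter.covU, h2, Matter.covV, du_dv_comm hφ]
  push_cast
  ring

lemma hasDerivAt_psi (sol : IsEMKG S F q₀ m2) (hp : p ∈ S.bulk) :
    HasDerivAt (fun y => psi S F q₀ (p.1, y))
      (psiSource S F q₀ m2 p - Complex.I * ((q₀ * F.Av p : ℝ) : ℂ) * psi S F q₀ p) p.2 := by
  have hr := OneEnded.r_pos_of_bulk hp
  have h1 := (OneEnded.hasDerivAt_r_dv hp).ofReal_comp.mul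
    (hasDerivAt_dv (sol.contDiffAt_covU hp))
  refine h1.congr_deriv ?_
  simp only [Prod.mk.eta]
  have h2 := sol.wave_φ p (OneEnded.mem_of_bulk hp) hr.ne'
  have h3 := sol.dv_covU_eq hp
  rw [h2] at h3
  rw [eq_sub_of_add_eq h3, psi, psiSource]
  have : (S.r p : ℂ) ≠ 0 := by exact_mod_cast hr.ne'
  push_cast
  field_simp
  ring

lemma norm_chi (hp : p ∈ S.bulk) : ‖chi S F q₀ p‖ = S.r p * ‖F.covV q₀ F.φ p‖ := by
  rw [chi, norm_mul, Complex.norm_of_nonneg (OneEnded.r_pos_of_bulk hp).le]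

lemma norm_psi (hp : p ∈ S.bulk) : ‖psi S F q₀ p‖ = S.r p * ‖F.covU q₀ F.φ p‖ := by
  rw [psi, norm_mul, Complex.norm_of_nonneg (OneEnded.r_pos_of_bulk hp).le]

lemma hasDerivAt_lam (hp : p ∈ S.bulk) :
    HasDerivAt (fun x => S.lam (x, p.2)) (du S.lam p) p.1 :=
  hasDerivAt_du (OneEnded.lam_contDiffAt hp)

lemma hasDerivAt_charge (sol : IsEMKG S F q₀ m2) (hp : p ∈ S.bulk) :
    HasDerivAt (fun x => F.charge (x, p.2)) (du F.charge p) p.1 :=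
  hasDerivAt_du (sol.smooth_charge p (OneEnded.mem_of_bulk hp))

lemma abs_du_charge_le (sol : IsEMKG S F q₀ m2) (hp : p ∈ S.bulk) :
    |du F.charge p| ≤ |q₀| * S.r p ^ 2 * ‖F.φ p‖ * ‖F.covU q₀ F.φ p‖ := by
  rw [sol.maxwell_u p (OneEnded.mem_of_bulk hp) (OneEnded.r_pos_of_bulk hp).ne', abs_mul, abs_mul,
    abs_neg, abs_of_nonneg (sq_nonneg (S.r p)), mul_assoc (|q₀| * _)]
  gcongr
  refine (Complex.abs_im_le_norm _).trans_eq ?_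
  rw [norm_mul, RCLike.norm_conj]

/-- The sign `σ = ±1` lets one estimate serve both `chiSource` and `psiSource`. -/
lemma norm_potential_le (hm : 0 ≤ m2) (hp : p ∈ S.bulk) (σ : ℝ) (hσ : |σ| = 1) :
    ‖(S.lapse p : ℂ) * (Complex.I * ((q₀ * F.charge p / (4 * S.r p) : ℝ) : ℂ) +
      σ * ((m2 * S.r p / 4 : ℝ) : ℂ)) * F.φ p‖ ≤
      S.lapse p * (|q₀| * |F.charge p| / (4 * S.r p) + m2 * S.r p / 4) * ‖F.φ p‖ := by
  have hr := OneEnded.r_pos_of_bulk hp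
  have hΩ := OneEnded.lapse_pos_of_bulk hp
  rw [norm_mul, norm_mul, Complex.norm_of_nonneg hΩ.le]
  gcongr
  refine (norm_add_le _ _).trans (add_le_add (le_of_eq ?_) (le_of_eq ?_))
  · rw [norm_mul, Complex.norm_I, one_mul, Complex.norm_real, Real.norm_eq_abs, abs_div, abs_mul,
      abs_of_pos (by positivity : 0 < 4 * S.r p)]
  · rw [norm_mul, Complex.norm_real, Complex.norm_real, Real.norm_eq_abs, hσ, one_mul,
      Real.norm_eq_abs, abs_of_nonneg (by positivity)]

lemma norm_chiSource_le (hm : 0 ≤ m2) (hp : p ∈ S.bulk) :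
    ‖chiSource S F q₀ m2 p‖ ≤ |dv S.r p| * ‖F.covU q₀ F.φ p‖ +
      S.lapse p * (|q₀| * |F.charge p| / (4 * S.r p) + m2 * S.r p / 4) * ‖F.φ p‖ := by
  unfold chiSource
  refine (norm_add_le _ _).trans (add_le_add (le_of_eq ?_) ?_)
  · rw [norm_mul, norm_neg, Complex.norm_real, Real.norm_eq_abs]
  · have := norm_potential_le (F := F) (q₀ := q₀) hm hp (-1) (by simp)
    simpa [sub_eq_add_neg] using this

lemma norm_psiSource_le (hm : 0 ≤ m2) (hp : p ∈ S.bulk) :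
    ‖psiSource S F q₀ m2 p‖ ≤ |du S.r p| * ‖F.covV q₀ F.φ p‖ +
      S.lapse p * (|q₀| * |F.charge p| / (4 * S.r p) + m2 * S.r p / 4) * ‖F.φ p‖ := by
  unfold psiSource
  refine (norm_sub_le _ _).trans (add_le_add (le_of_eq ?_) ?_)
  · rw [norm_mul, norm_neg, Complex.norm_real, Real.norm_eq_abs]
  · have := norm_potential_le (F := F) (q₀ := q₀) hm hp 1 (by simp)
    simpa using this

lemma du_lam_eq (sol : IsEMKG S F q₀ m2) (hp : p ∈ S.bulk) : du S.lam p =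
    -2 * (F.covU q₀ F.φ p * starRingEnd ℂ (F.covV q₀ F.φ p)).re
      + (S.lapse p / (2 * S.r p ^ 2) * (1 - 2 * F.charge p ^ 2 / S.r p ^ 2)
      + 2 * du S.r p * dv S.r p / S.r p ^ 2) := by
  have hr := OneEnded.r_pos_of_bulk hp
  have := sol.wave_lapse p (OneEnded.mem_of_bulk hp) hr.ne'
  change du S.lam p = _ at this
  rw [this]
  field_simp
  ring

lemma abs_cross_term_le (p : ℝ × ℝ) :
    |-2 * (F.covU q₀ F.φ p * starRingEnd ℂ (F.covV q₀ F.φ p)).re| ≤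
      2 * ‖F.covU q₀ F.φ p‖ * ‖F.covV q₀ F.φ p‖ := by
  rw [abs_mul, abs_neg, abs_two, mul_assoc]
  gcongr
  refine (Complex.abs_re_le_norm _).trans_eq ?_
  rw [norm_mul, RCLike.norm_conj]

/-- Only an upper bound on `λ = ∂ᵥ log Ω²` matters for decay of the lapse. The signs of the
geometric terms are kept because the static region exploits them. -/
lemma du_lam_le (sol : IsEMKG S F q₀ m2) (hp : p ∈ S.bulk) : du S.lam p ≤
    2 * ‖F.covU q₀ F.φ p‖ * ‖F.covV q₀ F.φ p‖
      + (S.lapse p / (2 * S.r p ^ 2) * (1 - 2 * F.charge p ^ 2 / S.r p ^ 2)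
      + 2 * du S.r p * dv S.r p / S.r p ^ 2) := by
  rw [sol.du_lam_eq hp]
  exact add_le_add ((le_abs_self _).trans (abs_cross_term_le p)) le_rfl

/-- Version for the region beyond the end-point, where no sign is available and smallness comes from
the short `u`-interval. -/
lemma abs_du_lam_le (sol : IsEMKG S F q₀ m2) (hp : p ∈ S.bulk) : |du S.lam p| ≤
    2 * ‖F.covU q₀ F.φ p‖ * ‖F.covV q₀ F.φ p‖
      + (S.lapse p / (2 * S.r p ^ 2) * (1 + 2 * F.charge p ^ 2 / S.r p ^ 2)
      + 2 * |du S.r p| * |dv S.r p| / S.r p ^ 2) := by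
  have hr := OneEnded.r_pos_of_bulk hp
  have hΩ := OneEnded.lapse_pos_of_bulk hp
  rw [sol.du_lam_eq hp]
  refine (abs_add_le _ _).trans (add_le_add (abs_cross_term_le p) ?_)
  refine (abs_add_le _ _).trans (add_le_add ?_ (le_of_eq ?_))
  · rw [abs_mul, abs_of_pos (a := S.lapse p / _) (by positivity)]
    gcongr
    refine (abs_sub _ _).trans_eq ?_
    rw [abs_one, abs_of_nonneg (by positivity)]
  · rw [abs_div, abs_mul, abs_mul, abs_two, abs_of_pos (a := S.r p ^ 2) (by positivity)]

lemma du_quotient_nonpos (sol : IsEMKG S F q₀ m2) {p : ℝ × ℝ} (hp : p ∈ S.Q) (hr : S.r p ≠ 0) :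
    du (fun q => du S.r q / S.lapse q) p ≤ 0 := by
  rw [sol.raychaudhuri_u p hp hr]
  have := S.lapse_pos p hp
  have := S.r_nonneg p hp
  rw [neg_div, neg_mul]
  exact neg_nonpos.2 (by positivity)

lemma dv_quotient_nonpos (sol : IsEMKG S F q₀ m2) {p : ℝ × ℝ} (hp : p ∈ S.Q) (hr : S.r p ≠ 0) :
    dv (fun q => dv S.r q / S.lapse q) p ≤ 0 := by
  rw [sol.raychaudhuri_v p hp hr]
  have := S.lapse_pos p hp
  have := S.r_nonneg p hp
  rw [neg_div, neg_mul]
  exact neg_nonpos.2 (by positivity)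

end IsEMKG

end ChargedScalarField

/-! ### Local stability of a decaying outgoing cone -/

section LocalStability

/-- The fourth power suffices below: the bootstrap lets the coefficients of `Ω²` grow like `v²`, and
a factor `v⁻²` must survive. -/
lemma pow_four_mul_exp_le {k v : ℝ} (hk : 0 < k) (hv : 0 ≤ v) :
    Real.exp (-(k * v)) * v ^ 4 ≤ 24 / k ^ 4 := by
  have h := Real.pow_div_factorial_le_exp (k * v) (by positivity) 4
  rw [Real.exp_neg, ← div_eq_inv_mul, div_le_div_iff₀ (Real.exp_pos _) (by positivity)]
  norm_num [Nat.factorial] at h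
  nlinarith

lemma le_of_forall_Ico_le {f : ℝ × ℝ → ℝ} {c u v C : ℝ} (hf : ContinuousAt f (u, v)) (hc : c < u)
    (h : ∀ w ∈ Ico c u, f (w, v) ≤ C) : f (u, v) ≤ C := by
  have h1 : Tendsto (fun w => f (w, v)) (𝓝[<] u) (𝓝 (f (u, v))) :=
    (ContinuousAt.comp (f := fun w : ℝ => ((w, v) : ℝ × ℝ)) hf
      (Continuous.prodMk_left v).continuousAt).tendsto.mono_left nhdsWithin_le_nhds
  refine le_of_tendsto h1 ?_
  filter_upwards [Ioo_mem_nhdsLT hc] with w hw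
  exact h w (Ioo_subset_Ico_self hw)

lemma exists_bound_on_ingoing {f : ℝ × ℝ → ℝ} {c x V : ℝ}
    (hf : ∀ u ∈ Icc c x, ContinuousAt f (u, V)) : ∃ N ≥ 0, ∀ u ∈ Icc c x, f (u, V) ≤ N := by
  obtain ⟨N, hN⟩ := (isCompact_Icc (a := c) (b := x)).bddAbove_image
    (f := fun u => f (u, V)) fun u hu =>
      (ContinuousAt.comp (f := fun w : ℝ => ((w, V) : ℝ × ℝ)) (hf u hu)
        (Continuous.prodMk_left V).continuousAt).continuousWithinAt
  exact ⟨max N 0, le_max_right _ _, fun u hu => (hN ⟨u, hu, rfl⟩).trans (le_max_left _ _)⟩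

/-- Bounds, with growth in `v`, on the solution at a point. -/
structure GrowthBound (S : OneEnded) (F : Matter) (q₀ ρ k B : ℝ) (p : ℝ × ℝ) : Prop where
  r_ge : ρ ≤ S.r p
  lam_le : S.lam p ≤ -k
  phi_le : ‖F.φ p‖ ≤ B * √p.2
  chi_le : ‖chi S F q₀ p‖ ≤ B / √p.2
  charge_le : |F.charge p| ≤ B * p.2

variable {S : OneEnded} {F : Matter} {q₀ m2 c x V k ρ R B : ℝ}

lemma IsEMKG.continuousAt_chi (sol : IsEMKG S F q₀ m2) {p : ℝ × ℝ} (hp : p ∈ S.bulk) :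
    ContinuousAt (chi S F q₀) p :=
  (Complex.continuous_ofReal.continuousAt.comp (OneEnded.r_contDiffAt hp).continuousAt).mul
    (sol.contDiffAt_covV hp).continuousAt

lemma IsEMKG.continuousAt_psi (sol : IsEMKG S F q₀ m2) {p : ℝ × ℝ} (hp : p ∈ S.bulk) :
    ContinuousAt (psi S F q₀) p :=
  (Complex.continuous_ofReal.continuousAt.comp (OneEnded.r_contDiffAt hp).continuousAt).mul
    (sol.contDiffAt_covU hp).continuousAt

lemma GrowthBound.of_left (sol : IsEMKG S F q₀ m2) {u v : ℝ} (hp : (u, v) ∈ S.bulk) (hc : c < u)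
    (h : ∀ w ∈ Ico c u, GrowthBound S F q₀ ρ k B (w, v)) : GrowthBound S F q₀ ρ k B (u, v) where
  r_ge := neg_le_neg_iff.1 (le_of_forall_Ico_le (f := fun p => -S.r p)
    (OneEnded.r_contDiffAt hp).continuousAt.neg hc fun w hw => neg_le_neg (h w hw).r_ge)
  lam_le := le_of_forall_Ico_le (OneEnded.lam_contDiffAt hp).continuousAt hc
    fun w hw => (h w hw).lam_le
  phi_le := le_of_forall_Ico_le (f := fun p => ‖F.φ p‖)
    (sol.smooth_φ _ (OneEnded.mem_of_bulk hp)).continuousAt.norm hc fun w hw => (h w hw).phi_le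
  chi_le := le_of_forall_Ico_le (f := fun p => ‖chi S F q₀ p‖)
    (sol.continuousAt_chi hp).norm hc fun w hw => (h w hw).chi_le
  charge_le := le_of_forall_Ico_le (f := fun p => |F.charge p|)
    (sol.smooth_charge _ (OneEnded.mem_of_bulk hp)).continuousAt.abs hc
    fun w hw => (h w hw).charge_le

/-- Openness step of the bootstrap: room in `ρ`, `k`, `B` makes the inequalities strict. Positivity
of `p.2` is needed for the room in `B` to be visible after multiplication by the weights. -/
lemma GrowthBound.eventually (sol : IsEMKG S F q₀ m2) {p : ℝ × ℝ} (hp : p ∈ S.bulk)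
    (hv : 0 < p.2) {ρ' k' B' : ℝ} (hρ : ρ < ρ') (hk : k < k') (hB : B' < B)
    (h : GrowthBound S F q₀ ρ' k' B' p) : ∀ᶠ q in 𝓝 p, GrowthBound S F q₀ ρ k B q := by
  have hQ := OneEnded.mem_of_bulk hp
  have hs : 0 < √p.2 := Real.sqrt_pos.2 hv
  have hsc : ContinuousAt (fun q : ℝ × ℝ => √q.2) p := continuousAt_snd.sqrt
  filter_upwards [(OneEnded.r_contDiffAt hp).continuousAt.eventually_const_lt (hρ.trans_le h.r_ge),
    (OneEnded.lam_contDiffAt hp).continuousAt.eventually_lt_const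
      (h.lam_le.trans_lt (neg_lt_neg hk)),
    ((sol.smooth_φ _ hQ).continuousAt.norm).eventually_lt (continuousAt_const.mul hsc)
      (h.phi_le.trans_lt (mul_lt_mul_of_pos_right hB hs)),
    ((sol.continuousAt_chi hp).norm).eventually_lt (continuousAt_const.div hsc hs.ne')
      (h.chi_le.trans_lt (div_lt_div_of_pos_right hB hs)),
    ((sol.smooth_charge _ hQ).continuousAt.abs).eventually_lt
      (continuousAt_const.mul continuousAt_snd)
      (h.charge_le.trans_lt (mul_lt_mul_of_pos_right hB hv))] with q h1 h2 h3 h4 h5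
  exact ⟨h1.le, h2.le, h3.le, h4.le, h5.le⟩

/-- Exponential decay of the lapse along outgoing rays. -/
lemma lapse_le_exp_mul {u v w : ℝ} (hvw : v ≤ w) (hb : ∀ y ∈ Icc v w, (u, y) ∈ S.bulk)
    (hl : ∀ y ∈ Icc v w, S.lam (u, y) ≤ -k) :
    S.lapse (u, w) ≤ Real.exp (-(k * (w - v))) * S.lapse (u, v) := by
  have h := sub_le_sub_of_hasDerivAt_le hvw (f := fun y => Real.log (S.lapse (u, y)))
    (g := fun y => -k * y)
    (fun t ht => hasDerivAt_dv (OneEnded.log_lapse_contDiffAt (OneEnded.mem_of_bulk (hb t ht))))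
    (fun t _ => (hasDerivAt_id t).const_mul (-k)) (fun t ht => by
      rw [mul_one]; exact hl t ht)
  have hw := OneEnded.lapse_pos_of_bulk (hb w (right_mem_Icc.2 hvw))
  have hv := OneEnded.lapse_pos_of_bulk (hb v (left_mem_Icc.2 hvw))
  rw [← Real.log_le_log_iff hw (by positivity), Real.log_mul (Real.exp_pos _).ne' hv.ne',
    Real.log_exp]
  linarith

/-- Pointwise consequences of the growth bounds, once the lapse decays. -/
lemma GrowthBound.pointwise (hm : 0 ≤ m2) (hρ : 0 < ρ) (hB : 0 ≤ B)
    {N : ℝ} {p : ℝ × ℝ} (hp : p ∈ S.bulk) (hv : 1 ≤ p.2) (hrR : S.r p ≤ R)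
    (hΩ : S.lapse p * p.2 ^ 4 ≤ N) (h : GrowthBound S F q₀ ρ k B p) :
    |S.lapse p * areaSource S F m2 p| ≤ (1 + B ^ 2 / ρ ^ 2 + m2 * R ^ 2 * B ^ 2) * N / p.2 ^ 2 ∧
    S.lapse p * (|q₀| * |F.charge p| / (4 * S.r p) + m2 * S.r p / 4) * ‖F.φ p‖ ≤
      (|q₀| * B / ρ + m2 * R) * B * N / p.2 ^ 2 ∧
    S.lapse p / (2 * S.r p ^ 2) * (1 + 2 * F.charge p ^ 2 / S.r p ^ 2) ≤
      (1 / ρ ^ 2 + B ^ 2 / ρ ^ 4) * N := by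
  have hr := OneEnded.r_pos_of_bulk hp
  have hl := OneEnded.lapse_pos_of_bulk hp
  have hrρ := h.r_ge
  have hR : 0 < R := hr.trans_le hrR
  set v := p.2
  have hv0 : 0 < v := by linarith
  have hsv : √v ≤ v := by
    rw [Real.sqrt_le_left hv0.le]; nlinarith
  have hφ : ‖F.φ p‖ ≤ B * v := h.phi_le.trans (by gcongr)
  have hφ2 : ‖F.φ p‖ ^ 2 ≤ B ^ 2 * v ^ 2 := by
    rw [← mul_pow]; gcongr
  have hQ2 : F.charge p ^ 2 ≤ B ^ 2 * v ^ 2 := by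
    rw [← mul_pow, ← sq_abs]; gcongr; exact h.charge_le
  have hv2 : 1 ≤ v ^ 2 := one_le_pow₀ hv
  have hlap : S.lapse p * v ^ 2 ≤ N / v ^ 2 := by
    rw [le_div_iff₀ (by positivity)]
    calc _ = S.lapse p * v ^ 4 := by ring
      _ ≤ N := hΩ
  have hlap' : S.lapse p * v ^ 2 ≤ N := by
    refine le_trans ?_ hΩ
    have : v ^ 2 ≤ v ^ 4 := pow_le_pow_right₀ hv (by norm_num)
    gcongr
  have hQr : F.charge p ^ 2 / S.r p ^ 2 ≤ B ^ 2 / ρ ^ 2 * v ^ 2 := by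
    calc F.charge p ^ 2 / S.r p ^ 2 ≤ (B ^ 2 * v ^ 2) / ρ ^ 2 := by gcongr
      _ = _ := by ring
  refine ⟨?_, ?_, ?_⟩
  · have h1 : |areaSource S F m2 p| ≤ (1 + B ^ 2 / ρ ^ 2 + m2 * R ^ 2 * B ^ 2) * v ^ 2 := by
      have h2 : m2 * S.r p ^ 2 * ‖F.φ p‖ ^ 2 ≤ m2 * R ^ 2 * (B ^ 2 * v ^ 2) := by gcongr
      have h3 : 0 ≤ m2 * S.r p ^ 2 * ‖F.φ p‖ ^ 2 := by positivity
      have h4 : 0 ≤ F.charge p ^ 2 / S.r p ^ 2 := by positivity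
      have h5 : 0 ≤ B ^ 2 / ρ ^ 2 * v ^ 2 := by positivity
      have h6 : 0 ≤ m2 * R ^ 2 * (B ^ 2 * v ^ 2) := by positivity
      unfold areaSource
      rw [abs_le]
      constructor <;> linarith
    rw [abs_mul, abs_of_pos hl]
    calc _ ≤ S.lapse p * ((1 + B ^ 2 / ρ ^ 2 + m2 * R ^ 2 * B ^ 2) * v ^ 2) := by gcongr
      _ = (1 + B ^ 2 / ρ ^ 2 + m2 * R ^ 2 * B ^ 2) * (S.lapse p * v ^ 2) := by ring
      _ ≤ (1 + B ^ 2 / ρ ^ 2 + m2 * R ^ 2 * B ^ 2) * (N / v ^ 2) := by gcongr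
      _ = _ := by ring
  · have h1 : |q₀| * |F.charge p| / (4 * S.r p) + m2 * S.r p / 4 ≤ (|q₀| * B / ρ + m2 * R) * v := by
      have h2 : |q₀| * |F.charge p| / (4 * S.r p) ≤ |q₀| * (B * v) / (1 * ρ) := by
        gcongr
        · exact h.charge_le
        · norm_num
      have h3 : m2 * S.r p / 4 ≤ m2 * R * v := by
        have h4 : m2 * S.r p ≤ m2 * R := by gcongr
        have h5 : 0 ≤ m2 * S.r p := by positivity
        nlinarith
      calc _ ≤ |q₀| * (B * v) / (1 * ρ) + m2 * R * v := add_le_add h2 h3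
        _ = _ := by ring
    calc _ ≤ S.lapse p * ((|q₀| * B / ρ + m2 * R) * v) * (B * v) := by gcongr
      _ = (|q₀| * B / ρ + m2 * R) * B * (S.lapse p * v ^ 2) := by ring
      _ ≤ (|q₀| * B / ρ + m2 * R) * B * (N / v ^ 2) := by gcongr
      _ = _ := by ring
  · have h1 : 1 + 2 * F.charge p ^ 2 / S.r p ^ 2 ≤ (2 + 2 * (B ^ 2 / ρ ^ 2)) * v ^ 2 := by
      have : 2 * F.charge p ^ 2 / S.r p ^ 2 = 2 * (F.charge p ^ 2 / S.r p ^ 2) := by ring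
      rw [this]
      linarith
    calc _ ≤ S.lapse p / (2 * ρ ^ 2) * ((2 + 2 * (B ^ 2 / ρ ^ 2)) * v ^ 2) := by gcongr
      _ = (1 / ρ ^ 2 + B ^ 2 / ρ ^ 4) * (S.lapse p * v ^ 2) := by field_simp
      _ ≤ _ := by gcongr

end LocalStability

section LocalStability

variable {S : OneEnded} {F : Matter} {q₀ m2 : ℝ}

lemma norm_covU_le {ρ n : ℝ} {p : ℝ × ℝ} (hp : p ∈ S.bulk) (hρ : 0 < ρ) (hr : ρ ≤ S.r p)
    (h : ‖psi S F q₀ p‖ ≤ n) : ‖F.covU q₀ F.φ p‖ ≤ n / ρ := by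
  rw [IsEMKG.norm_psi hp] at h
  rw [le_div_iff₀ hρ]
  nlinarith [norm_nonneg (F.covU q₀ F.φ p)]

lemma norm_covV_le {ρ n : ℝ} {p : ℝ × ℝ} (hp : p ∈ S.bulk) (hρ : 0 < ρ) (hr : ρ ≤ S.r p)
    (h : ‖chi S F q₀ p‖ ≤ n) : ‖F.covV q₀ F.φ p‖ ≤ n / ρ := by
  rw [IsEMKG.norm_chi hp] at h
  rw [le_div_iff₀ hρ]
  nlinarith [norm_nonneg (F.covV q₀ F.φ p)]

lemma abs_le_div_of_abs_mul_le {ρ r x n : ℝ} (hρ : 0 < ρ) (hr : ρ ≤ r) (h : |r * x| ≤ n) :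
    |x| ≤ n / ρ := by
  rw [abs_mul, abs_of_pos (hρ.trans_le hr)] at h
  rw [le_div_iff₀ hρ]
  nlinarith [abs_nonneg x]

/-- Propagation of the ingoing derivatives along outgoing rays. -/
lemma exists_outgoing_bound (sol : IsEMKG S F q₀ m2) (hm : 0 ≤ m2) {ρ k B R N : ℝ} (hρ : 0 < ρ)
    (hB : 0 ≤ B) (hN : 0 ≤ N) : ∃ K ≥ 0, ∀ u V W : ℝ, 1 ≤ V →
      (∀ v ∈ Icc V W, (u, v) ∈ S.bulk ∧ S.r (u, v) ≤ R ∧ S.lapse (u, v) * v ^ 4 ≤ N ∧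
        GrowthBound S F q₀ ρ k B (u, v)) →
      |S.r (u, V) * du S.r (u, V)| ≤ N → ‖psi S F q₀ (u, V)‖ ≤ N →
      ∀ v ∈ Icc V W, |S.r (u, v) * du S.r (u, v)| ≤ K ∧ ‖psi S F q₀ (u, v)‖ ≤ K * √v := by
  set h₁ := (1 + B ^ 2 / ρ ^ 2 + m2 * R ^ 2 * B ^ 2) * N with hh₁
  have hh₁0 : 0 ≤ h₁ := by positivity
  set h₂ := |(|q₀| * B / ρ + m2 * R) * B * N| with hh₂
  set K₁ := N + h₁ with hK₁
  have hK₁0 : 0 ≤ K₁ := by positivity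
  set K₂ := K₁ / ρ * (B / ρ) + h₂ with hK₂
  have hK₂0 : 0 ≤ K₂ := by positivity
  refine ⟨max K₁ (N + 2 * K₂), hK₁0.trans (le_max_left _ _), fun u V W hV hbd hr hψ => ?_⟩
  have hV0 : 0 < V := by linarith
  have hrdu : ∀ v ∈ Icc V W, |S.r (u, v) * du S.r (u, v)| ≤ K₁ := by
    intro v hv
    have hpos : ∀ t ∈ Icc V v, t ≠ 0 := fun t ht => by linarith [ht.1]
    -- The source is at most `h₁ / t²`, whose primitive `-h₁ / t` is bounded on `[1, ∞)`.
    have h := abs_sub_le_of_abs_hasDerivAt_le hv.1 (f := fun y => S.r (u, y) * du S.r (u, y))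
      (g := fun y => -(h₁ * y⁻¹))
      (fun t ht => OneEnded.hasDerivAt_r_mul_du_r (hbd t ⟨ht.1, ht.2.trans hv.2⟩).1)
      (fun t ht => ((hasDerivAt_inv (hpos t ht)).const_mul h₁).neg) (fun t ht => by
        obtain ⟨hb, hR, hΩ, hG⟩ := hbd t ⟨ht.1, ht.2.trans hv.2⟩
        rw [sol.area_eq hb]
        refine (hG.pointwise hm hρ hB hb (hV.trans ht.1) hR hΩ).1.trans_eq ?_
        simp only
        ring)
    have h3 : h₁ * V⁻¹ ≤ h₁ := mul_le_of_le_one_right hh₁0 (inv_le_one_of_one_le₀ hV)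
    have h4 : 0 ≤ h₁ * v⁻¹ := mul_nonneg hh₁0 (inv_nonneg.2 (hV0.le.trans hv.1))
    have h5 := abs_sub_abs_le_abs_sub (S.r (u, v) * du S.r (u, v)) (S.r (u, V) * du S.r (u, V))
    linarith
  intro v hv
  refine ⟨(hrdu v hv).trans (le_max_left _ _), ?_⟩
  -- The source is at most `K₂ / √t`: the main part is `∂ᵤ r · Dᵥ φ` with `∂ᵤ r` bounded. Its
  -- primitive `2 K₂ √t` is the origin of the growth rate of `r Dᵤ φ`.
  have h := abs_norm_sub_norm_le_of_transport hv.1 (ψ := fun y => psi S F q₀ (u, y))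
    (g := fun y => 2 * K₂ * √y)
    (fun t ht => sol.hasDerivAt_psi (hbd t ⟨ht.1, ht.2.trans hv.2⟩).1)
    (fun t ht => (Real.hasDerivAt_sqrt (by linarith [ht.1] : t ≠ 0)).const_mul (2 * K₂))
    (fun t ht => by
      obtain ⟨hb, hR, hΩ, hG⟩ := hbd t ⟨ht.1, ht.2.trans hv.2⟩
      have ht1 : 1 ≤ t := hV.trans ht.1
      have ht0 : 0 < t := by linarith
      have hs : 0 < √t := Real.sqrt_pos.2 ht0
      refine (IsEMKG.norm_psiSource_le hm hb).trans ?_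
      have h1 := abs_le_div_of_abs_mul_le hρ hG.r_ge (hrdu t ⟨ht.1, ht.2.trans hv.2⟩)
      have h2 := norm_covV_le hb hρ hG.r_ge hG.chi_le
      have h3 := (hG.pointwise hm hρ hB hb ht1 hR hΩ).2.1
      have h4 : (|q₀| * B / ρ + m2 * R) * B * N / t ^ 2 ≤ h₂ / √t := by
        gcongr
        · exact le_abs_self _
        · rw [Real.sqrt_le_left (by positivity)]
          nlinarith [pow_le_pow_right₀ ht1 (by norm_num : 1 ≤ 4)]
      calc _ ≤ K₁ / ρ * (B / √t / ρ) + h₂ / √t := by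
            refine add_le_add (mul_le_mul h1 h2 (norm_nonneg _) (by positivity)) (h3.trans h4)
        _ = 2 * K₂ * (1 / (2 * √t)) := by rw [hK₂]; field_simp)
  have hs1 : 1 ≤ √v := Real.one_le_sqrt.2 (hV.trans hv.1)
  have h1 := (abs_le.1 h).2
  have h2 : 0 ≤ 2 * K₂ * √V := by positivity
  calc ‖psi S F q₀ (u, v)‖ ≤ N + 2 * K₂ * √v := by linarith
    _ ≤ N * √v + 2 * K₂ * √v := by nlinarith
    _ = (N + 2 * K₂) * √v := by ring
    _ ≤ _ := by gcongr; exact le_max_right _ _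

set_option maxHeartbeats 1000000 in
/-- Propagation along short ingoing rays. -/
lemma exists_ingoing_bound (sol : IsEMKG S F q₀ m2) (hm : 0 ≤ m2) {ρ k B R N K : ℝ} (hρ : 0 < ρ)
    (hB : 0 ≤ B) (hN : 0 ≤ N) (hK : 0 ≤ K) : ∃ L ≥ 0, ∀ c b v : ℝ, 1 ≤ v → c ≤ b → b ≤ c + 1 →
      (∀ u ∈ Icc c b, (u, v) ∈ S.bulk ∧ S.r (u, v) ≤ R ∧ S.lapse (u, v) * v ^ 4 ≤ N ∧
        GrowthBound S F q₀ ρ k B (u, v) ∧ |S.r (u, v) * du S.r (u, v)| ≤ K ∧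
        ‖psi S F q₀ (u, v)‖ ≤ K * √v) →
      |S.r (c, v) * dv S.r (c, v)| ≤ N / v →
      S.r (c, v) - L * (b - c) ≤ S.r (b, v) ∧ S.lam (b, v) ≤ S.lam (c, v) + L * (b - c) ∧
      ‖F.φ (b, v)‖ ≤ ‖F.φ (c, v)‖ + L * (b - c) * √v ∧
      ‖chi S F q₀ (b, v)‖ ≤ ‖chi S F q₀ (c, v)‖ + L * (b - c) / √v ∧
      |F.charge (b, v)| ≤ |F.charge (c, v)| + L * (b - c) * v := by
  set h₁ := (1 + B ^ 2 / ρ ^ 2 + m2 * R ^ 2 * B ^ 2) * N with hh₁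
  have hh₁0 : 0 ≤ h₁ := by positivity
  set h₂ := |(|q₀| * B / ρ + m2 * R) * B * N| with hh₂
  set h₃ := (1 / ρ ^ 2 + B ^ 2 / ρ ^ 4) * N with hh₃
  have hh₃0 : 0 ≤ h₃ := by positivity
  set K₁ := N + h₁ with hK₁
  have hK₁0 : 0 ≤ K₁ := by positivity
  -- Weighted rates of change in `u`: `L₁` for `r` and `φ`, `L₂` for `r Dᵥ φ`, `L₃` for the charge,
  -- `L₄` for `λ`. None depends on `v`.
  set L₁ := K / ρ with hL₁
  set L₂ := K₁ / ρ * (K / ρ) + h₂ with hL₂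
  set L₃ := |q₀| * R ^ 2 * B * (K / ρ) with hL₃
  set L₄ := 2 * (K / ρ) * (B / ρ) + (h₃ + 2 * (K / ρ) * (K₁ / ρ) / ρ ^ 2) with hL₄
  have hL₁0 : 0 ≤ L₁ := by positivity
  have hL₂0 : 0 ≤ L₂ := by positivity
  have hL₃0 : 0 ≤ L₃ := by positivity
  have hL₄0 : 0 ≤ L₄ := by positivity
  clear_value L₁ L₂ L₃ L₄
  refine ⟨L₁ + L₂ + L₃ + L₄, by positivity, fun c b v hv hcb hb1 hbd hdv => ?_⟩
  have hv0 : 0 < v := by linarith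
  have hs : 0 < √v := Real.sqrt_pos.2 hv0
  have hss : √v * √v = v := Real.mul_self_sqrt hv0.le
  have hs1 : 1 ≤ √v := Real.one_le_sqrt.2 hv
  have hvv : v ≤ v ^ 2 := le_self_pow₀ hv (by norm_num)
  have hsv2 : √v ≤ v ^ 2 := ((Real.sqrt_le_left hv0.le).2 hvv).trans hvv
  have hbc : 0 ≤ b - c := by linarith
  have hlin : ∀ a : ℝ, ∀ t ∈ Icc c b, HasDerivAt (fun y => a * y) a t := fun a t _ => by
    simpa using (hasDerivAt_id t).const_mul a
  have hDu : ∀ u ∈ Icc c b, ‖F.covU q₀ F.φ (u, v)‖ ≤ K / ρ * √v := fun u hu => by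
    obtain ⟨hb, -, -, hG, -, hψ⟩ := hbd u hu
    refine (norm_covU_le hb hρ hG.r_ge hψ).trans_eq ?_
    ring
  have hDv : ∀ u ∈ Icc c b, ‖F.covV q₀ F.φ (u, v)‖ ≤ B / ρ / √v := fun u hu => by
    obtain ⟨hb, -, -, hG, -, -⟩ := hbd u hu
    refine (norm_covV_le hb hρ hG.r_ge hG.chi_le).trans_eq ?_
    ring
  have hdu : ∀ u ∈ Icc c b, |du S.r (u, v)| ≤ K / ρ := fun u hu => by
    obtain ⟨hb, -, -, hG, hd, -⟩ := hbd u hu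
    exact abs_le_div_of_abs_mul_le hρ hG.r_ge hd
  have hrdv : ∀ u ∈ Icc c b, |dv S.r (u, v)| ≤ K₁ / ρ / v := by
    intro u hu
    have h := abs_sub_le_of_abs_hasDerivAt_le hu.1 (f := fun x => S.r (x, v) * dv S.r (x, v))
      (g := fun x => h₁ / v ^ 2 * x)
      (fun t ht => OneEnded.hasDerivAt_r_mul_dv_r (hbd t ⟨ht.1, ht.2.trans hu.2⟩).1)
      (fun t ht => hlin _ t ⟨ht.1, ht.2.trans hu.2⟩) (fun t ht => by
        obtain ⟨hb, hR, hΩ, hG, -⟩ := hbd t ⟨ht.1, ht.2.trans hu.2⟩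
        rw [sol.area_eq hb]
        exact (hG.pointwise hm hρ hB hb hv hR hΩ).1)
    have h5 := abs_sub_abs_le_abs_sub (S.r (u, v) * dv S.r (u, v)) (S.r (c, v) * dv S.r (c, v))
    have h6 : h₁ / v ^ 2 * (u - c) ≤ h₁ / v := by
      calc _ ≤ h₁ / v ^ 2 * 1 := by gcongr; linarith [hu.2]
        _ ≤ h₁ / v := by
          rw [mul_one]
          gcongr
    have h7 : |S.r (u, v) * dv S.r (u, v)| ≤ K₁ / v := by
      rw [hK₁, add_div]
      linarith
    refine (abs_le_div_of_abs_mul_le hρ (hbd u hu).2.2.2.1.r_ge h7).trans_eq ?_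
    ring
  have hmono : ∀ {a : ℝ}, a ≤ L₁ + L₂ + L₃ + L₄ →
      a * (b - c) ≤ (L₁ + L₂ + L₃ + L₄) * (b - c) := fun h => by gcongr
  refine ⟨?_, ?_, ?_, ?_, ?_⟩
  · have h := abs_sub_le_of_abs_hasDerivAt_le hcb (f := fun x => S.r (x, v))
      (fun t ht => OneEnded.hasDerivAt_r_du (hbd t ht).1) (hlin L₁)
      (hL₁ ▸ hdu)
    have h1 := (abs_le.1 h).1
    have h2 := hmono (a := L₁) (by linarith)
    linarith
  · have h := abs_sub_le_of_abs_hasDerivAt_le hcb (f := fun x => S.lam (x, v))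
      (fun t ht => IsEMKG.hasDerivAt_lam (hbd t ht).1) (hlin L₄) (fun t ht => by
        obtain ⟨hb, hR, hΩ, hG, -⟩ := hbd t ht
        refine (sol.abs_du_lam_le hb).trans ?_
        have h3 := (hG.pointwise hm hρ hB hb hv hR hΩ).2.2
        -- The growth `√v` of `Dᵤ φ` and the decay `1 / √v` of `Dᵥ φ` cancel exactly; this fixes the
        -- weights of `GrowthBound`.
        have h4 : 2 * ‖F.covU q₀ F.φ (t, v)‖ * ‖F.covV q₀ F.φ (t, v)‖ ≤
            2 * (K / ρ) * (B / ρ) := by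
          calc _ ≤ 2 * (K / ρ * √v) * (B / ρ / √v) := by
                gcongr
                · exact hDu t ht
                · exact hDv t ht
            _ = _ := by field_simp
        have h5 : |dv S.r (t, v)| ≤ K₁ / ρ :=
          (hrdv t ht).trans (div_le_self (by positivity) hv)
        rw [hL₄]
        refine add_le_add h4 (add_le_add h3 ?_)
        have := hG.r_ge
        gcongr
        · exact hdu t ht)
    have h1 := (abs_le.1 h).2
    have h2 := hmono (a := L₄) (by linarith)
    linarith
  · have h := abs_norm_sub_norm_le_of_transport hcb (ψ := fun x => F.φ (x, v))
      (fun t ht => sol.hasDerivAt_phi_du (hbd t ht).1) (hlin (L₁ * √v))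
      (hL₁ ▸ hDu)
    have h1 := (abs_le.1 h).2
    have h2 := mul_le_mul_of_nonneg_right (hmono (a := L₁) (by linarith)) hs.le
    have h3 : L₁ * √v * b - L₁ * √v * c = L₁ * (b - c) * √v := by ring
    linarith
  · have h := abs_norm_sub_norm_le_of_transport hcb (ψ := fun x => chi S F q₀ (x, v))
      (fun t ht => sol.hasDerivAt_chi (hbd t ht).1) (hlin (L₂ / √v)) (fun t ht => by
        obtain ⟨hb, hR, hΩ, hG, -⟩ := hbd t ht
        refine (IsEMKG.norm_chiSource_le hm hb).trans ?_
        have h3 := (hG.pointwise hm hρ hB hb hv hR hΩ).2.1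
        have h4 : (|q₀| * B / ρ + m2 * R) * B * N / v ^ 2 ≤ h₂ / √v := by
          gcongr
          exact le_abs_self _
        calc _ ≤ K₁ / ρ / v * (K / ρ * √v) + h₂ / √v :=
              add_le_add (mul_le_mul (hrdv t ht) (hDu t ht) (norm_nonneg _) (by positivity))
                (h3.trans h4)
          _ = L₂ / √v := by
            have e : K₁ / ρ / v * (K / ρ * √v) = K₁ / ρ * (K / ρ) / √v := by
              rw [div_mul_eq_mul_div, div_eq_div_iff hv0.ne' hs.ne']
              linear_combination (K₁ / ρ * (K / ρ)) * hss
            rw [hL₂, e, ← add_div])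
    have h1 := (abs_le.1 h).2
    have h2 := div_le_div_of_nonneg_right (hmono (a := L₂) (by linarith)) hs.le
    have h3 : L₂ / √v * b - L₂ / √v * c = L₂ * (b - c) / √v := by ring
    linarith
  · have h := abs_sub_le_of_abs_hasDerivAt_le hcb (f := fun x => F.charge (x, v))
      (fun t ht => sol.hasDerivAt_charge (hbd t ht).1) (hlin (L₃ * v)) (fun t ht => by
        obtain ⟨hb, hR, hΩ, hG, -⟩ := hbd t ht
        refine (sol.abs_du_charge_le hb).trans ?_
        have hr := (OneEnded.r_pos_of_bulk hb).le
        calc _ ≤ |q₀| * R ^ 2 * (B * √v) * (K / ρ * √v) := by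
              gcongr
              · exact hG.phi_le
              · exact hDu t ht
          _ = |q₀| * R ^ 2 * B * (K / ρ) * (√v * √v) := by ring
          _ = _ := by rw [hss, hL₃])
    have h1 := abs_sub_abs_le_abs_sub (F.charge (b, v)) (F.charge (c, v))
    have h2 := mul_le_mul_of_nonneg_right (hmono (a := L₃) (by linarith)) hv0.le
    have h3 : L₃ * v * b - L₃ * v * c = L₃ * (b - c) * v := by ring
    linarith

end LocalStability

section LocalStability

variable {S : OneEnded} {F : Matter} {q₀ m2 : ℝ}

/-- Local stability in the ingoing direction, uniformly up to `v = ∞`: an outgoing cone on which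
the lapse decays exponentially and the field decays like `v ^ (-1/2)` is followed by cones on
which `r` stays away from zero. -/
theorem exists_r_ge_of_cone (sol : IsEMKG S F q₀ m2) (hm : 0 ≤ m2) {c x V k ρ R B₀ : ℝ}
    (hcx : c < x) (hV : 1 ≤ V) (hk : 0 < k) (hρ : 0 < ρ) (hB₀ : 0 ≤ B₀)
    (hb : ∀ u ∈ Icc c x, ∀ v ≥ V, (u, v) ∈ S.bulk)
    (hR : ∀ u ∈ Icc c x, ∀ v ≥ V, S.r (u, v) ≤ R)
    (hcr : ∀ v ≥ V, 2 * ρ ≤ S.r (c, v)) (hcl : ∀ v ≥ V, S.lam (c, v) ≤ -(2 * k))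
    (hcφ : ∀ v ≥ V, ‖F.φ (c, v)‖ ≤ B₀) (hcχ : ∀ v ≥ V, ‖chi S F q₀ (c, v)‖ ≤ B₀ / √v)
    (hcd : ∀ v ≥ V, |S.r (c, v) * dv S.r (c, v)| ≤ B₀ / v)
    (hcQ : ∀ v ≥ V, |F.charge (c, v)| ≤ B₀) :
    ∃ b ∈ Ioc c x, ∀ v ≥ V, ρ ≤ S.r (b, v) := by
  obtain ⟨N₁, hN₁0, hN₁⟩ := exists_bound_on_ingoing (f := fun p => |S.r p * du S.r p|) (c := c)
    (x := x) (V := V) fun u hu => ((OneEnded.r_contDiffAt (hb u hu V le_rfl)).continuousAt.mul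
      (OneEnded.continuousAt_du_r (hb u hu V le_rfl))).abs
  obtain ⟨N₂, hN₂0, hN₂⟩ := exists_bound_on_ingoing (f := fun p => ‖psi S F q₀ p‖) (c := c)
    (x := x) (V := V) fun u hu => (sol.continuousAt_psi (hb u hu V le_rfl)).norm
  obtain ⟨N₃, hN₃0, hN₃⟩ := exists_bound_on_ingoing (f := S.lapse) (c := c)
    (x := x) (V := V) fun u hu => (OneEnded.lapse_contDiffAt (hb u hu V le_rfl)).continuousAt
  set N₄ := N₃ * Real.exp (k * V) * (24 / k ^ 4)
  have hN₄0 : 0 ≤ N₄ := by positivity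
  -- One constant for the data on `v = V`, the cone `u = c`, and the bound on `Ω² v⁴`.
  set N := B₀ + N₁ + N₂ + N₄
  have hN0 : 0 ≤ N := by positivity
  set B := B₀ + 1 with hB
  have hB0 : 0 ≤ B := by positivity
  obtain ⟨K, hK0, hK⟩ := exists_outgoing_bound sol hm (k := k) (R := R) hρ hB0 hN0
  obtain ⟨L, hL0, hL⟩ := exists_ingoing_bound sol hm (k := k) (R := R) hρ hB0 hN0 hK0
  -- The length is chosen so that `L δ` uses at most half of each gap between data (`2 ρ`, `2 k`,
  -- `B₀`) and bootstrap bound (`ρ`, `k`, `B₀ + 1`); the entry `1` meets the length restriction of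
  -- `exists_ingoing_bound`.
  set δ := min 1 (min (1 / 2) (min (k / 2) (ρ / 2)) / (L + 1)) with hδ
  have hmin0 : 0 < min (1 / 2) (min (k / 2) (ρ / 2)) := by positivity
  have hδ0 : 0 < δ := by positivity
  have hLδ : L * δ ≤ min (1 / 2) (min (k / 2) (ρ / 2)) := by
    have h1 : δ ≤ min (1 / 2) (min (k / 2) (ρ / 2)) / (L + 1) := min_le_right _ _
    rw [le_div_iff₀ (by positivity)] at h1
    nlinarith
  rw [le_min_iff, le_min_iff] at hLδ
  obtain ⟨hL1, hL2, hL3⟩ := hLδ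
  set b := min x (c + δ)
  have hcb : c < b := lt_min hcx (by linarith)
  have hbx : b ≤ x := min_le_left _ _
  have hbδ : b - c ≤ δ := by linarith [min_le_right x (c + δ)]
  refine ⟨b, ⟨hcb, hbx⟩, fun W hW => ?_⟩
  have hv1 : ∀ v ∈ Icc V W, 1 ≤ v := fun v hv => hV.trans hv.1
  have hs1 : ∀ v ∈ Icc V W, 1 ≤ √v := fun v hv => Real.one_le_sqrt.2 (hv1 v hv)
  -- The height `W` is finite so that openness can use compactness of `[V, W]`; `b` was chosen
  -- before `W`, so the conclusion holds for all `v`.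
  suffices h : ∀ u ∈ Icc c b, ∀ v ∈ Icc V W, GrowthBound S F q₀ ρ k B (u, v) from
    (h b (right_mem_Icc.2 hcb.le) W (right_mem_Icc.2 hW)).r_ge
  refine continuity_induction ?_ ?_ ?_
  · intro v hv
    have h1 := hs1 v hv
    have h2 := hv1 v hv
    refine ⟨by linarith [hcr v hv.1], by linarith [hcl v hv.1], ?_, ?_, ?_⟩
    · refine (hcφ v hv.1).trans ?_
      simp only
      nlinarith
    · refine (hcχ v hv.1).trans ?_
      simp only
      gcongr
      linarith
    · refine (hcQ v hv.1).trans ?_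
      simp only
      nlinarith
  · intro u hu h v hv
    exact GrowthBound.of_left sol (hb u ⟨hu.1.le, hu.2.trans hbx⟩ v hv.1) hu.1
      fun w hw => h w hw v hv
  · intro u hu h
    have hux : u ≤ x := hu.2.le.trans hbx
    have hall : ∀ w ∈ Icc c u, ∀ v ∈ Icc V W, (w, v) ∈ S.bulk ∧ S.r (w, v) ≤ R ∧
        S.lapse (w, v) * v ^ 4 ≤ N ∧ GrowthBound S F q₀ ρ k B (w, v) := by
      intro w hw v hv
      have hwx : w ∈ Icc c x := ⟨hw.1, hw.2.trans hux⟩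
      refine ⟨hb w hwx v hv.1, hR w hwx v hv.1, ?_, h w hw v hv⟩
      have h1 := lapse_le_exp_mul (S := S) (u := w) hv.1 (fun y hy => hb w hwx y hy.1)
        (fun y hy => (h w hw y ⟨hy.1, hy.2.trans hv.2⟩).lam_le)
      have h2 := hN₃ w hwx
      have h3 := pow_four_mul_exp_le hk (by linarith [hv1 v hv] : 0 ≤ v)
      have hv0 : 0 < v := by linarith [hv1 v hv]
      calc S.lapse (w, v) * v ^ 4 ≤ (Real.exp (-(k * (v - V))) * N₃) * v ^ 4 := by
            gcongr
            exact h1.trans (by gcongr)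
        _ = N₃ * Real.exp (k * V) * (Real.exp (-(k * v)) * v ^ 4) := by
            rw [show -(k * (v - V)) = k * V + -(k * v) by ring, Real.exp_add]; ring
        _ ≤ N₄ := mul_le_mul_of_nonneg_left h3 (by positivity)
        _ ≤ N := by simp only [N]; linarith
    have himp : ∀ v ∈ Icc V W, GrowthBound S F q₀ (3 / 2 * ρ) (3 / 2 * k) (B₀ + 1 / 2) (u, v) := by
      intro v hv
      have hout : ∀ w ∈ Icc c u, |S.r (w, v) * du S.r (w, v)| ≤ K ∧ ‖psi S F q₀ (w, v)‖ ≤ K * √v := by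
        intro w hw
        have hwx : w ∈ Icc c x := ⟨hw.1, hw.2.trans hux⟩
        refine hK w V W hV (hall w hw) ?_ ?_ v hv
        · exact (hN₁ w hwx).trans (by simp only [N]; linarith)
        · exact (hN₂ w hwx).trans (by simp only [N]; linarith)
      have hu1 : u - c ≤ δ := by linarith [hu.2]
      obtain ⟨i1, i2, i3, i4, i5⟩ := hL c u v (hv1 v hv) hu.1
        (by linarith [min_le_left 1 (min (1 / 2) (min (k / 2) (ρ / 2)) / (L + 1))])
        (fun w hw => ⟨(hall w hw v hv).1, (hall w hw v hv).2.1, (hall w hw v hv).2.2.1,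
          (hall w hw v hv).2.2.2, (hout w hw).1, (hout w hw).2⟩)
        ((hcd v hv.1).trans (by
          have := hv1 v hv
          gcongr
          simp only [N]; linarith))
      have hLu : L * (u - c) ≤ L * δ := by gcongr
      have h1 := hs1 v hv
      have h2 := hv1 v hv
      have hh : L * (u - c) ≤ 1 / 2 := hLu.trans hL1
      refine ⟨by linarith [hcr v hv.1], by linarith [hcl v hv.1], i3.trans ?_, i4.trans ?_,
        i5.trans ?_⟩
      · have := hcφ v hv.1
        simp only
        calc _ ≤ B₀ * 1 + 1 / 2 * √v := by rw [mul_one]; gcongr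
          _ ≤ B₀ * √v + 1 / 2 * √v := by gcongr
          _ = _ := by ring
      · have := hcχ v hv.1
        simp only
        rw [add_div]
        gcongr
      · have := hcQ v hv.1
        simp only
        calc _ ≤ B₀ * 1 + 1 / 2 * v := by rw [mul_one]; gcongr
          _ ≤ B₀ * v + 1 / 2 * v := by gcongr
          _ = _ := by ring
    refine Filter.Eventually.filter_mono nhdsWithin_le_nhds ?_
    refine isCompact_Icc.eventually_forall_of_forall_eventually fun v hv => ?_
    exact (himp v hv).eventually sol (hb u ⟨hu.1, hux⟩ v hv.1)
      (by simp only; linarith [hv1 v hv]) (by linarith) (by linarith) (by linarith)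

end LocalStability

/-! ### A priori estimates in a static region -/

section StaticRegion

/-- A rectangle `[a, b] × [V, ∞)` whose boundary at `v = ∞` has constant area-radius `rm` and
vanishing ingoing derivative of the field, with bounds on the geometry and on the field. -/
structure StaticRegion (S : OneEnded) (F : Matter) (q₀ rm ρ R k q η a b V : ℝ) : Prop where
  le : a ≤ b
  bulk : ∀ u ∈ Icc a b, ∀ v ≥ V, (u, v) ∈ S.bulk
  r_ge : ∀ u ∈ Icc a b, ∀ v ≥ V, ρ ≤ S.r (u, v)
  r_le : ∀ u ∈ Icc a b, ∀ v ≥ V, S.r (u, v) ≤ R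
  lapse_le : ∀ u ∈ Icc a b, ∀ v ≥ V, S.lapse (u, v) ≤ -8 * du S.r (u, v)
  r_lim : ∀ u ∈ Icc a b, Tendsto (fun v => S.r (u, v)) atTop (𝓝 rm)
  r_almost_mono : ∀ u ∈ Icc a b, ∀ v ≥ V, ∀ w ≥ v, S.r (u, v) - η ≤ S.r (u, w)
  covU_lim : ∀ u ∈ Icc a b, Tendsto (fun v => ‖F.covU q₀ F.φ (u, v)‖) atTop (𝓝 0)
  covU_bdd : ∃ M, ∀ u ∈ Icc a b, ∀ v ≥ V, ‖F.covU q₀ F.φ (u, v)‖ ≤ M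
  phi_le : ∀ u ∈ Icc a b, ∀ v ≥ V, ‖F.φ (u, v)‖ ≤ 1
  charge_le : ∀ u ∈ Icc a b, ∀ v ≥ V, |F.charge (u, v)| ≤ q
  charge_ge : ∀ u ∈ Icc a b, ∀ v ≥ V, S.r (u, v) ≤ |F.charge (u, v)|
  lam_le : ∀ u ∈ Icc a b, ∀ v ≥ V, S.lam (u, v) ≤ -k
  cone_dv : ∀ v ≥ V, |S.r (a, v) * dv S.r (a, v)| ≤ η
  cone_du : ∀ v ≥ V, -du S.r (a, v) ≤ S.lapse (a, v)

namespace StaticRegion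

variable {S : OneEnded} {F : Matter} {q₀ m2 rm ρ R k q η a b V : ℝ}

lemma mono (h : StaticRegion S F q₀ rm ρ R k q η a b V) {W : ℝ} (hW : V ≤ W) :
    StaticRegion S F q₀ rm ρ R k q η a b W where
  le := h.le
  bulk u hu v hv := h.bulk u hu v (hW.trans hv)
  r_ge u hu v hv := h.r_ge u hu v (hW.trans hv)
  r_le u hu v hv := h.r_le u hu v (hW.trans hv)
  lapse_le u hu v hv := h.lapse_le u hu v (hW.trans hv)
  r_lim := h.r_lim
  r_almost_mono u hu v hv := h.r_almost_mono u hu v (hW.trans hv)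
  covU_lim := h.covU_lim
  covU_bdd := h.covU_bdd.imp fun _ hM u hu v hv => hM u hu v (hW.trans hv)
  phi_le u hu v hv := h.phi_le u hu v (hW.trans hv)
  charge_le u hu v hv := h.charge_le u hu v (hW.trans hv)
  charge_ge u hu v hv := h.charge_ge u hu v (hW.trans hv)
  lam_le u hu v hv := h.lam_le u hu v (hW.trans hv)
  cone_dv v hv := h.cone_dv v (hW.trans hv)
  cone_du v hv := h.cone_du v (hW.trans hv)

/-- Nonnegativity comes from `charge_ge`: inside the static region the charge dominates the radius,
so `Q² / r²` outweighs the `-1`. -/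
lemma areaSource_mem (h : StaticRegion S F q₀ rm ρ R k q η a b V) (hm : 0 ≤ m2) (hρ : 0 < ρ)
    {u v : ℝ} (hu : u ∈ Icc a b) (hv : V ≤ v) :
    areaSource S F m2 (u, v) ∈ Icc 0 (q ^ 2 / ρ ^ 2 + m2 * R ^ 2) := by
  have hr := OneEnded.r_pos_of_bulk (h.bulk u hu v hv)
  have h1 := h.r_ge u hu v hv
  have h2 := h.r_le u hu v hv
  have h3 := h.charge_le u hu v hv
  have h4 := h.charge_ge u hu v hv
  have h5 := h.phi_le u hu v hv
  have h6 : 1 ≤ F.charge (u, v) ^ 2 / S.r (u, v) ^ 2 := by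
    rw [one_le_div (by positivity), ← sq_abs (F.charge _)]
    gcongr
  have h7 : F.charge (u, v) ^ 2 / S.r (u, v) ^ 2 ≤ q ^ 2 / ρ ^ 2 := by
    rw [← sq_abs (F.charge _)]
    gcongr
  have h8 : 0 ≤ m2 * S.r (u, v) ^ 2 * ‖F.φ (u, v)‖ ^ 2 := by positivity
  have h9 : m2 * S.r (u, v) ^ 2 * ‖F.φ (u, v)‖ ^ 2 ≤ m2 * R ^ 2 * 1 ^ 2 := by gcongr
  unfold areaSource
  constructor <;> linarith

/-- The ingoing derivative of `r` is controlled by the lapse. -/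
lemma neg_r_mul_du_r_le (h : StaticRegion S F q₀ rm ρ R k q η a b V) (sol : IsEMKG S F q₀ m2)
    (hm : 0 ≤ m2) (hρ : 0 < ρ) (hk : 0 < k) {u v : ℝ} (hu : u ∈ Icc a b) (hv : V ≤ v) :
    -(S.r (u, v) * du S.r (u, v)) ≤ ((q ^ 2 / ρ ^ 2 + m2 * R ^ 2) / k + R) * S.lapse (u, v) := by
  set A := q ^ 2 / ρ ^ 2 + m2 * R ^ 2
  have hA0 : 0 ≤ A := by positivity
  have hR : 0 ≤ R := hρ.le.trans ((h.r_ge u hu v hv).trans (h.r_le u hu v hv))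
  -- The main argument needs an interval to the left of `u`; on the first cone the hypothesis
  -- `cone_du` replaces it.
  rcases hu.1.eq_or_lt with rfl | hau
  · have h1 := h.cone_du v hv
    have h2 := OneEnded.lapse_pos_of_bulk (h.bulk a hu v hv)
    have h3 := h.r_le a hu v hv
    have h4 := OneEnded.r_pos_of_bulk (h.bulk a hu v hv)
    have h5 : 0 ≤ A / k * S.lapse (a, v) := by positivity
    have h6 : S.r (a, v) * -du S.r (a, v) ≤ R * S.lapse (a, v) :=
      mul_le_mul h3 h1 (by linarith [h.lapse_le a hu v hv]) hR
    linarith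
  suffices hmain : 0 ≤ S.r (u, v) * du S.r (u, v) + A / k * S.lapse (u, v) by
    have h2 := OneEnded.lapse_pos_of_bulk (h.bulk u hu v hv)
    have : 0 ≤ R * S.lapse (u, v) := by positivity
    linarith
  -- The quantity `G = r ∂ᵤ r + (A / k) Ω²` is nonincreasing in `v`, as `∂ᵥ (r ∂ᵤ r) ≤ A Ω²` and `∂ᵥ
  -- Ω² ≤ -k Ω²`. If `G < 0` at `(u, v)`, then `r ∂ᵤ r` stays below a negative constant on a strip
  -- `[c, u] × [v, ∞)`, and the limits of `r` at `c` and `u` cannot both be `rm`.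
  by_contra hneg
  rw [not_le] at hneg
  set G : ℝ × ℝ → ℝ := fun p => S.r p * du S.r p + A / k * S.lapse p with hG
  have hGc : ContinuousAt G (u, v) :=
    ((OneEnded.r_contDiffAt (h.bulk u hu v hv)).continuousAt.mul
      (OneEnded.continuousAt_du_r (h.bulk u hu v hv))).add
      (continuousAt_const.mul (OneEnded.lapse_contDiffAt (h.bulk u hu v hv)).continuousAt)
  have hGu : ContinuousAt (fun x => G (x, v)) u :=
    ContinuousAt.comp (f := fun x : ℝ => ((x, v) : ℝ × ℝ)) hGc
      (Continuous.prodMk_left v).continuousAt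
  have hlt : G (u, v) < G (u, v) / 2 := by have : G (u, v) < 0 := hneg; linarith
  have hev : ∀ᶠ x in 𝓝 u, G (x, v) < G (u, v) / 2 := hGu.eventually_lt_const hlt
  obtain ⟨l, hl, hlu⟩ := exists_Ioc_subset_of_mem_nhds hev ⟨a, hau⟩
  set c := max a ((l + u) / 2)
  have hcu : c < u := max_lt hau (by linarith)
  have hsub : ∀ x ∈ Icc c u, x ∈ Icc a b ∧ G (x, v) < G (u, v) / 2 := fun x hx =>
    ⟨⟨(le_max_left _ _).trans hx.1, hx.2.trans hu.2⟩,
      hlu ⟨by linarith [(le_max_right a ((l + u) / 2)).trans hx.1], hx.2⟩⟩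
  have hdecr : ∀ x ∈ Icc c u, ∀ w ≥ v, S.r (x, w) * du S.r (x, w) ≤ G (u, v) / 2 := by
    intro x hx w hw
    obtain ⟨hxab, hxG⟩ := hsub x hx
    have h1 := sub_le_sub_of_hasDerivAt_le hw (f := fun y => G (x, y)) (g := fun _ => (0 : ℝ))
      (fun t ht => (OneEnded.hasDerivAt_r_mul_du_r (h.bulk x hxab t (hv.trans ht.1))).add
        ((OneEnded.hasDerivAt_lapse_dv (h.bulk x hxab t (hv.trans ht.1))).const_mul (A / k)))
      (fun t _ => hasDerivAt_const t (0 : ℝ)) (fun t ht => by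
        have hb := h.bulk x hxab t (hv.trans ht.1)
        rw [sol.area_eq hb]
        have h2 := (h.areaSource_mem hm hρ hxab (hv.trans ht.1)).2
        have h3 := h.lam_le x hxab t (hv.trans ht.1)
        have h4 := OneEnded.lapse_pos_of_bulk hb
        have h5 : S.lapse (x, t) * areaSource S F m2 (x, t) ≤ S.lapse (x, t) * A := by gcongr
        have h6 : A / k * (S.lapse (x, t) * S.lam (x, t)) ≤ A / k * (S.lapse (x, t) * -k) := by
          gcongr
        have h7 : A / k * (S.lapse (x, t) * -k) = -(S.lapse (x, t) * A) := by field_simp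
        linarith)
    have h2 := OneEnded.lapse_pos_of_bulk (h.bulk x hxab w (hv.trans hw))
    have h3 : 0 ≤ A / k * S.lapse (x, w) := by positivity
    have h4 : G (x, w) = S.r (x, w) * du S.r (x, w) + A / k * S.lapse (x, w) := rfl
    linarith
  have hlim : Tendsto (fun w => S.r (u, w) ^ 2 - S.r (c, w) ^ 2) atTop (𝓝 (rm ^ 2 - rm ^ 2)) :=
    ((h.r_lim u hu).pow 2).sub ((h.r_lim c (hsub c (left_mem_Icc.2 hcu.le)).1).pow 2)
  have hle : rm ^ 2 - rm ^ 2 ≤ G (u, v) * u - G (u, v) * c := by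
    refine le_of_tendsto hlim ((eventually_ge_atTop v).mono fun w hw => ?_)
    refine sub_le_sub_of_hasDerivAt_le hcu.le (f := fun x => S.r (x, w) ^ 2)
      (g := fun x => G (u, v) * x)
      (fun t ht => (OneEnded.hasDerivAt_r_du (h.bulk t (hsub t ht).1 w (hv.trans hw))).pow 2)
      (fun t _ => (hasDerivAt_id t).const_mul (G (u, v))) (fun t ht => ?_)
    have := hdecr t ht w hw
    simp
    linarith
  have hG0 : G (u, v) < 0 := hneg
  nlinarith

/-- Bounds on the outgoing derivative of `r`. -/
lemma r_mul_dv_r_mem (h : StaticRegion S F q₀ rm ρ R k q η a b V) (sol : IsEMKG S F q₀ m2)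
    (hm : 0 ≤ m2) (hρ : 0 < ρ) {u v : ℝ} (hu : u ∈ Icc a b) (hv : V ≤ v) :
    S.r (u, v) * dv S.r (u, v) ∈ Icc (-η) (η + 8 * (q ^ 2 / ρ ^ 2 + m2 * R ^ 2) * R) := by
  set A := q ^ 2 / ρ ^ 2 + m2 * R ^ 2
  have hA0 : 0 ≤ A := by positivity
  have ha : a ∈ Icc a b := left_mem_Icc.2 h.le
  have hsub : ∀ t ∈ Icc a u, t ∈ Icc a b := fun t ht => ⟨ht.1, ht.2.trans hu.2⟩
  have h0 := abs_le.1 (h.cone_dv v hv)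
  constructor
  · have h1 := sub_le_sub_of_hasDerivAt_le hu.1 (f := fun _ => (0 : ℝ))
      (g := fun x => S.r (x, v) * dv S.r (x, v)) (fun t _ => hasDerivAt_const t (0 : ℝ))
      (fun t ht => OneEnded.hasDerivAt_r_mul_dv_r (h.bulk t (hsub t ht) v hv)) (fun t ht => by
        have hb := h.bulk t (hsub t ht) v hv
        rw [sol.area_eq hb]
        exact mul_nonneg (OneEnded.lapse_pos_of_bulk hb).le
          (h.areaSource_mem hm hρ (hsub t ht) hv).1)
    linarith
  -- Since `Ω² ≤ -8 ∂ᵤ r`, the source is dominated by the derivative of a multiple of `-r`, and its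
  -- integral is bounded without reference to `b - a`.
  · have h1 := sub_le_sub_of_hasDerivAt_le hu.1 (f := fun x => S.r (x, v) * dv S.r (x, v))
      (g := fun x => -8 * A * S.r (x, v))
      (fun t ht => OneEnded.hasDerivAt_r_mul_dv_r (h.bulk t (hsub t ht) v hv))
      (fun t ht => (OneEnded.hasDerivAt_r_du (h.bulk t (hsub t ht) v hv)).const_mul (-8 * A))
      (fun t ht => by
        have hb := h.bulk t (hsub t ht) v hv
        rw [sol.area_eq hb]
        have h2 := (h.areaSource_mem hm hρ (hsub t ht) hv).2
        have h3 := h.lapse_le t (hsub t ht) v hv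
        have h4 := OneEnded.lapse_pos_of_bulk hb
        calc _ ≤ S.lapse (t, v) * A := by gcongr
          _ ≤ -8 * du S.r (t, v) * A := by gcongr
          _ = _ := by ring)
    have h2 : 0 ≤ 8 * A * S.r (u, v) := by
      have := OneEnded.r_pos_of_bulk (h.bulk u hu v hv)
      positivity
    have h3 : 8 * A * S.r (a, v) ≤ 8 * A * R := by
      have := h.r_le a ha v hv
      gcongr
    linarith

end StaticRegion

end StaticRegion

lemma hasDerivAt_exp_neg_mul {f : ℝ → ℝ} {f' L C t : ℝ} (hf : HasDerivAt f f' t) :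
    HasDerivAt (fun x => C * Real.exp (-(L * f x))) (C * L * (-f') * Real.exp (-(L * f t))) t := by
  refine (((hf.const_mul L).neg.exp).const_mul C).congr_deriv ?_
  simp only [Pi.neg_apply]
  ring

namespace StaticRegion

variable {S : OneEnded} {F : Matter} {q₀ m2 rm ρ R k q η a b V : ℝ}

lemma abs_du_r_le (h : StaticRegion S F q₀ rm ρ R k q η a b V) (sol : IsEMKG S F q₀ m2)
    (hm : 0 ≤ m2) (hρ : 0 < ρ) (hk : 0 < k) {u v : ℝ} (hu : u ∈ Icc a b) (hv : V ≤ v) :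
    |du S.r (u, v)| ≤ ((q ^ 2 / ρ ^ 2 + m2 * R ^ 2) / k + R) / ρ * S.lapse (u, v) := by
  have h1 := h.neg_r_mul_du_r_le sol hm hρ hk hu hv
  have h2 := h.lapse_le u hu v hv
  have h3 := OneEnded.lapse_pos_of_bulk (h.bulk u hu v hv)
  have h4 := h.r_ge u hu v hv
  have h5 : |S.r (u, v) * du S.r (u, v)| ≤ ((q ^ 2 / ρ ^ 2 + m2 * R ^ 2) / k + R) * S.lapse (u, v) := by
    rw [abs_of_nonpos]
    · exact h1
    · exact mul_nonpos_of_nonneg_of_nonpos (hρ.le.trans h4) (by linarith)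
  refine (abs_le_div_of_abs_mul_le hρ h4 h5).trans_eq ?_
  ring

lemma potential_le (h : StaticRegion S F q₀ rm ρ R k q η a b V)
    (hm : 0 ≤ m2) (hρ : 0 < ρ) {u v : ℝ} (hu : u ∈ Icc a b) (hv : V ≤ v) :
    |q₀| * |F.charge (u, v)| / (4 * S.r (u, v)) + m2 * S.r (u, v) / 4 ≤
      |q₀| * q / (4 * ρ) + m2 * R / 4 := by
  have h1 := h.charge_le u hu v hv
  have h2 := h.r_ge u hu v hv
  have h3 := h.r_le u hu v hv
  have h4 : 0 ≤ q := (abs_nonneg _).trans h1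
  gcongr

/-- The ingoing derivative of the field, integrated from `v = ∞`. -/
lemma norm_psi_le (h : StaticRegion S F q₀ rm ρ R k q η a b V) (sol : IsEMKG S F q₀ m2)
    (hm : 0 ≤ m2) (hρ : 0 < ρ) (hk : 0 < k) {u v m : ℝ} (hu : u ∈ Icc a b) (hv : V ≤ v)
    (hφ : ∀ t ≥ v, ‖F.φ (u, t)‖ ≤ m) (hχ : ∀ t ≥ v, ‖chi S F q₀ (u, t)‖ ≤ m) :
    ‖psi S F q₀ (u, v)‖ ≤ (((q ^ 2 / ρ ^ 2 + m2 * R ^ 2) / k + R) / ρ / ρ +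
      (|q₀| * q / (4 * ρ) + m2 * R / 4)) * m / k * S.lapse (u, v) := by
  set c₁ := ((q ^ 2 / ρ ^ 2 + m2 * R ^ 2) / k + R) / ρ
  set c₂ := |q₀| * q / (4 * ρ) + m2 * R / 4
  have hR : 0 ≤ R := hρ.le.trans ((h.r_ge u hu v hv).trans (h.r_le u hu v hv))
  have hq : 0 ≤ q := (abs_nonneg _).trans (h.charge_le u hu v hv)
  have hc₁ : 0 ≤ c₁ := by positivity
  have hc₂ : 0 ≤ c₂ := by positivity
  have hm0 : 0 ≤ m := (norm_nonneg _).trans (hφ v le_rfl)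
  have key : ∀ w ≥ v, ‖psi S F q₀ (u, v)‖ ≤
      (c₁ / ρ + c₂) * m / k * S.lapse (u, v) + R * ‖F.covU q₀ F.φ (u, w)‖ := by
    intro w hw
    -- A multiple of `-Ω²` is the comparison function: `k Ω² ≤ -∂ᵥ Ω²`, so integrating `Ω²` to the
    -- future costs `Ω² / k`. The contribution of the upper end `w` vanishes as `w → ∞` by
    -- `covU_lim`.
    have hd := abs_norm_sub_norm_le_of_transport hw (ψ := fun y => psi S F q₀ (u, y))
      (g := fun y => -((c₁ / ρ + c₂) * m / k) * S.lapse (u, y))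
      (fun t ht => sol.hasDerivAt_psi (h.bulk u hu t (hv.trans ht.1)))
      (fun t ht => (OneEnded.hasDerivAt_lapse_dv (h.bulk u hu t (hv.trans ht.1))).const_mul _)
      (fun t ht => by
        have hb := h.bulk u hu t (hv.trans ht.1)
        have hl := OneEnded.lapse_pos_of_bulk hb
        refine (IsEMKG.norm_psiSource_le hm hb).trans ?_
        have h1 := h.abs_du_r_le sol hm hρ hk hu (hv.trans ht.1)
        have h2 := norm_covV_le hb hρ (h.r_ge u hu t (hv.trans ht.1)) (hχ t ht.1)
        have h3 := h.potential_le (q₀ := q₀) hm hρ hu (hv.trans ht.1)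
        have h4 := h.lam_le u hu t (hv.trans ht.1)
        calc _ ≤ c₁ * S.lapse (u, t) * (m / ρ) + S.lapse (u, t) * c₂ * m := by
              refine add_le_add (mul_le_mul h1 h2 (norm_nonneg _) (by positivity)) ?_
              refine mul_le_mul ?_ (hφ t ht.1) (norm_nonneg _) (by positivity)
              gcongr
          _ = (c₁ / ρ + c₂) * m / k * (S.lapse (u, t) * k) := by field_simp
          _ ≤ (c₁ / ρ + c₂) * m / k * (S.lapse (u, t) * -S.lam (u, t)) := by
              gcongr
              linarith
          _ = _ := by ring)
    have hb := h.bulk u hu w (hv.trans hw)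
    have h1 := (abs_le.1 hd).1
    have h2 : 0 ≤ (c₁ / ρ + c₂) * m / k * S.lapse (u, w) := by
      have := OneEnded.lapse_pos_of_bulk hb
      positivity
    have h3 : ‖psi S F q₀ (u, w)‖ ≤ R * ‖F.covU q₀ F.φ (u, w)‖ := by
      rw [IsEMKG.norm_psi hb]
      have := h.r_le u hu w (hv.trans hw)
      gcongr
    linarith
  have hlim := ((h.covU_lim u hu).const_mul R).const_add ((c₁ / ρ + c₂) * m / k * S.lapse (u, v))
  rw [mul_zero, add_zero] at hlim
  exact ge_of_tendsto hlim ((eventually_ge_atTop v).mono key)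

/-- If bounds decaying exponentially in `r` imply bounds with half the constant plus the size of
the data, then they hold with twice the size of the data. -/
lemma le_of_halving {ι : Type*} {f g : ι → ℝ} {m₀ d : ℝ} (h₀ : ∀ i, f i ≤ m₀ * g i)
    (hstep : ∀ m, (∀ i, f i ≤ m * g i) → ∀ i, f i ≤ (d + m / 2) * g i) (i : ι) :
    f i ≤ 2 * d * g i := by
  have h : ∀ n : ℕ, ∀ i, f i ≤ (2 * d + (m₀ - 2 * d) * (1 / 2) ^ n) * g i := by
    intro n
    induction n with
    | zero => intro i; simpa using h₀ i
    | succ n ih =>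
      intro i
      refine (hstep _ ih i).trans_eq ?_
      ring
  have hlim : Tendsto (fun n : ℕ => (2 * d + (m₀ - 2 * d) * (1 / 2 : ℝ) ^ n) * g i) atTop
      (𝓝 ((2 * d + (m₀ - 2 * d) * 0) * g i)) :=
    (((tendsto_pow_atTop_nhds_zero_of_lt_one (by norm_num) (by norm_num)).const_mul _).const_add
      _).mul_const _
  have := ge_of_tendsto' hlim fun n => h n i
  simpa using this

/-- The rescaled outgoing derivative of the field is bounded. -/
lemma exists_chi_le (h : StaticRegion S F q₀ rm ρ R k q η a b V) (sol : IsEMKG S F q₀ m2)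
    (hm : 0 ≤ m2) (hρ : 0 < ρ) (hk : 0 < k) {d : ℝ}
    (hχ : ∀ v ≥ V, ‖chi S F q₀ (a, v)‖ ≤ d) :
    ∃ M, ∀ u ∈ Icc a b, ∀ v ≥ V, ‖chi S F q₀ (u, v)‖ ≤ M := by
  obtain ⟨M₀, hM₀⟩ := h.covU_bdd
  obtain ⟨N, hN0, hN⟩ := exists_bound_on_ingoing (f := S.lapse) (c := a) (x := b) (V := V)
    fun u hu => (OneEnded.lapse_contDiffAt (h.bulk u hu V le_rfl)).continuousAt
  have ha : a ∈ Icc a b := left_mem_Icc.2 h.le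
  have hM0 : 0 ≤ M₀ := (norm_nonneg _).trans (hM₀ a ha V le_rfl)
  have hη : 0 ≤ η := (abs_nonneg _).trans (h.cone_dv V le_rfl)
  set T := η + 8 * (q ^ 2 / ρ ^ 2 + m2 * R ^ 2) * R
  set c₂ := |q₀| * q / (4 * ρ) + m2 * R / 4
  have hR : 0 ≤ R := hρ.le.trans ((h.r_ge a ha V le_rfl).trans (h.r_le a ha V le_rfl))
  have hq : 0 ≤ q := (abs_nonneg _).trans (h.charge_le a ha V le_rfl)
  have hT0 : 0 ≤ T := by positivity
  have hc₂0 : 0 ≤ c₂ := by positivity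
  set C := T / ρ * M₀ + N * c₂ * 1
  have hC0 : 0 ≤ C := by positivity
  -- This bound depends on `b - a`, but it serves only as a finite starting constant for
  -- `le_of_halving`.
  refine ⟨d + C * (b - a), fun u hu v hv => ?_⟩
  have hsub : ∀ t ∈ Icc a u, t ∈ Icc a b := fun t ht => ⟨ht.1, ht.2.trans hu.2⟩
  have hd := abs_norm_sub_norm_le_of_transport hu.1 (ψ := fun x => chi S F q₀ (x, v))
    (g := fun x => C * x) (fun t ht => sol.hasDerivAt_chi (h.bulk t (hsub t ht) v hv))
    (fun t _ => (hasDerivAt_id t).const_mul C) (fun t ht => by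
      have hb := h.bulk t (hsub t ht) v hv
      have hl := OneEnded.lapse_pos_of_bulk hb
      rw [mul_one]
      refine (IsEMKG.norm_chiSource_le hm hb).trans ?_
      have h1 := h.r_mul_dv_r_mem sol hm hρ (hsub t ht) hv
      have h2 : |dv S.r (t, v)| ≤ T / ρ := by
        refine abs_le_div_of_abs_mul_le hρ (h.r_ge t (hsub t ht) v hv) (abs_le.2 ⟨?_, h1.2⟩)
        refine le_trans ?_ h1.1
        have : 0 ≤ 8 * (q ^ 2 / ρ ^ 2 + m2 * R ^ 2) * R := by positivity
        simp only [T]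
        linarith
      have h3 := h.potential_le (q₀ := q₀) hm hρ (hsub t ht) hv
      have h4 : S.lapse (t, v) ≤ N := by
        refine le_trans ?_ (hN t (hsub t ht))
        refine (lapse_le_exp_mul (k := k) hv (fun y hy => h.bulk t (hsub t ht) y hy.1)
          (fun y hy => h.lam_le t (hsub t ht) y hy.1)).trans ?_
        refine mul_le_of_le_one_left
          (OneEnded.lapse_pos_of_bulk (h.bulk t (hsub t ht) V le_rfl)).le ?_
        rw [Real.exp_le_one_iff, neg_nonpos]
        exact mul_nonneg hk.le (sub_nonneg.2 hv)
      have hr := OneEnded.r_pos_of_bulk hb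
      refine add_le_add (mul_le_mul h2 (hM₀ t (hsub t ht) v hv) (norm_nonneg _) (by positivity)) ?_
      refine mul_le_mul ?_ (h.phi_le t (hsub t ht) v hv) (norm_nonneg _) (by positivity)
      exact mul_le_mul h4 h3 (by positivity) hN0)
  have h1 := (abs_le.1 hd).2
  have h2 := hχ v hv
  have h3 : C * u ≤ C * b := by have := hu.2; gcongr
  linarith

end StaticRegion

namespace StaticRegion

variable {S : OneEnded} {F : Matter} {q₀ m2 ρ R k q : ℝ}

/-- In a static region the size of the field is controlled by its size on the first cone. -/
theorem exists_field_le (sol : IsEMKG S F q₀ m2) (hm : 0 ≤ m2) (hρ : 0 < ρ) (hk : 0 < k)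
    (hR : 0 ≤ R) (hq : 0 ≤ q) :
    ∃ L > 0, ∃ C ≥ 0, ∀ rm η a b V d : ℝ, η ≤ 1 → Real.exp (L * η) ≤ 2 →
      StaticRegion S F q₀ rm ρ R k q η a b V →
      (∀ v ≥ V, ‖F.φ (a, v)‖ ≤ d ∧ ‖chi S F q₀ (a, v)‖ ≤ d) →
      ∀ u ∈ Icc a b, ∀ v ≥ V, ‖F.φ (u, v)‖ ≤ C * d ∧ ‖chi S F q₀ (u, v)‖ ≤ C * d ∧
        ‖F.covU q₀ F.φ (u, v)‖ ≤ C * d * S.lapse (u, v) := by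
  set A := q ^ 2 / ρ ^ 2 + m2 * R ^ 2
  set c₂ := |q₀| * q / (4 * ρ) + m2 * R / 4
  set c₄ := (A / k + R) / ρ / ρ + c₂
  set c₅ := 2 * c₄ / (k * ρ) with hc₅
  set T := (1 + 8 * A * R) / ρ
  set c₆ := T * c₅ + c₂ with hc₆
  have hA0 : 0 ≤ A := by positivity
  have hc₂0 : 0 ≤ c₂ := by positivity
  have hc₄0 : 0 ≤ c₄ := by positivity
  have hc₅0 : 0 ≤ c₅ := by positivity
  have hT0 : 0 ≤ T := by positivity
  have hc₆0 : 0 ≤ c₆ := by positivity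
  -- Integrating the weight `exp (-L r)` in `u` gains `1 / L`; this choice makes `8 c / L ≤ 1 / 2`
  -- for `c ≤ c₅ + c₆`, the halving required below.
  set L := 16 * (c₅ + c₆) + 1 with hL
  have hL0 : 0 < L := by positivity
  clear_value c₆ c₅ L
  set C := 2 * Real.exp (L * R)
  have hC0 : 0 ≤ C := by positivity
  refine ⟨L, hL0, max C (c₅ * C), hC0.trans (le_max_left _ _), ?_⟩
  intro rm η a b V d hη hLη h hdata u hu v hv
  have ha : a ∈ Icc a b := left_mem_Icc.2 h.le
  have hd0 : 0 ≤ d := (norm_nonneg _).trans (hdata V le_rfl).1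
  have hη0 : 0 ≤ η := (abs_nonneg _).trans (h.cone_dv V le_rfl)
  obtain ⟨M, hM⟩ := h.exists_chi_le sol hm hρ hk fun v hv => (hdata v hv).2
  have hcov : ∀ m, (∀ u ∈ Icc a b, ∀ v ≥ V,
      max ‖F.φ (u, v)‖ ‖chi S F q₀ (u, v)‖ ≤ m * Real.exp (-(L * S.r (u, v)))) →
      ∀ u ∈ Icc a b, ∀ v ≥ V, ‖F.covU q₀ F.φ (u, v)‖ ≤
        c₅ * (m * Real.exp (-(L * S.r (u, v)))) * S.lapse (u, v) := by
    intro m hmb u hu v hv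
    have hm0 : 0 ≤ m := by
      have h1 := (norm_nonneg _).trans ((le_max_left _ _).trans (hmb u hu v hv))
      exact nonneg_of_mul_nonneg_left h1 (Real.exp_pos _)
    -- The bound for `r Dᵤ φ` at `v` involves the field at all later `t`. As `r` loses at most `η`
    -- along the ray, the weight there exceeds the one at `v` by a factor at most `exp (L η) ≤ 2`.
    have hb : ∀ t ≥ v, m * Real.exp (-(L * S.r (u, t))) ≤ 2 * (m * Real.exp (-(L * S.r (u, v)))) := by
      intro t ht
      have h1 := h.r_almost_mono u hu v hv t ht
      calc m * Real.exp (-(L * S.r (u, t))) ≤ m * Real.exp (L * η + -(L * S.r (u, v))) := by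
            gcongr
            nlinarith
        _ = m * (Real.exp (L * η) * Real.exp (-(L * S.r (u, v)))) := by rw [Real.exp_add]
        _ ≤ m * (2 * Real.exp (-(L * S.r (u, v)))) := by gcongr
        _ = _ := by ring
    have h1 : ‖psi S F q₀ (u, v)‖ ≤
        c₄ * (2 * (m * Real.exp (-(L * S.r (u, v))))) / k * S.lapse (u, v) :=
      h.norm_psi_le sol hm hρ hk hu hv
      (fun t ht => ((le_max_left _ _).trans (hmb u hu t (hv.trans ht))).trans (hb t ht))
      (fun t ht => ((le_max_right _ _).trans (hmb u hu t (hv.trans ht))).trans (hb t ht))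
    refine (norm_covU_le (h.bulk u hu v hv) hρ (h.r_ge u hu v hv) h1).trans_eq ?_
    rw [hc₅]
    field_simp
  have hstep : ∀ m, (∀ u ∈ Icc a b, ∀ v ≥ V,
      max ‖F.φ (u, v)‖ ‖chi S F q₀ (u, v)‖ ≤ m * Real.exp (-(L * S.r (u, v)))) →
      ∀ u ∈ Icc a b, ∀ v ≥ V, max ‖F.φ (u, v)‖ ‖chi S F q₀ (u, v)‖ ≤
        (d * Real.exp (L * R) + m / 2) * Real.exp (-(L * S.r (u, v))) := by
    intro m hmb u hu v hv
    have hm0 : 0 ≤ m := by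
      have h1 := (norm_nonneg _).trans ((le_max_left _ _).trans (hmb u hu v hv))
      exact nonneg_of_mul_nonneg_left h1 (Real.exp_pos _)
    have hsub : ∀ t ∈ Icc a u, t ∈ Icc a b := fun t ht => ⟨ht.1, ht.2.trans hu.2⟩
    -- Comparison functions for the integration in `u`: their derivative dominates the weighted
    -- source once `Ω²` is replaced by `-8 ∂ᵤ r`.
    have hg : ∀ c : ℝ, ∀ t ∈ Icc a u, HasDerivAt
        (fun x => 8 * c * m / L * Real.exp (-(L * S.r (x, v))))
        (8 * c * m / L * L * (-du S.r (t, v)) * Real.exp (-(L * S.r (t, v)))) t := fun c t ht =>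
      hasDerivAt_exp_neg_mul (OneEnded.hasDerivAt_r_du (h.bulk t (hsub t ht) v hv))
    have hgle : ∀ c : ℝ, 0 ≤ c → ∀ t ∈ Icc a u,
        c * (m * Real.exp (-(L * S.r (t, v)))) * S.lapse (t, v) ≤
        8 * c * m / L * L * (-du S.r (t, v)) * Real.exp (-(L * S.r (t, v))) := by
      intro c hc t ht
      have h1 := h.lapse_le t (hsub t ht) v hv
      calc _ ≤ c * (m * Real.exp (-(L * S.r (t, v)))) * (-8 * du S.r (t, v)) := by gcongr
        _ = _ := by field_simp
    have hend : ∀ c : ℝ, 0 ≤ c → c ≤ c₅ + c₆ → ∀ X : ℝ, X ≤ d →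
        8 * c * m / L * Real.exp (-(L * S.r (u, v))) - 8 * c * m / L * Real.exp (-(L * S.r (a, v)))
          + X ≤ (d * Real.exp (L * R) + m / 2) * Real.exp (-(L * S.r (u, v))) := by
      intro c hc hcle X hX
      have h1 : 8 * c * m / L ≤ m / 2 := by
        rw [div_le_div_iff₀ hL0 two_pos, hL]
        nlinarith
      have h2 : 0 ≤ 8 * c * m / L * Real.exp (-(L * S.r (a, v))) := by positivity
      have h3 : d ≤ d * Real.exp (L * R) * Real.exp (-(L * S.r (u, v))) := by
        rw [mul_assoc, ← Real.exp_add]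
        refine le_mul_of_one_le_right hd0 (Real.one_le_exp ?_)
        have := h.r_le u hu v hv
        nlinarith
      have h4 := mul_le_mul_of_nonneg_right h1 (Real.exp_pos (-(L * S.r (u, v)))).le
      linarith
    refine max_le ?_ ?_
    · have h1 := abs_norm_sub_norm_le_of_transport hu.1 (ψ := fun x => F.φ (x, v))
        (fun t ht => sol.hasDerivAt_phi_du (h.bulk t (hsub t ht) v hv)) (hg c₅)
        (fun t ht => (hcov m hmb t (hsub t ht) v hv).trans (hgle c₅ hc₅0 t ht))
      have h2 := (abs_le.1 h1).2
      have h3 := hend c₅ hc₅0 (by linarith) _ (hdata v hv).1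
      linarith
    · have h1 := abs_norm_sub_norm_le_of_transport hu.1 (ψ := fun x => chi S F q₀ (x, v))
        (fun t ht => sol.hasDerivAt_chi (h.bulk t (hsub t ht) v hv)) (hg c₆)
        (fun t ht => by
          refine le_trans ?_ (hgle c₆ hc₆0 t ht)
          have hb := h.bulk t (hsub t ht) v hv
          have hl := OneEnded.lapse_pos_of_bulk hb
          refine (IsEMKG.norm_chiSource_le hm hb).trans ?_
          have h1 := h.r_mul_dv_r_mem sol hm hρ (hsub t ht) hv
          have h2 : |dv S.r (t, v)| ≤ T := by
            have h8 : 0 ≤ 8 * A * R := by positivity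
            refine abs_le_div_of_abs_mul_le hρ (h.r_ge t (hsub t ht) v hv) (abs_le.2 ⟨?_, ?_⟩)
            · linarith [h1.1]
            · exact h1.2.trans (add_le_add_left hη _)
          have h3 := h.potential_le (q₀ := q₀) hm hρ (hsub t ht) hv
          have h4 := (le_max_left _ _).trans (hmb t (hsub t ht) v hv)
          have h5 := hcov m hmb t (hsub t ht) v hv
          have hr := OneEnded.r_pos_of_bulk hb
          calc _ ≤ T * (c₅ * (m * Real.exp (-(L * S.r (t, v)))) * S.lapse (t, v)) +
                S.lapse (t, v) * c₂ * (m * Real.exp (-(L * S.r (t, v)))) := by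
                refine add_le_add (mul_le_mul h2 h5 (norm_nonneg _) hT0) ?_
                refine mul_le_mul ?_ h4 (norm_nonneg _) (by positivity)
                exact mul_le_mul_of_nonneg_left h3 hl.le
            _ = _ := by rw [hc₆]; ring)
      have h2 := (abs_le.1 h1).2
      have h3 := hend c₆ hc₆0 (by linarith) _ (hdata v hv).2
      linarith
  have hfin : ∀ u ∈ Icc a b, ∀ v ≥ V, max ‖F.φ (u, v)‖ ‖chi S F q₀ (u, v)‖ ≤
      2 * (d * Real.exp (L * R)) * Real.exp (-(L * S.r (u, v))) := by
    intro u hu v hv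
    have hhalf := le_of_halving (ι := {p : ℝ × ℝ // p.1 ∈ Icc a b ∧ V ≤ p.2})
      (f := fun i => max ‖F.φ i.1‖ ‖chi S F q₀ i.1‖) (g := fun i => Real.exp (-(L * S.r i.1)))
      (m₀ := max 1 M * Real.exp (L * R)) (d := d * Real.exp (L * R))
      (fun ⟨⟨x, y⟩, hx, hy⟩ => by
        have h1 : 1 ≤ Real.exp (L * R) * Real.exp (-(L * S.r (x, y))) := by
          rw [← Real.exp_add]
          refine Real.one_le_exp ?_
          have := h.r_le x hx y hy
          nlinarith
        have h2 := max_le_max (h.phi_le x hx y hy) (hM x hx y hy)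
        rw [mul_assoc]
        exact h2.trans (le_mul_of_one_le_right (zero_le_one.trans (le_max_left _ _)) h1))
      (fun m hmb ⟨⟨x, y⟩, hx, hy⟩ => hstep m (fun u hu v hv => hmb ⟨⟨u, v⟩, hu, hv⟩) x hx y hy)
    exact hhalf ⟨⟨u, v⟩, hu, hv⟩
  have hE : Real.exp (-(L * S.r (u, v))) ≤ 1 := by
    rw [Real.exp_le_one_iff, neg_nonpos]
    exact mul_nonneg hL0.le (OneEnded.r_pos_of_bulk (h.bulk u hu v hv)).le
  have hCd : 2 * (d * Real.exp (L * R)) * Real.exp (-(L * S.r (u, v))) ≤ C * d := by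
    calc _ ≤ 2 * (d * Real.exp (L * R)) * 1 := by gcongr
      _ = C * d := by simp only [C]; ring
  have hCC : C * d ≤ max C (c₅ * C) * d := by gcongr; exact le_max_left _ _
  refine ⟨((le_max_left _ _).trans (hfin u hu v hv)).trans (hCd.trans hCC),
    ((le_max_right _ _).trans (hfin u hu v hv)).trans (hCd.trans hCC), ?_⟩
  have hl := OneEnded.lapse_pos_of_bulk (h.bulk u hu v hv)
  refine (hcov _ hfin u hu v hv).trans ?_
  refine mul_le_mul_of_nonneg_right ?_ hl.le
  calc _ ≤ c₅ * (C * d) := mul_le_mul_of_nonneg_left hCd hc₅0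
    _ = c₅ * C * d := by ring
    _ ≤ _ := mul_le_mul_of_nonneg_right (le_max_right _ _) hd0

end StaticRegion

namespace StaticRegion

variable {S : OneEnded} {F : Matter} {q₀ m2 rm ρ R k q η a b V : ℝ}

lemma r_mul_dv_r_mono (h : StaticRegion S F q₀ rm ρ R k q η a b V) (sol : IsEMKG S F q₀ m2)
    (hm : 0 ≤ m2) (hρ : 0 < ρ) {u v : ℝ} (hu : u ∈ Icc a b) (hv : V ≤ v) :
    S.r (a, v) * dv S.r (a, v) ≤ S.r (u, v) * dv S.r (u, v) := by
  have hsub : ∀ t ∈ Icc a u, t ∈ Icc a b := fun t ht => ⟨ht.1, ht.2.trans hu.2⟩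
  have h1 := sub_le_sub_of_hasDerivAt_le hu.1 (f := fun _ => (0 : ℝ))
    (g := fun x => S.r (x, v) * dv S.r (x, v)) (fun t _ => hasDerivAt_const t (0 : ℝ))
    (fun t ht => OneEnded.hasDerivAt_r_mul_dv_r (h.bulk t (hsub t ht) v hv)) (fun t ht => by
      have hb := h.bulk t (hsub t ht) v hv
      rw [sol.area_eq hb]
      exact mul_nonneg (OneEnded.lapse_pos_of_bulk hb).le
        (h.areaSource_mem hm hρ (hsub t ht) hv).1)
  linarith

/-- In a static region, the field, the charge and the lapse stay close to their values on the
first cone. -/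
theorem exists_improved (sol : IsEMKG S F q₀ m2) (hm : 0 ≤ m2) (hρ : 0 < ρ) (hk : 0 < k)
    (hR : 0 ≤ R) (hq : 0 ≤ q) :
    ∃ L > 0, ∃ C ≥ 0, ∀ rm η a b V d : ℝ, η ≤ 1 → Real.exp (L * η) ≤ 2 →
      StaticRegion S F q₀ rm ρ R k q η a b V →
      (∀ v ≥ V, ‖F.φ (a, v)‖ ≤ d ∧ ‖chi S F q₀ (a, v)‖ ≤ d) →
      ∀ u ∈ Icc a b, ∀ v ≥ V, ‖F.φ (u, v)‖ ≤ C * d ∧ ‖chi S F q₀ (u, v)‖ ≤ C * d ∧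
        |F.charge (u, v) - F.charge (a, v)| ≤ C * d ^ 2 ∧
        S.lam (u, v) ≤ S.lam (a, v) + C * (d ^ 2 + η) := by
  obtain ⟨L, hL, C, hC, hfield⟩ := exists_field_le sol hm hρ hk hR hq
  set C₁ := |q₀| * R ^ 2 * C ^ 2 * 8 * R
  set C₂ := 16 * C ^ 2 / ρ * R
  set C₃ := 2 / ρ ^ 3 * R
  have hC₁ : 0 ≤ C₁ := by positivity
  have hC₂ : 0 ≤ C₂ := by positivity
  have hC₃ : 0 ≤ C₃ := by positivity
  refine ⟨L, hL, C + C₁ + C₂ + C₃, by positivity, ?_⟩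
  intro rm η a b V d hη hLη h hdata u hu v hv
  have hd0 : 0 ≤ d := (norm_nonneg _).trans (hdata V le_rfl).1
  have hη0 : 0 ≤ η := (abs_nonneg _).trans (h.cone_dv V le_rfl)
  have hf := hfield rm η a b V d hη hLη h hdata
  have ha : a ∈ Icc a b := left_mem_Icc.2 h.le
  have hsub : ∀ t ∈ Icc a u, t ∈ Icc a b := fun t ht => ⟨ht.1, ht.2.trans hu.2⟩
  have hg : ∀ c : ℝ, ∀ t ∈ Icc a u, HasDerivAt (fun x => -c * S.r (x, v)) (-c * du S.r (t, v)) t :=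
    fun c t ht => (OneEnded.hasDerivAt_r_du (h.bulk t (hsub t ht) v hv)).const_mul (-c)
  -- Each source below is at most `-c ∂ᵤ r`, so its integral over any `u`-interval is at most `c R`.
  have hend : ∀ c : ℝ, 0 ≤ c → -c * S.r (u, v) - -c * S.r (a, v) ≤ c * R := by
    intro c hc
    have h1 := OneEnded.r_pos_of_bulk (h.bulk u hu v hv)
    have h2 := h.r_le a ha v hv
    nlinarith
  have hCd : C * d ≤ (C + C₁ + C₂ + C₃) * d := by gcongr; linarith
  refine ⟨(hf u hu v hv).1.trans hCd, (hf u hu v hv).2.1.trans hCd, ?_, ?_⟩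
  · have h1 := abs_sub_le_of_abs_hasDerivAt_le hu.1 (f := fun x => F.charge (x, v))
      (fun t ht => sol.hasDerivAt_charge (h.bulk t (hsub t ht) v hv))
      (hg (|q₀| * R ^ 2 * C ^ 2 * 8 * d ^ 2)) (fun t ht => by
        have hb := h.bulk t (hsub t ht) v hv
        refine (sol.abs_du_charge_le hb).trans ?_
        have h2 := h.r_le t (hsub t ht) v hv
        obtain ⟨h3, -, h4⟩ := hf t (hsub t ht) v hv
        have h5 := h.lapse_le t (hsub t ht) v hv
        have hr := OneEnded.r_pos_of_bulk hb
        calc _ ≤ |q₀| * R ^ 2 * (C * d) * (C * d * (-8 * du S.r (t, v))) := by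
              gcongr
              exact h4.trans (by gcongr)
          _ = _ := by ring)
    refine (h1.trans (hend _ (by positivity))).trans ?_
    calc _ = C₁ * d ^ 2 := by simp only [C₁]; ring
      _ ≤ _ := by gcongr; linarith
  · have h1 := sub_le_sub_of_hasDerivAt_le hu.1 (f := fun x => S.lam (x, v))
      (fun t ht => IsEMKG.hasDerivAt_lam (h.bulk t (hsub t ht) v hv))
      (hg (16 * C ^ 2 / ρ * d ^ 2 + 2 / ρ ^ 3 * η)) (fun t ht => by
        have hb := h.bulk t (hsub t ht) v hv
        have hl := OneEnded.lapse_pos_of_bulk hb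
        have hr := OneEnded.r_pos_of_bulk hb
        refine (sol.du_lam_le hb).trans ?_
        obtain ⟨-, h3, h4⟩ := hf t (hsub t ht) v hv
        have h5 := h.lapse_le t (hsub t ht) v hv
        have h6 := norm_covV_le hb hρ (h.r_ge t (hsub t ht) v hv) h3
        have hdu : 0 ≤ -du S.r (t, v) := by linarith
        have e1 : 2 * ‖F.covU q₀ F.φ (t, v)‖ * ‖F.covV q₀ F.φ (t, v)‖ ≤
            16 * C ^ 2 / ρ * d ^ 2 * -du S.r (t, v) := by
          have h4' : ‖F.covU q₀ F.φ (t, v)‖ ≤ C * d * (-8 * du S.r (t, v)) :=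
            h4.trans (by gcongr)
          calc _ ≤ 2 * (C * d * (-8 * du S.r (t, v))) * (C * d / ρ) :=
                mul_le_mul (mul_le_mul_of_nonneg_left h4' zero_le_two) h6 (norm_nonneg _)
                  (mul_nonneg zero_le_two ((norm_nonneg _).trans h4'))
            _ = _ := by ring
        -- Not small, but nonpositive because `r ≤ |Q|`; this is why only an upper bound on `λ` is
        -- propagated.
        have e2 : S.lapse (t, v) / (2 * S.r (t, v) ^ 2) *
            (1 - 2 * F.charge (t, v) ^ 2 / S.r (t, v) ^ 2) ≤ 0 := by
          refine mul_nonpos_of_nonneg_of_nonpos (by positivity) ?_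
          rw [sub_nonpos, one_le_div (by positivity), ← sq_abs (F.charge _)]
          have h7 := h.charge_ge t (hsub t ht) v hv
          have h8 : S.r (t, v) ^ 2 ≤ |F.charge (t, v)| ^ 2 := by gcongr
          nlinarith [sq_nonneg |F.charge (t, v)|]
        -- With `∂ᵤ r < 0` only negative `∂ᵥ r` hurts, and `r ∂ᵥ r ≥ -η` is inherited from the first
        -- cone.
        have e3 : 2 * du S.r (t, v) * dv S.r (t, v) / S.r (t, v) ^ 2 ≤
            2 / ρ ^ 3 * η * -du S.r (t, v) := by
          have h7 := (h.r_mul_dv_r_mem sol hm hρ (hsub t ht) hv).1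
          have h8 := h.r_ge t (hsub t ht) v hv
          calc _ = 2 * -du S.r (t, v) * (-(S.r (t, v) * dv S.r (t, v))) / S.r (t, v) ^ 3 := by
                field_simp
            _ ≤ 2 * -du S.r (t, v) * η / S.r (t, v) ^ 3 := by
                gcongr
                linarith
            _ ≤ 2 * -du S.r (t, v) * η / ρ ^ 3 := by gcongr
            _ = _ := by ring
        linarith)
    have h2 := hend (16 * C ^ 2 / ρ * d ^ 2 + 2 / ρ ^ 3 * η) (by positivity)
    have h3 : (16 * C ^ 2 / ρ * d ^ 2 + 2 / ρ ^ 3 * η) * R = C₂ * d ^ 2 + C₃ * η := by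
      simp only [C₂, C₃]; ring
    have h4 : C₂ * d ^ 2 + C₃ * η ≤ (C + C₁ + C₂ + C₃) * (d ^ 2 + η) := by
      have h5 : C₂ * d ^ 2 ≤ (C + C₁ + C₂ + C₃) * d ^ 2 := by gcongr; linarith
      have h6 : C₃ * η ≤ (C + C₁ + C₂ + C₃) * η := by gcongr; linarith
      linarith
    linarith

end StaticRegion

/-! ### Monotonicity along null rays and uniformity of boundary extensions -/

namespace OneEnded

variable {S : OneEnded}

/-- Along an outgoing ray, `r` first increases and then decreases to its limit. -/
lemma min_r_le (hE : ∀ p ∈ S.Q, S.r p ≠ 0 → dv (fun q => dv S.r q / S.lapse q) p ≤ 0)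
    {u v w l : ℝ} (hvw : v ≤ w) (hb : ∀ y ≥ v, (u, y) ∈ S.bulk)
    (hl : Tendsto (fun y => S.r (u, y)) atTop (𝓝 l)) : min (S.r (u, v)) l ≤ S.r (u, w) := by
  have hq : ∀ y z, v ≤ y → y ≤ z →
      dv S.r (u, z) / S.lapse (u, z) ≤ dv S.r (u, y) / S.lapse (u, y) := fun y z hy hyz =>
    dv_quotient_antitone hE hyz fun t ht => hb t (hy.trans ht.1)
  rcases le_total 0 (dv S.r (u, w)) with h0 | h0
  · refine (min_le_left _ _).trans ?_
    have h1 := sub_le_sub_of_hasDerivAt_le hvw (f := fun _ => (0 : ℝ))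
      (g := fun y => S.r (u, y)) (fun t _ => hasDerivAt_const t (0 : ℝ))
      (fun t ht => hasDerivAt_r_dv (hb t ht.1)) (fun t ht => by
        have h2 := hq t w ht.1 ht.2
        have h3 : 0 ≤ dv S.r (u, w) / S.lapse (u, w) :=
          div_nonneg h0 (lapse_pos_of_bulk (hb w hvw)).le
        have h4 := h3.trans h2
        rw [le_div_iff₀ (lapse_pos_of_bulk (hb t ht.1)), zero_mul] at h4
        exact h4)
    linarith
  · refine (min_le_right _ _).trans (le_of_tendsto hl ((eventually_ge_atTop w).mono fun z hz => ?_))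
    have h1 := sub_le_sub_of_hasDerivAt_le hz (f := fun y => S.r (u, y)) (g := fun _ => (0 : ℝ))
      (fun t ht => hasDerivAt_r_dv (hb t (hvw.trans ht.1)))
      (fun t _ => hasDerivAt_const t (0 : ℝ)) (fun t ht => by
        have h2 := hq w t hvw ht.1
        have h3 : dv S.r (u, w) / S.lapse (u, w) ≤ 0 :=
          div_nonpos_of_nonpos_of_nonneg h0 (lapse_pos_of_bulk (hb w hvw)).le
        have h4 := h2.trans h3
        rw [div_le_iff₀ (lapse_pos_of_bulk (hb t (hvw.trans ht.1))), zero_mul] at h4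
        exact h4)
    linarith

/-- The quantity `∂ᵤ r / Ω²` decreases along ingoing rays. -/
lemma du_quotient_antitone (hE : ∀ p ∈ S.Q, S.r p ≠ 0 → du (fun q => du S.r q / S.lapse q) p ≤ 0)
    {a u v : ℝ} (hau : a ≤ u) (hb : ∀ t ∈ Icc a u, (t, v) ∈ S.bulk) :
    du S.r (u, v) / S.lapse (u, v) ≤ du S.r (a, v) / S.lapse (a, v) := by
  have := sub_le_sub_of_hasDerivAt_le hau
    (f := fun x => du S.r (x, v) / S.lapse (x, v)) (fun t ht => hasDerivAt_du_quotient
      (mem_of_bulk (hb t ht)))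
    (fun t _ => hasDerivAt_const t (0 : ℝ))
    (fun t ht => hE _ (mem_of_bulk (hb t ht)) (r_pos_of_bulk (hb t ht)).ne')
  linarith

lemma r_antitone_u (hE : ∀ p ∈ S.Q, S.r p ≠ 0 → du (fun q => du S.r q / S.lapse q) p ≤ 0)
    {a u v : ℝ} (hau : a ≤ u) (hb : ∀ t ∈ Icc a u, (t, v) ∈ S.bulk) :
    S.r (u, v) ≤ S.r (a, v) := by
  have := sub_le_sub_of_hasDerivAt_le hau
    (f := fun x => S.r (x, v)) (fun t ht => hasDerivAt_r_du (hb t ht))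
    (fun t _ => hasDerivAt_const t (0 : ℝ))
    (fun t ht => (du_r_neg hE (mem_of_bulk (hb t ht))).le)
  linarith

end OneEnded

namespace OneEnded

variable {S : OneEnded}

lemma ExtendsByZero.tendsto_ray {f : ℝ × ℝ → ℝ} {u : ℝ} (h : S.ExtendsByZero f u)
    (hu : S.Reaches u) : Tendsto (fun v => f (u, v)) atTop (𝓝 0) :=
  Tendsto.comp h (tendsto_ray_approach hu)

lemma ExtendsByZero.exists_abs_le {f : ℝ × ℝ → ℝ} {u ε : ℝ} (h : S.ExtendsByZero f u)
    (hε : 0 < ε) : ∃ δ > 0, ∃ V, ∀ w v, (w, v) ∈ S.Q → |w - u| < δ → V ≤ v → |f (w, v)| ≤ ε := by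
  obtain ⟨δ, hδ, V, hV⟩ := eventually_approach_iff.1 (Metric.tendsto_nhds.1 h ε hε)
  refine ⟨δ, hδ, V, fun w v hw h1 h2 => ?_⟩
  have := hV (w, v) hw h1 h2
  rw [Real.dist_eq, sub_zero] at this
  exact this.le

/-- Continuous extension by zero to a compact piece of the boundary is uniform. -/
lemma exists_abs_le_of_extendsByZero {f : ℝ × ℝ → ℝ} {a b : ℝ}
    (h : ∀ u ∈ Icc a b, S.ExtendsByZero f u) :
    ∃ V, ∀ u ∈ Icc a b, ∀ v ≥ V, (u, v) ∈ S.Q → |f (u, v)| ≤ 1 := by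
  refine isCompact_Icc.induction_on (p := fun s => ∃ V, ∀ u ∈ s, ∀ v ≥ V, (u, v) ∈ S.Q →
    |f (u, v)| ≤ 1) ⟨0, by simp⟩ ?_ ?_ ?_
  · rintro s t hst ⟨V, hV⟩
    exact ⟨V, fun u hu => hV u (hst hu)⟩
  · rintro s t ⟨V, hV⟩ ⟨W, hW⟩
    refine ⟨max V W, fun u hu v hv => ?_⟩
    rcases hu with hu | hu
    · exact hV u hu v ((le_max_left _ _).trans hv)
    · exact hW u hu v ((le_max_right _ _).trans hv)
  · intro u hu
    obtain ⟨δ, hδ, V, hV⟩ := (h u hu).exists_abs_le one_pos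
    refine ⟨Metric.ball u δ, mem_nhdsWithin_of_mem_nhds (Metric.ball_mem_nhds u hδ), V, ?_⟩
    intro w hw v hv hq
    exact hV w v hq (by simpa [Real.dist_eq] using hw) hv

lemma exists_bound_rectangle {f : ℝ × ℝ → ℝ} {a b V W : ℝ}
    (hf : ∀ u ∈ Icc a b, ∀ v ∈ Icc V W, ContinuousAt f (u, v)) :
    ∃ N, ∀ u ∈ Icc a b, ∀ v ∈ Icc V W, f (u, v) ≤ N := by
  obtain ⟨N, hN⟩ := (isCompact_Icc.prod isCompact_Icc : IsCompact (Icc a b ×ˢ Icc V W)).bddAbove_image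
    (f := f) fun p hp => (hf p.1 hp.1 p.2 hp.2).continuousWithinAt
  exact ⟨N, fun u hu v hv => hN ⟨(u, v), ⟨hu, hv⟩, rfl⟩⟩

end OneEnded

/-! ### Bootstrap along the static Cauchy horizon, uniform up to its end-point -/

lemma tendsto_const_div_sqrt (D : ℝ) : Tendsto (fun v : ℝ => D / √v) atTop (𝓝 0) :=
  Real.tendsto_sqrt_atTop.const_div_atTop D

lemma div_sqrt_le_div_sqrt {D v w : ℝ} (hD : 0 ≤ D) (hv : 0 < v) (hvw : v ≤ w) :
    D / √w ≤ D / √v := by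
  have : 0 < √v := Real.sqrt_pos.2 hv
  gcongr

/-- Uniform estimates on a static Cauchy horizon, up to its end-point. -/
theorem exists_static_bounds {S : OneEnded} {F : Matter} {q₀ m2 : ℝ} (sol : IsEMKG S F q₀ m2)
    (hm : 0 ≤ m2) {a c rm e k V₀ D ρ : ℝ} (hρ : 0 < ρ) (hk : 0 < k) (hrm : 0 < rm)
    (hrme : rm < |e|) (hV₀ : 1 ≤ V₀) (hD : 0 ≤ D)
    (hb : ∀ u ∈ Ico a c, ∀ v ≥ V₀, (u, v) ∈ S.bulk)
    (hρr : ∀ u ∈ Ico a c, ∀ v ≥ V₀, ρ ≤ S.r (u, v))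
    (ext_r : ∀ u ∈ Ico a c, S.ExtendsByZero (fun p => S.r p - rm) u)
    (ext_φ : ∀ u ∈ Ico a c, S.ExtendsByZero (fun p => ‖F.φ p‖) u)
    (ext_Du : ∀ u ∈ Ico a c, S.ExtendsByZero (fun p => ‖F.covU q₀ F.φ p‖) u)
    (ext_Q : ∀ u ∈ Ico a c, S.ExtendsByZero (fun p => F.charge p - e) u)
    (ext_lam : ∀ u ∈ Ico a c, S.ExtendsByZero (fun p => S.lam p + 2 * k) u)
    (cone_φ : ∀ v ≥ V₀, ‖F.φ (a, v)‖ ≤ D / √v)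
    (cone_χ : ∀ v ≥ V₀, ‖chi S F q₀ (a, v)‖ ≤ D / √v)
    (cone_dv : ∀ v ≥ V₀, |S.r (a, v) * dv S.r (a, v)| ≤ D / v)
    (cone_lapse : ∀ v ≥ V₀, S.lapse (a, v) ≤ -8 * du S.r (a, v))
    (cone_du : ∀ v ≥ V₀, -du S.r (a, v) ≤ S.lapse (a, v)) :
    ∃ V ≥ V₀, ∃ C ≥ 0, ∀ u ∈ Ico a c, ∀ v ≥ V, ‖F.φ (u, v)‖ ≤ C / √v ∧
      ‖chi S F q₀ (u, v)‖ ≤ C / √v ∧ |F.charge (u, v)| ≤ C ∧ S.lam (u, v) ≤ -k ∧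
      -(D / v) ≤ S.r (u, v) * dv S.r (u, v) ∧ S.r (u, v) ≤ rm + 1 := by
  rcases le_or_gt c a with hca | hac
  · exact ⟨V₀, le_rfl, 0, le_rfl, fun u hu => absurd (hu.1.trans_lt hu.2) (not_lt.2 hca)⟩
  obtain ⟨L, hL, C, hC, hmain⟩ := StaticRegion.exists_improved sol hm hρ hk
    (by positivity : 0 ≤ rm + 1) (by positivity : 0 ≤ |e| + 1)
  have haa : a ∈ Ico a c := ⟨le_rfl, hac⟩
  have hreach : ∀ u ∈ Ico a c, S.Reaches u := fun u hu =>
    eventually_atTop.2 ⟨V₀, fun v hv => OneEnded.mem_of_bulk (hb u hu v hv)⟩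
  -- With `|Q - e| ≤ δ` and `r ≤ rm + η`, `η ≤ δ`, this guarantees `r ≤ |Q|`.
  set δ := min 1 ((|e| - rm) / 2) with hδ
  have hδ0 : 0 < δ := lt_min one_pos (by linarith)
  have hδ1 : δ ≤ 1 := min_le_left _ _
  have hδ2 : δ ≤ (|e| - rm) / 2 := min_le_right _ _
  obtain ⟨η, hη0, hη1, hηδ, hηC, hηL⟩ : ∃ η > 0, η ≤ 1 ∧ η ≤ δ ∧ C * η ≤ k / 16 ∧
      Real.exp (L * η) ≤ 2 := by
    have hev : ∀ᶠ η : ℝ in 𝓝[>] 0, η ≤ 1 ∧ η ≤ δ ∧ C * η ≤ k / 16 ∧ Real.exp (L * η) ≤ 2 := by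
      refine Filter.Eventually.filter_mono nhdsWithin_le_nhds ?_
      have h1 : Continuous fun η : ℝ => C * η := by fun_prop
      have h2 : Continuous fun η : ℝ => Real.exp (L * η) := by fun_prop
      filter_upwards [eventually_le_nhds one_pos, eventually_le_nhds hδ0,
        (h1.tendsto 0).eventually_le_const (show C * 0 < k / 16 by simpa using hk),
        (h2.tendsto 0).eventually_le_const (show Real.exp (L * 0) < 2 by norm_num)]
        with η h1 h2 h3 h4 using ⟨h1, h2, h3, h4⟩
    obtain ⟨η, h1, h2⟩ := (hev.and self_mem_nhdsWithin).exists
    exact ⟨η, h2, h1⟩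
  have hdt := tendsto_const_div_sqrt D
  have hlarge : ∀ᶠ v : ℝ in atTop, V₀ ≤ v ∧ D / √v ≤ 1 / 2 ∧ C * (D / √v) ≤ 1 / 2 ∧
      C * (D / √v) ^ 2 ≤ δ / 4 ∧ C * (D / √v) ^ 2 ≤ k / 16 ∧ D / v ≤ η ∧ |S.r (a, v) - rm| ≤ η ∧
      |F.charge (a, v) - e| ≤ δ / 2 ∧ |S.lam (a, v) + 2 * k| ≤ k / 4 := by
    have h0 := hdt.const_mul C
    have h1 := (hdt.pow 2).const_mul C
    rw [mul_zero] at h0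
    rw [zero_pow two_ne_zero, mul_zero] at h1
    have h2 : Tendsto (fun v : ℝ => D / v) atTop (𝓝 0) := tendsto_id.const_div_atTop D
    have h3 := ((ext_r a haa).tendsto_ray (hreach a haa)).abs
    have h4 := ((ext_Q a haa).tendsto_ray (hreach a haa)).abs
    have h5 := ((ext_lam a haa).tendsto_ray (hreach a haa)).abs
    rw [abs_zero] at h3 h4 h5
    filter_upwards [eventually_ge_atTop V₀, hdt.eventually_le_const (by norm_num : (0 : ℝ) < 1 / 2),
      h0.eventually_le_const (by norm_num : (0 : ℝ) < 1 / 2),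
      h1.eventually_le_const (by positivity : 0 < δ / 4),
      h1.eventually_le_const (by positivity : 0 < k / 16), h2.eventually_le_const hη0,
      h3.eventually_le_const hη0, h4.eventually_le_const (by positivity : 0 < δ / 2),
      h5.eventually_le_const (by positivity : 0 < k / 4)] with v i1 i2 i3 i4 i5 i6 i7 i8 i9
    exact ⟨i1, i2, i3, i4, i5, i6, i7, i8, i9⟩
  obtain ⟨V, hV⟩ := eventually_atTop.1 hlarge
  have hVV₀ : V₀ ≤ V := (hV V le_rfl).1
  have hV0 : 0 < V := by linarith
  -- The bootstrap assumptions; the remaining properties of a `StaticRegion` follow from them,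
  -- Raychaudhuri and the data on the cone and at `v = ∞`.
  set P : ℝ → Prop := fun u => ∀ v ≥ V, ‖F.φ (u, v)‖ ≤ 1 ∧ |F.charge (u, v) - e| ≤ δ ∧
    S.lam (u, v) ≤ -k with hP
  have hlim : ∀ u ∈ Ico a c, Tendsto (fun v => S.r (u, v)) atTop (𝓝 rm) := fun u hu => by
    simpa using ((ext_r u hu).tendsto_ray (hreach u hu)).add_const rm
  have hanti : ∀ u ∈ Ico a c, ∀ v ≥ V, S.r (u, v) ≤ rm + η := by
    intro u hu v hv
    have h1 := OneEnded.r_antitone_u (fun p hp hr => sol.du_quotient_nonpos hp hr) hu.1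
      (v := v) fun t ht => hb t ⟨ht.1, ht.2.trans_lt hu.2⟩ v (hVV₀.trans hv)
    have h2 := (abs_le.1 (hV v hv).2.2.2.2.2.2.1).2
    linarith
  have hregion : ∀ b ∈ Ico a c, (∀ u ∈ Icc a b, P u) →
      StaticRegion S F q₀ rm ρ (rm + 1) k (|e| + 1) η a b V := by
    intro b hbc hPb
    have hsub : ∀ u ∈ Icc a b, u ∈ Ico a c := fun u hu => ⟨hu.1, hu.2.trans_lt hbc.2⟩
    have hbk : ∀ u ∈ Icc a b, ∀ v ≥ V, (u, v) ∈ S.bulk := fun u hu v hv =>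
      hb u (hsub u hu) v (hVV₀.trans hv)
    refine ⟨hbc.1, hbk, fun u hu v hv => hρr u (hsub u hu) v (hVV₀.trans hv),
      fun u hu v hv => (hanti u (hsub u hu) v hv).trans (by linarith), ?_,
      fun u hu => hlim u (hsub u hu), ?_,
      fun u hu => (ext_Du u (hsub u hu)).tendsto_ray (hreach u (hsub u hu)), ?_,
      fun u hu v hv => (hPb u hu v hv).1, ?_, ?_, fun u hu v hv => (hPb u hu v hv).2.2, ?_,
      fun v hv => cone_du v (hVV₀.trans hv)⟩
    -- `∂ᵤ r / Ω²` decreases in `u`, so the comparison of lapse and `∂ᵤ r` on the first cone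
    -- propagates.
    · intro u hu v hv
      have h1 := OneEnded.du_quotient_antitone (fun p hp hr => sol.du_quotient_nonpos hp hr) hu.1
        (v := v) fun t ht => hbk t ⟨ht.1, ht.2.trans hu.2⟩ v hv
      have h2 := cone_lapse v (hVV₀.trans hv)
      have h3 := OneEnded.lapse_pos_of_bulk (hbk u hu v hv)
      have h4 := OneEnded.lapse_pos_of_bulk (hbk a (left_mem_Icc.2 hbc.1) v hv)
      have h5 : du S.r (a, v) / S.lapse (a, v) ≤ -(1 / 8) := by
        rw [div_le_iff₀ h4]; linarith
      have h6 := h1.trans h5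
      rw [div_le_iff₀ h3] at h6
      linarith
    -- Along a ray `r` cannot go below the smaller of its present value and its limit `rm`, and `r ≤
    -- rm + η`.
    · intro u hu v hv w hw
      have h1 := OneEnded.min_r_le (fun p hp hr => sol.dv_quotient_nonpos hp hr) hw
        (fun y hy => hbk u hu y (hv.trans hy)) (hlim u (hsub u hu))
      have h2 := hanti u (hsub u hu) v hv
      refine le_trans (le_min ?_ ?_) h1 <;> linarith
    -- The extension by zero is uniform over the compact interval `[a, b]` for `v ≥ W`; the rest is
    -- a compact rectangle. The bound may depend on `b`.
    · obtain ⟨W, hW⟩ := OneEnded.exists_abs_le_of_extendsByZero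
        fun u hu => ext_Du u (hsub u hu)
      obtain ⟨N, hN⟩ := OneEnded.exists_bound_rectangle (f := fun p => ‖F.covU q₀ F.φ p‖) (a := a)
        (b := b) (V := V) (W := W) fun u hu v hv =>
          (sol.contDiffAt_covU (hbk u hu v hv.1)).continuousAt.norm
      refine ⟨max N 1, fun u hu v hv => ?_⟩
      rcases le_total v W with hvW | hvW
      · exact (hN u hu v ⟨hv, hvW⟩).trans (le_max_left _ _)
      · have := hW u hu v hvW (OneEnded.mem_of_bulk (hbk u hu v hv))
        rw [abs_norm] at this
        exact this.trans (le_max_right _ _)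
    · intro u hu v hv
      have h1 := (hPb u hu v hv).2.1
      have h2 := abs_sub_abs_le_abs_sub (F.charge (u, v)) e
      linarith
    · intro u hu v hv
      have h1 := (hPb u hu v hv).2.1
      have h2 := abs_sub_abs_le_abs_sub e (F.charge (u, v))
      rw [abs_sub_comm] at h2
      have h3 := hanti u (hsub u hu) v hv
      linarith
    · intro v hv
      exact (cone_dv v (hVV₀.trans hv)).trans (hV v hv).2.2.2.2.2.1
  -- The region is restarted at height `v`, where the data have size `d = D / √v`; this turns the
  -- estimates by the data into decay in `v`.
  have himp : ∀ b ∈ Ico a c, (∀ u ∈ Icc a b, P u) → ∀ v ≥ V,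
      ‖F.φ (b, v)‖ ≤ C * (D / √v) ∧ ‖chi S F q₀ (b, v)‖ ≤ C * (D / √v) ∧
      |F.charge (b, v) - F.charge (a, v)| ≤ C * (D / √v) ^ 2 ∧
      S.lam (b, v) ≤ S.lam (a, v) + C * ((D / √v) ^ 2 + η) := by
    intro b hbc hPb v hv
    have hv0 : 0 < v := hV0.trans_le hv
    exact hmain rm η a b v (D / √v) hη1 hηL ((hregion b hbc hPb).mono hv)
      (fun w hw => ⟨(cone_φ w (hVV₀.trans (hv.trans hw))).trans (div_sqrt_le_div_sqrt hD hv0 hw),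
        (cone_χ w (hVV₀.trans (hv.trans hw))).trans (div_sqrt_le_div_sqrt hD hv0 hw)⟩)
      b (right_mem_Icc.2 hbc.1) v le_rfl
  have hstrict : ∀ b ∈ Ico a c, (∀ u ∈ Icc a b, P u) → ∀ v ≥ V,
      ‖F.φ (b, v)‖ < 1 ∧ |F.charge (b, v) - e| < δ ∧ S.lam (b, v) < -k := by
    intro b hbc hPb v hv
    obtain ⟨i1, -, i3, i4⟩ := himp b hbc hPb v hv
    obtain ⟨-, -, j3, j4, j5, -, -, j8, j9⟩ := hV v hv
    refine ⟨by linarith, ?_, ?_⟩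
    · have := abs_sub_le (F.charge (b, v)) (F.charge (a, v)) e
      linarith
    · have := (abs_le.1 j9).2
      linarith
  have hPall : ∀ b ∈ Ico a c, ∀ u ∈ Icc a b, P u := by
    intro b hbc
    refine continuity_induction ?_ ?_ ?_
    · intro v hv
      obtain ⟨-, j2, -, -, -, -, -, j8, j9⟩ := hV v hv
      have h1 := cone_φ v (hVV₀.trans hv)
      have h2 := (abs_le.1 j9).2
      exact ⟨by linarith, by linarith, by linarith⟩
    · intro u hu h v hv
      have hp := hb u ⟨hu.1.le, hu.2.trans_lt hbc.2⟩ v (hVV₀.trans hv)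
      refine ⟨le_of_forall_Ico_le (f := fun p => ‖F.φ p‖)
        (sol.smooth_φ _ (OneEnded.mem_of_bulk hp)).continuousAt.norm hu.1
        fun w hw => (h w hw v hv).1, le_of_forall_Ico_le (f := fun p => |F.charge p - e|)
        ((sol.smooth_charge _ (OneEnded.mem_of_bulk hp)).continuousAt.sub continuousAt_const).abs
        hu.1 fun w hw => (h w hw v hv).2.1, le_of_forall_Ico_le
        (OneEnded.lam_contDiffAt hp).continuousAt hu.1 fun w hw => (h w hw v hv).2.2⟩
    · intro u hu h
      have huc : u ∈ Ico a c := ⟨hu.1, hu.2.trans hbc.2⟩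
      have hst := hstrict u huc h
      -- Openness must be uniform up to `v = ∞`. For `v ≥ W` the continuous extension at `u` gives
      -- the bounds on all nearby cones; on `[V, W]` the strict bounds and compactness do.
      obtain ⟨ε₁, hε₁, W₁, hW₁⟩ := (ext_φ u huc).exists_abs_le one_pos
      obtain ⟨ε₂, hε₂, W₂, hW₂⟩ := (ext_Q u huc).exists_abs_le hδ0
      obtain ⟨ε₃, hε₃, W₃, hW₃⟩ := (ext_lam u huc).exists_abs_le hk
      set W := max W₁ (max W₂ W₃)
      have hcpt : ∀ᶠ w in 𝓝 u, ∀ v ∈ Icc V W, ‖F.φ (w, v)‖ ≤ 1 ∧ |F.charge (w, v) - e| ≤ δ ∧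
          S.lam (w, v) ≤ -k := by
        refine isCompact_Icc.eventually_forall_of_forall_eventually fun v hv => ?_
        have hp := hb u huc v (hVV₀.trans hv.1)
        obtain ⟨h1, h2, h3⟩ := hst v hv.1
        filter_upwards [((sol.smooth_φ _ (OneEnded.mem_of_bulk hp)).continuousAt.norm).eventually_lt_const h1,
          (((sol.smooth_charge _ (OneEnded.mem_of_bulk hp)).continuousAt.sub
            continuousAt_const).abs).eventually_lt_const h2,
          ((OneEnded.lam_contDiffAt hp).continuousAt).eventually_lt_const h3] with q i1 i2 i3
        exact ⟨i1.le, i2.le, i3.le⟩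
      have hnear : ∀ ε > 0, ∀ᶠ w in 𝓝[>] u, |w - u| < ε := fun ε hε =>
        Filter.Eventually.filter_mono nhdsWithin_le_nhds (Metric.eventually_nhds_iff_ball.2
          ⟨ε, hε, fun w hw => by simpa [Real.dist_eq] using hw⟩)
      filter_upwards [hcpt.filter_mono nhdsWithin_le_nhds, hnear _ hε₁, hnear _ hε₂, hnear _ hε₃,
        Ioo_mem_nhdsGT huc.2] with w j1 j2 j3 j4 j5 v hv
      rcases le_total v W with hvW | hvW
      · exact j1 v ⟨hv, hvW⟩
      · have hq := OneEnded.mem_of_bulk (hb w ⟨hu.1.trans j5.1.le, j5.2⟩ v (hVV₀.trans hv))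
        have h1 := hW₁ w v hq j2 ((le_max_left _ _).trans hvW)
        have h2 := hW₂ w v hq j3 (((le_max_left _ _).trans (le_max_right _ _)).trans hvW)
        have h3 := hW₃ w v hq j4 (((le_max_right _ _).trans (le_max_right _ _)).trans hvW)
        rw [abs_norm] at h1
        exact ⟨h1, h2, by linarith [(abs_le.1 h3).2]⟩
  refine ⟨V, hVV₀, C * D + (|e| + 1), by positivity, fun u hu v hv => ?_⟩
  have hPu := hPall u hu
  have hreg := hregion u hu hPu
  have huu : u ∈ Icc a u := right_mem_Icc.2 hu.1
  obtain ⟨i1, i2, -, -⟩ := himp u hu hPu v hv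
  have hle : C * (D / √v) ≤ (C * D + (|e| + 1)) / √v := by
    rw [← mul_div_assoc]
    gcongr
    linarith [abs_nonneg e]
  refine ⟨i1.trans hle, i2.trans hle, ?_, hreg.lam_le u huu v hv, ?_, hreg.r_le u huu v hv⟩
  · have : 0 ≤ C * D := by positivity
    linarith [hreg.charge_le u huu v hv]
  · have h1 := hreg.r_mul_dv_r_mono sol hm hρ huu hv
    have h2 := (abs_le.1 (cone_dv v (hVV₀.trans hv))).1
    linarith

/-! ### Reissner-Nordström parameters -/

section Parameters

variable {M e : ℝ}

lemma sqrt_sub_sq_pos (he : |e| < M) : 0 < √(M ^ 2 - e ^ 2) := by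
  rw [Real.sqrt_pos, sub_pos]
  exact sq_lt_sq' (by linarith [neg_abs_le e]) (lt_of_abs_lt he)

/-- The product of the two horizon radii, the roots of `x² - 2 M x + e²`. -/
lemma rMinus_mul (he : |e| < M) : rMinus M e * (M + √(M ^ 2 - e ^ 2)) = e ^ 2 := by
  have h : √(M ^ 2 - e ^ 2) ^ 2 = M ^ 2 - e ^ 2 :=
    Real.sq_sqrt (Real.sqrt_pos.1 (sqrt_sub_sq_pos he)).le
  rw [rMinus]
  linear_combination -h

lemma rMinus_pos (he0 : 0 < |e|) (he : |e| < M) : 0 < rMinus M e := by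
  have h1 := rMinus_mul he
  have h2 := sqrt_sub_sq_pos he
  have h3 : 0 < e ^ 2 := by rw [← sq_abs]; positivity
  rw [← h1] at h3
  exact pos_of_mul_pos_left h3 (by linarith)

/-- The other root exceeds `M > |e|` while the product is `e²`. This strict gap is what lets the
charge dominate the radius near the horizon. -/
lemma rMinus_lt (he0 : 0 < |e|) (he : |e| < M) : rMinus M e < |e| := by
  have h1 := rMinus_mul he
  have h2 := sqrt_sub_sq_pos he
  have h3 : rMinus M e * (M + √(M ^ 2 - e ^ 2)) = |e| ^ 2 := h1.trans (sq_abs e).symm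
  by_contra h
  rw [not_lt] at h
  nlinarith [mul_nonneg (sub_nonneg.2 h) (by linarith : 0 ≤ M + √(M ^ 2 - e ^ 2)),
    mul_pos he0 (by linarith : 0 < M + √(M ^ 2 - e ^ 2) - |e|)]

/-- Since `e² / r₋ = r₊`, the bracket is `M - r₊ < 0`. The sign means exponential decay of the
lapse. -/
lemma kMinus_neg (he0 : 0 < |e|) (he : |e| < M) : kMinus M e < 0 := by
  have h1 := rMinus_mul he
  have h2 := sqrt_sub_sq_pos he
  have h3 := rMinus_pos he0 he
  have h4 : e ^ 2 / rMinus M e = M + √(M ^ 2 - e ^ 2) := by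
    rw [div_eq_iff h3.ne', mul_comm]
    exact h1.symm
  rw [kMinus, h4]
  exact mul_neg_of_pos_of_neg (by positivity) (by linarith)

end Parameters

/-! ### Conclusion: the singular segment is empty -/

lemma rpow_le_inv_sqrt {v s : ℝ} (hv : 1 ≤ v) (hs : 3 / 4 < s) : v ^ (-s) ≤ 1 / √v := by
  rw [Real.sqrt_eq_rpow, one_div, ← Real.rpow_neg (by linarith)]
  exact Real.rpow_le_rpow_of_exponent_le hv (by linarith)

lemma rpow_le_inv {v s : ℝ} (hv : 1 ≤ v) (hs : 3 / 4 < s) : v ^ (-(2 * s)) ≤ 1 / v := by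
  rw [one_div, ← Real.rpow_neg_one]
  exact Real.rpow_le_rpow_of_exponent_le hv (by linarith)

/-- The part of the decay on the initial cone of a static Cauchy horizon which is used. -/
lemma IsStaticType.exists_cone {S : OneEnded} {F : Matter} {q₀ M e s ui uc : ℝ}
    (h : IsStaticType S F q₀ M e s ui uc) (hs : 3 / 4 < s) :
    ∃ a ∈ Ioo ui uc, ∃ D ≥ 0, ∀ᶠ v in atTop, ‖F.φ (a, v)‖ ≤ D / √v ∧
      ‖F.covV q₀ F.φ (a, v)‖ ≤ D / √v ∧ |dv S.r (a, v)| ≤ D / v ∧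
      S.lapse (a, v) ≤ -8 * du S.r (a, v) ∧ -du S.r (a, v) ≤ S.lapse (a, v) := by
  obtain ⟨a, ha, C, hC, v₁, -, -, hv₁⟩ := h.cone
  have hlim : Tendsto (fun v : ℝ => C * v ^ (1 - 2 * s)) atTop (𝓝 0) := by
    have := (tendsto_rpow_neg_atTop (by linarith : 0 < 2 * s - 1)).const_mul C
    rw [mul_zero] at this
    refine this.congr fun v => ?_
    ring_nf
  refine ⟨a, ha, C, hC.le, ?_⟩
  filter_upwards [eventually_ge_atTop v₁, eventually_ge_atTop 1,
    hlim.eventually_le_const (by norm_num : (0 : ℝ) < 1 / 2)] with v hv hv1 hsmall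
  obtain ⟨hQ, -, -, h4, -, -, h7, h8⟩ := hv₁ v hv
  have h5 : C * v ^ (-s) ≤ C / √v := by
    rw [div_eq_mul_one_div]
    exact mul_le_mul_of_nonneg_left (rpow_le_inv_sqrt hv1 hs) hC.le
  have h6 : C * v ^ (-(2 * s)) ≤ C / v := by
    rw [div_eq_mul_one_div C v]
    exact mul_le_mul_of_nonneg_left (rpow_le_inv hv1 hs) hC.le
  have hl := S.lapse_pos _ hQ
  have hκ : (S.kappa (a, v))⁻¹ = -(4 * du S.r (a, v)) / S.lapse (a, v) := by
    rw [OneEnded.kappa, inv_div, div_neg, neg_div]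
  rw [hκ] at h7
  obtain ⟨h9, h10⟩ := abs_le.1 (h7.trans hsmall)
  -- `κ⁻¹ = -4 ∂ᵤ r / Ω²` lies in `[1/2, 3/2]`: the lower bound gives `Ω² ≤ -8 ∂ᵤ r`, the upper one
  -- `-∂ᵤ r ≤ (3/8) Ω²`.
  have h11 : 1 / 2 ≤ -(4 * du S.r (a, v)) / S.lapse (a, v) := by linarith
  have h12 : -(4 * du S.r (a, v)) / S.lapse (a, v) ≤ 3 / 2 := by linarith
  rw [le_div_iff₀ hl] at h11
  rw [div_le_iff₀ hl] at h12
  refine ⟨?_, ?_, h8.trans h6, by linarith, by linarith⟩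
  · linarith [norm_nonneg (F.covV q₀ F.φ (a, v))]
  · linarith [norm_nonneg (F.φ (a, v))]

/-- A static Cauchy horizon is not followed by a null segment on which `r` vanishes. -/
theorem singularSegment_eq_empty {S : OneEnded} {F : Matter} {q₀ m2 M e s ui uc : ℝ}
    (hm : 0 ≤ m2) (he0 : 0 < |e|) (he : |e| < M) (hs : 3 / 4 < s) (sol : IsEMKG S F q₀ m2)
    (hc : S.IsCauchyHorizonEnd ui uc) (hst : IsStaticType S F q₀ M e s ui uc) :
    S.singularSegment uc = ∅ := by
  rw [← not_nonempty_iff_eq_empty]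
  rintro ⟨x, hx⟩
  obtain ⟨a, ha, D, hD, hcone⟩ := hst.exists_cone hs
  have hE_u := fun p hp hr => sol.du_quotient_nonpos (p := p) hp hr
  have hE_v := fun p hp hr => sol.dv_quotient_nonpos (p := p) hp hr
  set rm := rMinus M e
  have hrm : 0 < rm := rMinus_pos he0 he
  have hrme : rm < |e| := rMinus_lt he0 he
  set k := -kMinus M e with hk_def
  have hk : 0 < k := neg_pos.2 (kMinus_neg he0 he)
  have hax : a < x := ha.2.trans hx.1
  have hreach : ∀ u ∈ Ico a uc, S.Reaches u := fun u hu =>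
    (OneEnded.cauchyHorizon_of_lt hc ⟨ha.1.trans_le hu.1, hu.2⟩).1
  have hstat : ∀ u ∈ Ico a uc, u ∈ Ioo ui uc := fun u hu => ⟨ha.1.trans_le hu.1, hu.2⟩
  have haa : a ∈ Ico a uc := ⟨le_rfl, ha.2⟩
  -- The assumed point of the singular segment enters here: since `x > uc` reaches `v = ∞`, so do
  -- all cones between `a` and `x`, including `u = uc`.
  obtain ⟨V₁, hV₁⟩ := OneEnded.exists_rectangle_subset_bulk (hreach a haa)
    (hx.2 x ⟨hx.1, le_rfl⟩).1
  have hlim : ∀ u ∈ Ico a uc, Tendsto (fun v => S.r (u, v)) atTop (𝓝 rm) := fun u hu => by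
    simpa using ((hst.extend_r u (hstat u hu)).tendsto_ray (hreach u hu)).add_const (rMinus M e)
  obtain ⟨V₀, hV₀⟩ := eventually_atTop.1 (((eventually_ge_atTop (max V₁ 1)).and hcone).and
    ((hlim a haa).eventually_le_const (by linarith : rm < rm + 1)))
  have hV₁₀ : V₁ ≤ V₀ := (le_max_left _ _).trans (hV₀ V₀ le_rfl).1.1
  have hV₀1 : 1 ≤ V₀ := (le_max_right _ _).trans (hV₀ V₀ le_rfl).1.1
  have hb : ∀ u ∈ Icc a x, ∀ v ≥ V₀, (u, v) ∈ S.bulk := fun u hu v hv => hV₁ v (hV₁₀.trans hv) u hu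
  have hsub : ∀ u ∈ Ico a uc, u ∈ Icc a x := fun u hu => ⟨hu.1, hu.2.le.trans hx.1.le⟩
  -- By `min_r_le`, `r` on the horizon cones is bounded below by its minimum on the compact segment
  -- `v = V₀` or by its limit `rm`; this bound is uniform as `u → uc`.
  obtain ⟨u₀, hu₀, hmin⟩ := isCompact_Icc.exists_isMinOn (nonempty_Icc.2 hax.le)
    (f := fun u => S.r (u, V₀)) fun u hu =>
      (OneEnded.hasDerivAt_r_du (hb u hu V₀ le_rfl)).continuousAt.continuousWithinAt
  set ρ := min (S.r (u₀, V₀)) rm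
  have hρ : 0 < ρ := lt_min (OneEnded.r_pos_of_bulk (hb u₀ hu₀ V₀ le_rfl)) hrm
  have hρr : ∀ u ∈ Ico a uc, ∀ v ≥ V₀, ρ ≤ S.r (u, v) := fun u hu v hv =>
    (min_le_min_right rm (hmin (hsub u hu))).trans
      (OneEnded.min_r_le hE_v hv (fun y hy => hb u (hsub u hu) y hy) (hlim u hu))
  have hR : ∀ u ∈ Icc a x, ∀ v ≥ V₀, S.r (u, v) ≤ rm + 1 := fun u hu v hv =>
    (OneEnded.r_antitone_u hE_u hu.1 fun t ht => hb t ⟨ht.1, ht.2.trans hu.2⟩ v hv).trans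
      (hV₀ v hv).2
  have haX : a ∈ Icc a x := left_mem_Icc.2 hax.le
  have hRD : (rm + 1) * D ≤ (rm + 2) * D := by gcongr; norm_num
  obtain ⟨V, hVV₀, C, hC, hbd⟩ := exists_static_bounds sol hm (a := a) (c := uc) (rm := rm) (e := e)
    (k := k) (V₀ := V₀) (D := (rm + 2) * D) (ρ := ρ) hρ hk hrm hrme hV₀1 (by positivity)
    (fun u hu => hb u (hsub u hu)) hρr (fun u hu => hst.extend_r u (hstat u hu))
    (fun u hu => hst.extend_φ u (hstat u hu)) (fun u hu => hst.extend_Du_φ u (hstat u hu))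
    (fun u hu => hst.extend_charge u (hstat u hu))
    (fun u hu => by
      refine (hst.extend_lapse u (hstat u hu)).congr fun p => ?_
      rw [OneEnded.lam, hk_def]
      ring)
    (fun v hv => ((hV₀ v hv).1.2.1).trans (by
      gcongr
      exact le_mul_of_one_le_left hD (by linarith)))
    (fun v hv => by
      rw [IsEMKG.norm_chi (hb a haX v hv)]
      calc _ ≤ (rm + 1) * (D / √v) := mul_le_mul (hR a haX v hv) (hV₀ v hv).1.2.2.1
            (norm_nonneg _) (by positivity)
        _ = (rm + 1) * D / √v := by ring
        _ ≤ _ := by gcongr)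
    (fun v hv => by
      have hv0 : 0 < v := by linarith
      rw [abs_mul, abs_of_pos (OneEnded.r_pos_of_bulk (hb a haX v hv))]
      calc _ ≤ (rm + 1) * (D / v) := mul_le_mul (hR a haX v hv) (hV₀ v hv).1.2.2.2.1
            (abs_nonneg _) (by positivity)
        _ = (rm + 1) * D / v := by ring
        _ ≤ _ := by gcongr)
    (fun v hv => (hV₀ v hv).1.2.2.2.2.1) (fun v hv => (hV₀ v hv).1.2.2.2.2.2)
  have hV1 : 1 ≤ V := hV₀1.trans hVV₀
  have hend : uc ∈ Icc a x := ⟨ha.2.le, hx.1.le⟩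
  have hbe : ∀ v ≥ V, (uc, v) ∈ S.bulk := fun v hv => hb uc hend v (hVV₀.trans hv)
  -- The constants are the same for all `u < uc`, so at each finite `v` the bounds hold on the cone
  -- `u = uc` by continuity in `u`.
  have hpass : ∀ {f : ℝ × ℝ → ℝ} {v B : ℝ}, ContinuousAt f (uc, v) →
      (∀ u ∈ Ico a uc, f (u, v) ≤ B) → f (uc, v) ≤ B := fun hf h =>
    le_of_forall_Ico_le hf ha.2 h
  have e_r : ∀ v ≥ V, ρ ≤ S.r (uc, v) := fun v hv =>
    neg_le_neg_iff.1 (hpass (f := fun p => -S.r p)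
      (OneEnded.r_contDiffAt (hbe v hv)).continuousAt.neg
      fun u hu => neg_le_neg (hρr u hu v (hVV₀.trans hv)))
  have e_lam : ∀ v ≥ V, S.lam (uc, v) ≤ -k := fun v hv =>
    hpass (OneEnded.lam_contDiffAt (hbe v hv)).continuousAt fun u hu => (hbd u hu v hv).2.2.2.1
  have e_dv : ∀ v ≥ V, -((rm + 2) * D / v) ≤ S.r (uc, v) * dv S.r (uc, v) := fun v hv =>
    neg_le_neg_iff.1 ((neg_neg ((rm + 2) * D / v)).symm ▸
      hpass (f := fun p => -(S.r p * dv S.r p))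
      ((OneEnded.r_contDiffAt (hbe v hv)).continuousAt.mul
        (OneEnded.continuousAt_dv_r (hbe v hv))).neg
      fun u hu => neg_le.1 (hbd u hu v hv).2.2.2.2.1)
  -- The static estimates bound `r ∂ᵥ r` from below only. From above, Raychaudhuri gives `∂ᵥ r ≤ Θ
  -- Ω²`, and the lapse decays exponentially.
  set Θ := |dv S.r (uc, V) / S.lapse (uc, V)|
  set B := (rm + 1) * Θ * (S.lapse (uc, V) * Real.exp (k * V) * (24 / k ^ 4))
  have hlV := OneEnded.lapse_pos_of_bulk (hbe V le_rfl)
  have hB : 0 ≤ B := by positivity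
  have e_dv_le : ∀ v ≥ V, S.r (uc, v) * dv S.r (uc, v) ≤ B / v := by
    intro v hv
    have hv1 : 1 ≤ v := hV1.trans hv
    have hv0 : 0 < v := by linarith
    have h1 := OneEnded.dv_quotient_antitone hE_v hv (u := uc) fun y hy => hbe y hy.1
    have h2 := OneEnded.lapse_pos_of_bulk (hbe v hv)
    have h3 : dv S.r (uc, v) ≤ Θ * S.lapse (uc, v) := by
      rw [← div_le_iff₀ h2]
      exact h1.trans (le_abs_self _)
    have h4 := lapse_le_exp_mul (k := k) hv (fun y hy => hbe y hy.1) fun y hy => e_lam y hy.1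
    have h5 := pow_four_mul_exp_le hk hv0.le
    have h6 := OneEnded.r_pos_of_bulk (hbe v hv)
    have h7 := hR uc hend v (hVV₀.trans hv)
    have h8 : Real.exp (-(k * v)) ≤ 24 / k ^ 4 / v := by
      rw [le_div_iff₀ hv0]
      refine le_trans ?_ h5
      gcongr
      exact le_self_pow₀ hv1 (by norm_num)
    have h9 : S.lapse (uc, v) ≤ S.lapse (uc, V) * Real.exp (k * V) * (24 / k ^ 4 / v) := by
      refine h4.trans ?_
      rw [show -(k * (v - V)) = k * V + -(k * v) by ring, Real.exp_add]
      calc _ = S.lapse (uc, V) * Real.exp (k * V) * Real.exp (-(k * v)) := by ring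
        _ ≤ _ := by gcongr
    calc _ ≤ S.r (uc, v) * (Θ * S.lapse (uc, v)) := by gcongr
      _ ≤ (rm + 1) * (Θ * (S.lapse (uc, V) * Real.exp (k * V) * (24 / k ^ 4 / v))) := by gcongr
      _ = _ := by ring
  set B₀ := C + (rm + 2) * D + B
  have hDD : 0 ≤ (rm + 2) * D := by positivity
  -- The data must be twice as good as the conclusion, hence `ρ / 2` and `k / 2`. The cone `b > uc`
  -- obtained lies in the singular segment, where `r → 0`.
  obtain ⟨b, hbm, hbr⟩ := exists_r_ge_of_cone sol hm (c := uc) (x := x) (V := V) (k := k / 2)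
    (ρ := ρ / 2) (R := rm + 1) (B₀ := B₀) hx.1 hV1 (by positivity) (by positivity) (by positivity)
    (fun u hu v hv => hb u ⟨ha.2.le.trans hu.1, hu.2⟩ v (hVV₀.trans hv))
    (fun u hu v hv => hR u ⟨ha.2.le.trans hu.1, hu.2⟩ v (hVV₀.trans hv))
    (fun v hv => by linarith [e_r v hv]) (fun v hv => by linarith [e_lam v hv])
    (fun v hv => by
      have hv1 : 1 ≤ √v := Real.one_le_sqrt.2 (hV1.trans hv)
      refine hpass (f := fun p => ‖F.φ p‖)
        (sol.smooth_φ _ (OneEnded.mem_of_bulk (hbe v hv))).continuousAt.norm fun u hu => ?_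
      refine (hbd u hu v hv).1.trans ((div_le_self hC hv1).trans ?_)
      simp only [B₀]
      linarith)
    (fun v hv => by
      refine hpass (f := fun p => ‖chi S F q₀ p‖) (sol.continuousAt_chi (hbe v hv)).norm
        fun u hu => (hbd u hu v hv).2.1.trans ?_
      gcongr
      simp only [B₀]
      linarith)
    (fun v hv => by
      have hv0 : 0 < v := by linarith
      have h1 : (rm + 2) * D / v ≤ B₀ / v := by
        gcongr
        simp only [B₀]
        linarith
      have h2 : B / v ≤ B₀ / v := by
        gcongr
        simp only [B₀]
        linarith
      exact abs_le.2 ⟨(neg_le_neg h1).trans (e_dv v hv), (e_dv_le v hv).trans h2⟩)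
    (fun v hv => by
      refine hpass (f := fun p => |F.charge p|)
        (sol.smooth_charge _ (OneEnded.mem_of_bulk (hbe v hv))).continuousAt.abs
        fun u hu => (hbd u hu v hv).2.2.1.trans ?_
      simp only [B₀]
      linarith)
  have hzero := OneEnded.tendsto_r_of_singularSegment hx hbm
  have := ge_of_tendsto hzero ((eventually_ge_atTop V).mono hbr)
  linarith

end Collapse

end

theorem corollary5p2 :
    (∀ (S : Collapse.OneEnded) (F : Collapse.Matter) (q₀ m2 M e s ui uc : ℝ),
      q₀ ≠ 0 → 0 ≤ m2 → 0 < |e| → |e| < M → 3 / 4 < s →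
      Collapse.IsEMKG S F q₀ m2 →
      S.IsTimelikeInfinity ui → S.IsCauchyHorizonEnd ui uc →
      Collapse.IsStaticType S F q₀ M e s ui uc →
      S.singularSegment uc = ∅) ∧
    (∀ (S : Collapse.OneEnded) (ui uc : ℝ) (V : Set (ℝ × EReal)),
      S.NullEnergyCondition →
      S.IsTimelikeInfinity ui → S.IsCauchyHorizonEnd ui uc →
      (S.singularSegment uc).Nonempty →
      IsOpen V → (uc, ⊤) ∈ V → (∀ p ∈ S.Q, Collapse.embed p ∈ V → p ∈ S.trapped) →
      ∃ R : ℝ × EReal → ℝ,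
        (∀ p ∈ S.Q, Collapse.embed p ∈ V → R (Collapse.embed p) = S.r p) ∧
        ContinuousOn R
          (V ∩ (Collapse.embed '' S.Q ∪ (S.cauchyHorizon ui ∪ S.singularSegment uc) ×ˢ {⊤})) ∧
        R (uc, ⊤) = 0) := by
  refine ⟨?_, ?_⟩
  · intro S F q₀ m2 M e s ui uc _ hm he0 he hs sol _ hc hst
    exact Collapse.singularSegment_eq_empty hm he0 he hs sol hc hst
  · intro S ui uc V h _ hc hne hV hVt ht
    exact ⟨S.extendedRadius uc, fun p _ _ => Collapse.OneEnded.extendedRadius_embed p,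
      Collapse.OneEnded.exists_continuous_extension h hc hne hV hVt ht, by
        rw [Collapse.OneEnded.extendedRadius_top, Collapse.OneEnded.boundaryRadius,
          if_neg (lt_irrefl uc)]⟩
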